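/- Let $\mathbb F\in\{\mathbb R,\mathbb C\}$ and let $M$ be a Hausdorff smooth manifold. **Functions.** For a (not necessarily Hausdorff) smooth manifold $X$, $C_c^\infty(X)$ denotes the space of sums $\sum_i f_i|_{U_i}^X$, where $U_i\subset X$ is open and Hausdorff, $f_i$ is a smooth $\mathbb F$-valued function with compact support on $U_i$, and $f_i|_{U_i}^X$ is its extension by zero, regarded as a (not necessarily continuous) section $x\mapsto u_x$ of the sheaf of germs of functions on $X$. For a local diffeomorphism $\varphi:X\to Y$ put $\varphi_+(u)_y=\sum_{x\in\varphi^{-1}(y)}(\varphi_x^*)^{-1}(u_x)$, where $\varphi_x^*$ is composition of germs with $\varphi$. For two local diffeomorphisms $\pi:X\to M$, $\xi:Y\to M$ put $\Omega_{\pi,\xi}(u\otimes v)_{(x,y)}=\mathrm{pr}_1^*(u_x)\,\mathrm{pr}_2^*(v_y)$ on $X\times_M Y$. The space $R=C_c^\infty(M)$ is a commutative algebra under pointwise multiplication. **Hopf algebroids.** Let $R$ be a commutative $\mathbb F$-algebra, perhaps without identity. A Hopf algebroid over $R$ is an associative $\mathbb F$-algebra $A$ (perhaps without identity) which contains $R$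 as a subalgebra and has local identities in $R$ (for any $a_1,\dots,a_k\in A$ there is $r\in R$ with $ra_i=a_ir=a_i$), with $\mathbb F$-linear maps $\Delta:A\to A\otimes_R^{ll}A$ (tensor product for the left $R$-actions on both factors), $\epsilon:A\to R$ and $S:A\to A$ such that: (i) $\Delta,\epsilon$ are left $R$-linear, $(\mathrm{id}\otimes\epsilon)\Delta=\mathrm{id}=(\epsilon\otimes\mathrm{id})\Delta$; (ii) $\epsilon|_R=\mathrm{id}$, $\Delta|_R$ is the canonical map $R\cong R\otimes_RR\to A\otimes_R^{ll}A$, and the two right $R$-actions on $A\otimes_R^{ll}A$ coincide on $\Delta A$; (iii) $\Delta(ab)=\Delta(a)\Delta(b)$; (iv) $S|_R=\mathrm{id}$, $S\circ S=\mathrm{id}$; (v) $S(ab)=S(b)S(a)$; (vi) $\mu\circ(S\otimes\mathrm{id})\circ\Delta=\epsilon\circ S$, where $\mu$ is the multiplication. It is coassociative if $(\Delta\otimes\mathrm{id})\Delta=(\mathrm{id}\otimes\Delta)\Delta$ and cocommutative if $\Delta$ is invariant under the flip. A homomorphism of Hopf algebroids over $R$ is a homomorphism $\alpha$ of algebras with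 $\alpha|_R=\mathrm{id}$, $\epsilon\alpha=\epsilon$, $(\alpha\otimes\alpha)\Delta=\Delta\alpha$, $S\alpha=\alpha S$. **Statement.** Let $G$ be an étale Lie groupoid over $M$, i.e. a groupoid with object manifold $M$ whose arrows form a (not necessarily Hausdorff) smooth manifold $G$ and whose source $s$, target $t$, unit $\mathrm{uni}$, inverse $\mathrm{inv}$ and multiplication $\mathrm{mlt}:G\times_M^{st}G\to G$ are local diffeomorphisms. Then the vector space $C_c^\infty(G)$, with the convolution product $uv=\mathrm{mlt}_+(\Omega_{s,t}(u\otimes v))$, the inclusion $\mathrm{uni}_+:C_c^\infty(M)\to C_c^\infty(G)$, the comultiplication $\Delta=\Omega_{t,t}^{-1}\circ\mathrm{diag}_+$ (i.e. $\Delta u$ is the unique element of $C_c^\infty(G)\otimes^{ll}_{C_c^\infty(M)}C_c^\infty(G)$ mapped by $\Omega_{t,t}$ to $\mathrm{diag}_+(u)$, for the diagonal $\mathrm{diag}:G\to G\times_M^{tt}G$), the counit $\epsilon=t_+$ and the antipode $S=\mathrm{inv}_+$, is a cocommutative coassociative Hopf algebroid over $C_c^\infty(M)$. Moreover, $G\mapsto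 C_c^\infty(G)$, $\varphi\mapsto\varphi_+$ is a functor from the category of étale Lie groupoids over $M$ (with the smooth groupoid morphisms over $M$ that are the identity on $M$) to the category of Hopf algebroids over $C_c^\infty(M)$. -/

import Mathlib

open scoped Manifold ContDiff Topology TensorProduct
open Filter CategoryTheory

universe u v w z

noncomputable section

namespace GroupoidHopf

/-! ### Hopf algebroids over a commutative algebra without identity -/

section Algebra

variable (𝕜 : Type u) [Field 𝕜]
variable (R : Type v) [NonUnitalCommRing R] [Module 𝕜 R] [IsScalarTower 𝕜 R R]
  [SMulCommClass 𝕜 R R]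

/-- An associative `𝕜`-algebra structure (perhaps without identity) on the vector space `A`,
which has the commutative algebra `R` for a subalgebra (through the injective homomorphism
`incl`) and has local identities in `R`. -/
structure AlgebraOver (A : Type w) [AddCommGroup A] [Module 𝕜 A] where
  mul : A →ₗ[𝕜] A →ₗ[𝕜] A
  mul_assoc : ∀ a b c, mul (mul a b) c = mul a (mul b c)
  incl : R →ₗ[𝕜] A
  incl_mul : ∀ r s, incl (r * s) = mul (incl r) (incl s)
  incl_injective : Function.Injective incl
  local_identities : ∀ s : Finset A, ∃ r : R, ∀ a ∈ s,
    mul a (incl r) = a ∧ mul (incl r) a = a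

namespace AlgebraOver

variable {𝕜 R}
variable {A : Type w} [AddCommGroup A] [Module 𝕜 A] (X : AlgebraOver 𝕜 R A)

/-- The left action of `R` on `A`. -/
def lact : R →ₗ[𝕜] A →ₗ[𝕜] A := X.mul ∘ₗ X.incl

/-- The right action of `R` on `A`: `X.ract r a` is `a r`. -/
def ract : R →ₗ[𝕜] A →ₗ[𝕜] A := X.mul.flip ∘ₗ X.incl

theorem lact_apply (r : R) (a : A) : X.lact r a = X.mul (X.incl r) a := rfl

theorem ract_apply (r : R) (a : A) : X.ract r a = X.mul a (X.incl r) := rfl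

theorem lact_mul (r s : R) (a : A) : X.lact (r * s) a = X.lact r (X.lact s a) := by
  simp [lact_apply, X.incl_mul, X.mul_assoc]

theorem lact_comm (r s : R) (a : A) : X.lact r (X.lact s a) = X.lact s (X.lact r a) := by
  rw [← lact_mul, ← lact_mul, mul_comm]

theorem lact_ract (r s : R) (a : A) : X.lact r (X.ract s a) = X.ract s (X.lact r a) := by
  simp [lact_apply, ract_apply, X.mul_assoc]

/-- The subspace of `A ⊗ A` generated by the elements `ra ⊗ b - a ⊗ rb`. -/
def relLL : Submodule 𝕜 (A ⊗[𝕜] A) :=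
  Submodule.span 𝕜 {x | ∃ (r : R) (a b : A), x = X.lact r a ⊗ₜ[𝕜] b - a ⊗ₜ[𝕜] X.lact r b}

/-- The tensor product `A ⊗_R^{ll} A` with respect to the left actions on both factors. -/
abbrev LL := (A ⊗[𝕜] A) ⧸ X.relLL

/-- The quotient projection `A ⊗ A → A ⊗_R^{ll} A`. -/
def mkLL : A ⊗[𝕜] A →ₗ[𝕜] X.LL := X.relLL.mkQ

/-- The subspace of `A ⊗ A` generated by the elements `ar ⊗ b - a ⊗ rb`. -/
def relRL : Submodule 𝕜 (A ⊗[𝕜] A) :=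
  Submodule.span 𝕜 {x | ∃ (r : R) (a b : A), x = X.ract r a ⊗ₜ[𝕜] b - a ⊗ₜ[𝕜] X.lact r b}

/-- The tensor product `A ⊗_R^{rl} A` with respect to the right action on the first factor and
the left action on the second one. -/
abbrev RL := (A ⊗[𝕜] A) ⧸ X.relRL

/-- The quotient projection `A ⊗ A → A ⊗_R^{rl} A`. -/
def mkRL : A ⊗[𝕜] A →ₗ[𝕜] X.RL := X.relRL.mkQ

/-- The relations of the triple tensor product over `R` (left actions on all factors). -/
def relLLL : Submodule 𝕜 (A ⊗[𝕜] (A ⊗[𝕜] A)) :=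
  Submodule.span 𝕜 ({x | ∃ (r : R) (a b c : A),
      x = X.lact r a ⊗ₜ[𝕜] (b ⊗ₜ[𝕜] c) - a ⊗ₜ[𝕜] (X.lact r b ⊗ₜ[𝕜] c)} ∪
    {x | ∃ (r : R) (a b c : A),
      x = a ⊗ₜ[𝕜] (X.lact r b ⊗ₜ[𝕜] c) - a ⊗ₜ[𝕜] (b ⊗ₜ[𝕜] X.lact r c)})

/-- The triple tensor product of `A` over `R` with respect to the left actions. -/
abbrev LLL := (A ⊗[𝕜] (A ⊗[𝕜] A)) ⧸ X.relLLL

section lift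

variable {P : Type z} [AddCommGroup P] [Module 𝕜 P]

/-- The linear map on `A ⊗_R^{ll} A` induced by a balanced bilinear map. -/
def liftLL (f : A →ₗ[𝕜] A →ₗ[𝕜] P)
    (hf : ∀ r a b, f (X.lact r a) b = f a (X.lact r b)) : X.LL →ₗ[𝕜] P :=
  X.relLL.liftQ (TensorProduct.lift f) (by
    rw [relLL, Submodule.span_le]
    rintro _ ⟨r, a, b, rfl⟩
    simp [hf])

@[simp] theorem liftLL_mk (f : A →ₗ[𝕜] A →ₗ[𝕜] P)
    (hf : ∀ r a b, f (X.lact r a) b = f a (X.lact r b)) (a b : A) :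
    X.liftLL f hf (X.mkLL (a ⊗ₜ[𝕜] b)) = f a b := by
  simp [liftLL, mkLL]

/-- The linear map on `A ⊗_R^{rl} A` induced by a balanced bilinear map. -/
def liftRL (f : A →ₗ[𝕜] A →ₗ[𝕜] P)
    (hf : ∀ r a b, f (X.ract r a) b = f a (X.lact r b)) : X.RL →ₗ[𝕜] P :=
  X.relRL.liftQ (TensorProduct.lift f) (by
    rw [relRL, Submodule.span_le]
    rintro _ ⟨r, a, b, rfl⟩
    simp [hf])

variable {X}

theorem hom_ext_LL {f g : X.LL →ₗ[𝕜] P}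
    (h : ∀ a b, f (X.mkLL (a ⊗ₜ[𝕜] b)) = g (X.mkLL (a ⊗ₜ[𝕜] b))) : f = g := by
  apply Submodule.linearMap_qext
  apply TensorProduct.ext'
  exact h

end lift

theorem mkLL_lact (r : R) (a b : A) :
    X.mkLL (X.lact r a ⊗ₜ[𝕜] b) = X.mkLL (a ⊗ₜ[𝕜] X.lact r b) := by
  rw [← sub_eq_zero, ← map_sub, mkLL, Submodule.mkQ_apply, Submodule.Quotient.mk_eq_zero]
  exact Submodule.subset_span ⟨r, a, b, rfl⟩

theorem mkRL_lact (r : R) (a b : A) :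
    X.mkRL (X.ract r a ⊗ₜ[𝕜] b) = X.mkRL (a ⊗ₜ[𝕜] X.lact r b) := by
  rw [← sub_eq_zero, ← map_sub, mkRL, Submodule.mkQ_apply, Submodule.Quotient.mk_eq_zero]
  exact Submodule.subset_span ⟨r, a, b, rfl⟩

/-- `f ⊗ g` on `A ⊗_R^{ll} A`, for left `R`-linear maps `f` and `g`. -/
def mapLL {B : Type z} [AddCommGroup B] [Module 𝕜 B] (Y : AlgebraOver 𝕜 R B)
    (f g : A →ₗ[𝕜] B) (hf : ∀ r a, f (X.lact r a) = Y.lact r (f a))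
    (hg : ∀ r a, g (X.lact r a) = Y.lact r (g a)) : X.LL →ₗ[𝕜] Y.LL :=
  X.liftLL ((TensorProduct.mk 𝕜 B B).compl₁₂ f g |>.compr₂ Y.mkLL) (by
    intro r a b
    simp [hf, hg, Y.mkLL_lact])

@[simp] theorem mapLL_mk {B : Type z} [AddCommGroup B] [Module 𝕜 B] (Y : AlgebraOver 𝕜 R B)
    (f g : A →ₗ[𝕜] B) (hf : ∀ r a, f (X.lact r a) = Y.lact r (f a))
    (hg : ∀ r a, g (X.lact r a) = Y.lact r (g a)) (a b : A) :
    X.mapLL Y f g hf hg (X.mkLL (a ⊗ₜ[𝕜] b)) = Y.mkLL (f a ⊗ₜ[𝕜] g b) := by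
  simp [mapLL]

/-- The left action of `R` on `A ⊗_R^{ll} A`. -/
def lactLL (r : R) : X.LL →ₗ[𝕜] X.LL :=
  X.mapLL X (X.lact r) LinearMap.id (fun s a => X.lact_comm r s a) (fun _ _ => rfl)

/-- The first right action of `R` on `A ⊗_R^{ll} A`: `a ⊗ b ↦ ar ⊗ b`. -/
def ractFst (r : R) : X.LL →ₗ[𝕜] X.LL :=
  X.mapLL X (X.ract r) LinearMap.id (fun s a => (X.lact_ract s r a).symm) (fun _ _ => rfl)

/-- The second right action of `R` on `A ⊗_R^{ll} A`: `a ⊗ b ↦ a ⊗ br`. -/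
def ractSnd (r : R) : X.LL →ₗ[𝕜] X.LL :=
  X.mapLL X LinearMap.id (X.ract r) (fun _ _ => rfl) (fun s a => (X.lact_ract s r a).symm)

/-- The flip `a ⊗ b ↦ b ⊗ a` of `A ⊗_R^{ll} A`. -/
def flipLL : X.LL →ₗ[𝕜] X.LL :=
  X.liftLL ((TensorProduct.mk 𝕜 A A).flip.compr₂ X.mkLL) (by
    intro r a b
    simp [X.mkLL_lact])

/-- The componentwise product of `A ⊗ A`. -/
def mulTensor : A ⊗[𝕜] A →ₗ[𝕜] A ⊗[𝕜] A →ₗ[𝕜] A ⊗[𝕜] A :=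
  TensorProduct.map₂ X.mul X.mul

/-- The multiplication `μ : A ⊗_R^{rl} A → A`. -/
def mulRL : X.RL →ₗ[𝕜] A :=
  X.liftRL X.mul (by intro r a b; simp [lact_apply, ract_apply, X.mul_assoc])

/-- `S ⊗ id : A ⊗_R^{ll} A → A ⊗_R^{rl} A`, for a map `S` which turns the left action of `R` into
the right one. -/
def antipodeId (S : A →ₗ[𝕜] A) (hS : ∀ r a, S (X.lact r a) = X.ract r (S a)) :
    X.LL →ₗ[𝕜] X.RL :=
  X.liftLL ((TensorProduct.mk 𝕜 A A).compl₁₂ S LinearMap.id |>.compr₂ X.mkRL) (by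
    intro r a b
    simp [hS, X.mkRL_lact])

/-- `id ⊗ ε : A ⊗_R^{ll} A → A ⊗_R R = A`. -/
def idCounit (ε : A →ₗ[𝕜] R) (hε : ∀ r a, ε (X.lact r a) = r * ε a) : X.LL →ₗ[𝕜] A :=
  X.liftLL (X.lact ∘ₗ ε).flip (by
    intro r a b
    simp [hε, mul_comm r, X.lact_mul])

/-- `ε ⊗ id : A ⊗_R^{ll} A → R ⊗_R A = A`. -/
def counitId (ε : A →ₗ[𝕜] R) (hε : ∀ r a, ε (X.lact r a) = r * ε a) : X.LL →ₗ[𝕜] A :=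
  X.liftLL (X.lact ∘ₗ ε) (by
    intro r a b
    simp [hε, mul_comm r, X.lact_mul])

/-- The trilinear map `(a, b, c) ↦ a ⊗ b ⊗ c`. -/
def mk₃ : A →ₗ[𝕜] A →ₗ[𝕜] A →ₗ[𝕜] X.LLL where
  toFun a := (TensorProduct.mk 𝕜 A A).compr₂ (TensorProduct.curry X.relLLL.mkQ a)
  map_add' a b := by ext; simp only [map_add]; rfl
  map_smul' c a := by ext; simp only [map_smul]; rfl

theorem mk₃_apply (a b c : A) :
    X.mk₃ a b c = X.relLLL.mkQ (a ⊗ₜ[𝕜] (b ⊗ₜ[𝕜] c)) := rfl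

theorem mk₃_left (r : R) (a b c : A) : X.mk₃ (X.lact r a) b c = X.mk₃ a (X.lact r b) c := by
  rw [← sub_eq_zero, mk₃_apply, mk₃_apply, ← map_sub, Submodule.mkQ_apply,
    Submodule.Quotient.mk_eq_zero]
  exact Submodule.subset_span (Or.inl ⟨r, a, b, c, rfl⟩)

theorem mk₃_right (r : R) (a b c : A) : X.mk₃ a (X.lact r b) c = X.mk₃ a b (X.lact r c) := by
  rw [← sub_eq_zero, mk₃_apply, mk₃_apply, ← map_sub, Submodule.mkQ_apply,
    Submodule.Quotient.mk_eq_zero]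
  exact Submodule.subset_span (Or.inr ⟨r, a, b, c, rfl⟩)

/-- `(x, c) ↦ x ⊗ c` for `x` in `A ⊗_R^{ll} A` and `c` in `A`. -/
def tmulRight : X.LL →ₗ[𝕜] A →ₗ[𝕜] X.LLL :=
  X.liftLL X.mk₃ (by intro r a b; ext c; exact X.mk₃_left r a b c)

/-- `(a, x) ↦ a ⊗ x` for `a` in `A` and `x` in `A ⊗_R^{ll} A`. -/
def tmulLeft : A →ₗ[𝕜] X.LL →ₗ[𝕜] X.LLL where
  toFun a := X.liftLL (X.mk₃ a) (X.mk₃_right · a)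
  map_add' a b := hom_ext_LL (by intros; simp)
  map_smul' c a := hom_ext_LL (by intros; simp)

theorem tmulRight_lact (r : R) (x : X.LL) (c : A) :
    X.tmulRight (X.lactLL r x) c = X.tmulRight x (X.lact r c) := by
  have h : (X.tmulRight.flip c) ∘ₗ X.lactLL r = X.tmulRight.flip (X.lact r c) := by
    apply hom_ext_LL
    intro a b
    simp [tmulRight, lactLL, mk₃_left, mk₃_right]
  exact LinearMap.congr_fun h x

theorem tmulLeft_lact (r : R) (a : A) (x : X.LL) :
    X.tmulLeft (X.lact r a) x = X.tmulLeft a (X.lactLL r x) := by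
  have h : X.tmulLeft (X.lact r a) = X.tmulLeft a ∘ₗ X.lactLL r := by
    apply hom_ext_LL
    intro b c
    simp [tmulLeft, lactLL, mk₃_left]
  exact LinearMap.congr_fun h x

/-- `Δ ⊗ id : A ⊗_R A → A ⊗_R A ⊗_R A`. -/
def comulId (Δ : A →ₗ[𝕜] X.LL) (hΔ : ∀ r a, Δ (X.lact r a) = X.lactLL r (Δ a)) :
    X.LL →ₗ[𝕜] X.LLL :=
  X.liftLL (X.tmulRight ∘ₗ Δ) (by
    intro r a b
    simp [hΔ, X.tmulRight_lact])

/-- `id ⊗ Δ : A ⊗_R A → A ⊗_R A ⊗_R A`. -/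
def idComul (Δ : A →ₗ[𝕜] X.LL) (hΔ : ∀ r a, Δ (X.lact r a) = X.lactLL r (Δ a)) :
    X.LL →ₗ[𝕜] X.LLL :=
  X.liftLL (X.tmulLeft.compl₂ Δ) (by
    intro r a b
    simp [hΔ, X.tmulLeft_lact])

end AlgebraOver

/-- A Hopf algebroid over `R` with underlying vector space `A`. -/
structure HopfAlgebroidStr (A : Type w) [AddCommGroup A] [Module 𝕜 A]
    extends AlgebraOver 𝕜 R A where
  comul : A →ₗ[𝕜] toAlgebraOver.LL
  counit : A →ₗ[𝕜] R
  antipode : A →ₗ[𝕜] A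
  comul_lact : ∀ r a, comul (toAlgebraOver.lact r a) = toAlgebraOver.lactLL r (comul a)
  counit_lact : ∀ r a, counit (toAlgebraOver.lact r a) = r * counit a
  id_counit : ∀ a, toAlgebraOver.idCounit counit counit_lact (comul a) = a
  counit_id : ∀ a, toAlgebraOver.counitId counit counit_lact (comul a) = a
  counit_incl : ∀ r, counit (incl r) = r
  /-- `Δ|_R` is the canonical embedding of `R ≅ R ⊗_R R` (where `r s` corresponds to `r ⊗ s`). -/
  comul_incl : ∀ r s, comul (incl (r * s)) = toAlgebraOver.mkLL (incl r ⊗ₜ[𝕜] incl s)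
  ract_comul : ∀ r a,
    toAlgebraOver.ractFst r (comul a) = toAlgebraOver.ractSnd r (comul a)
  /-- `Δ(ab) = Δ(a)Δ(b)`: the product on the right is computed on arbitrary representatives
  in `A ⊗ A`. -/
  comul_mul : ∀ (a b : A) (x y : A ⊗[𝕜] A),
    toAlgebraOver.mkLL x = comul a → toAlgebraOver.mkLL y = comul b →
      comul (mul a b) = toAlgebraOver.mkLL (toAlgebraOver.mulTensor x y)
  antipode_incl : ∀ r, antipode (incl r) = incl r
  antipode_antipode : ∀ a, antipode (antipode a) = a
  antipode_mul : ∀ a b, antipode (mul a b) = mul (antipode b) (antipode a)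
  mul_antipode_id : ∀ a,
    toAlgebraOver.mulRL (toAlgebraOver.antipodeId antipode
      (fun r a => by
        rw [AlgebraOver.lact_apply, antipode_mul, antipode_incl, AlgebraOver.ract_apply])
      (comul a)) = incl (counit (antipode a))

namespace HopfAlgebroidStr

variable {𝕜 R}
variable {A : Type w} [AddCommGroup A] [Module 𝕜 A] (X : HopfAlgebroidStr 𝕜 R A)

/-- `(Δ ⊗ id) ∘ Δ = (id ⊗ Δ) ∘ Δ`. -/
def IsCoassociative : Prop :=
  ∀ a, X.comulId X.comul X.comul_lact (X.comul a) = X.idComul X.comul X.comul_lact (X.comul a)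

/-- `σ ∘ Δ = Δ` for the flip `σ`. -/
def IsCocommutative : Prop :=
  ∀ a, X.flipLL (X.comul a) = X.comul a

end HopfAlgebroidStr

/-- The objects of the category of Hopf algebroids over `R`. -/
structure HoAlgd where
  carrier : Type w
  [addCommGroup : AddCommGroup carrier]
  [module : Module 𝕜 carrier]
  str : HopfAlgebroidStr 𝕜 R carrier

attribute [instance] HoAlgd.addCommGroup HoAlgd.module

namespace HoAlgd

variable {𝕜 R}

/-- Homomorphisms of Hopf algebroids over `R`. -/
@[ext]
structure Hom (A B : HoAlgd.{u, v, w} 𝕜 R) where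
  toLin : A.carrier →ₗ[𝕜] B.carrier
  map_mul : ∀ a b, toLin (A.str.mul a b) = B.str.mul (toLin a) (toLin b)
  map_incl : ∀ r, toLin (A.str.incl r) = B.str.incl r
  map_counit : ∀ a, B.str.counit (toLin a) = A.str.counit a
  map_comul : ∀ a,
    A.str.mapLL B.str.toAlgebraOver toLin toLin
      (fun r a => by rw [AlgebraOver.lact_apply, map_mul, map_incl, AlgebraOver.lact_apply])
      (fun r a => by rw [AlgebraOver.lact_apply, map_mul, map_incl, AlgebraOver.lact_apply])
      (A.str.comul a) = B.str.comul (toLin a)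
  map_antipode : ∀ a, B.str.antipode (toLin a) = toLin (A.str.antipode a)

/-- The identity homomorphism. -/
def Hom.id (A : HoAlgd.{u, v, w} 𝕜 R) : Hom A A where
  toLin := LinearMap.id
  map_mul _ _ := rfl
  map_incl _ := rfl
  map_counit _ := rfl
  map_comul a := by
    have h : A.str.mapLL A.str.toAlgebraOver LinearMap.id LinearMap.id
        (fun _ _ => rfl) (fun _ _ => rfl) = (LinearMap.id : A.str.LL →ₗ[𝕜] A.str.LL) :=
      AlgebraOver.hom_ext_LL (fun a b => by rw [AlgebraOver.mapLL_mk]; rfl)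
    exact LinearMap.congr_fun h _
  map_antipode _ := rfl

/-- The composition of homomorphisms. -/
def Hom.comp {A B C : HoAlgd.{u, v, w} 𝕜 R} (f : Hom A B) (g : Hom B C) : Hom A C where
  toLin := g.toLin ∘ₗ f.toLin
  map_mul a b := by simp [f.map_mul, g.map_mul]
  map_incl r := by simp [f.map_incl, g.map_incl]
  map_counit a := by simp [f.map_counit, g.map_counit]
  map_comul a := by
    have hA : ∀ r a, f.toLin (A.str.lact r a) = B.str.lact r (f.toLin a) := fun r a => by
      rw [AlgebraOver.lact_apply, f.map_mul, f.map_incl, AlgebraOver.lact_apply]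
    have hB : ∀ r a, g.toLin (B.str.lact r a) = C.str.lact r (g.toLin a) := fun r a => by
      rw [AlgebraOver.lact_apply, g.map_mul, g.map_incl, AlgebraOver.lact_apply]
    have hC : ∀ r a, (g.toLin ∘ₗ f.toLin) (A.str.lact r a) =
        C.str.lact r ((g.toLin ∘ₗ f.toLin) a) := fun r a => by
      rw [LinearMap.comp_apply, hA, hB, LinearMap.comp_apply]
    have h : A.str.mapLL C.str.toAlgebraOver (g.toLin ∘ₗ f.toLin) (g.toLin ∘ₗ f.toLin) hC hC =
        B.str.mapLL C.str.toAlgebraOver g.toLin g.toLin hB hB ∘ₗ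
          A.str.mapLL B.str.toAlgebraOver f.toLin f.toLin hA hA :=
      AlgebraOver.hom_ext_LL (fun a b => by simp)
    rw [LinearMap.comp_apply, ← g.map_comul, ← f.map_comul]
    exact LinearMap.congr_fun h _
  map_antipode a := by simp [f.map_antipode, g.map_antipode]

instance : Category (HoAlgd.{u, v, w} 𝕜 R) where
  Hom := Hom
  id := Hom.id
  comp := Hom.comp

end HoAlgd

end Algebra

/-! ### Smooth functions with compact support on non-Hausdorff manifolds -/

section Sections

variable (𝕜 : Type u) [RCLike 𝕜]

/-- Not necessarily continuous sections of the sheaf of germs of `𝕜`-valued functions on `X`. -/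
abbrev GermSection (X : Type v) [TopologicalSpace X] := (x : X) → Germ (𝓝 x) 𝕜

instance {α : Type v} (l : Filter α) : IsScalarTower 𝕜 (Germ l 𝕜) (Germ l 𝕜) where
  smul_assoc c f g := by
    induction f using Germ.inductionOn with | _ f
    induction g using Germ.inductionOn with | _ g
    simp only [smul_eq_mul]
    rw [← Germ.coe_smul, ← Germ.coe_mul, ← Germ.coe_mul, ← Germ.coe_smul, smul_mul_assoc]

instance {α : Type v} (l : Filter α) : SMulCommClass 𝕜 (Germ l 𝕜) (Germ l 𝕜) where
  smul_comm c f g := by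
    induction f using Germ.inductionOn with | _ f
    induction g using Germ.inductionOn with | _ g
    simp only [smul_eq_mul]
    rw [← Germ.coe_smul, ← Germ.coe_mul, ← Germ.coe_mul, ← Germ.coe_smul, mul_smul_comm]

variable {𝕜}

open scoped Classical in
/-- The extension by zero, as a section of germs, of a function `f` defined on `U`: its value is
the germ of `f` at the points of `U`, and the zero germ elsewhere. -/
def zeroExt {X : Type v} [TopologicalSpace X] (U : Set X) (f : X → 𝕜) : GermSection 𝕜 X :=
  fun x => if x ∈ U then (f : Germ (𝓝 x) 𝕜) else 0

/-- The restriction of `f` to `U` is a smooth function with compact support in `U`. -/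
def SmoothCompactlySupportedOn (E : Type w) [NormedAddCommGroup E] [NormedSpace ℝ E]
    {X : Type v} [TopologicalSpace X] [ChartedSpace E X] (U : Set X) (f : X → 𝕜) : Prop :=
  ContMDiffOn 𝓘(ℝ, E) 𝓘(ℝ, 𝕜) ∞ f U ∧ ∃ K ⊆ U, IsCompact K ∧ ∀ x ∈ U, x ∉ K → f x = 0

variable (𝕜)

/-- The space `C_c^∞(X)` of smooth functions with compact support on a (not necessarily
Hausdorff) manifold `X` modelled on `E`: the sums of extensions by zero of smooth functions with
compact support in Hausdorff open subsets of `X`. -/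
def Cc (E : Type w) [NormedAddCommGroup E] [NormedSpace ℝ E]
    (X : Type v) [TopologicalSpace X] [ChartedSpace E X] : Submodule 𝕜 (GermSection 𝕜 X) :=
  Submodule.span 𝕜 {u | ∃ (U : Set X) (f : X → 𝕜), IsOpen U ∧ T2Space U ∧
    SmoothCompactlySupportedOn E U f ∧ u = zeroExt U f}

theorem Cc_mul_mem {E : Type w} [NormedAddCommGroup E] [NormedSpace ℝ E]
    {X : Type v} [TopologicalSpace X] [ChartedSpace E X] [T2Space X] {a b : GermSection 𝕜 X}
    (ha : a ∈ Cc 𝕜 E X) (hb : b ∈ Cc 𝕜 E X) : a * b ∈ Cc 𝕜 E X := by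
  induction ha using Submodule.span_induction with
  | zero => rw [zero_mul]; exact zero_mem _
  | add x y _ _ hx hy => rw [add_mul]; exact add_mem hx hy
  | smul c x _ hx =>
    rw [smul_mul_assoc]
    exact Submodule.smul_mem _ _ hx
  | mem x hx =>
    obtain ⟨U, f, hU, hU2, ⟨hf, K, hKU, hK, hfK⟩, rfl⟩ := hx
    induction hb using Submodule.span_induction with
    | zero => rw [mul_zero]; exact zero_mem _
    | add x y _ _ hx hy => rw [mul_add]; exact add_mem hx hy
    | smul c x _ hx =>
      rw [mul_smul_comm]
      exact Submodule.smul_mem _ _ hx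
    | mem y hy =>
      obtain ⟨V, g, hV, hV2, ⟨hg, L, hLV, hL, hgL⟩, rfl⟩ := hy
      refine Submodule.subset_span ⟨U ∩ V, f * g, hU.inter hV, inferInstance, ⟨?_, K ∩ L,
        Set.inter_subset_inter hKU hLV, hK.inter hL, ?_⟩, ?_⟩
      · have h1 := hf.mono (Set.inter_subset_left (t := V))
        have h2 := hg.mono (Set.inter_subset_right (s := U))
        intro x hx
        exact (contDiff_mul (𝕜 := ℝ) (𝔸 := 𝕜)).contDiffAt.contMDiffAt.comp_contMDiffWithinAt x
          ((h1 x hx).prodMk_space (h2 x hx))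
      · intro x hx hxK
        by_cases h : x ∈ K
        · simp [hgL x hx.2 fun h' => hxK ⟨h, h'⟩]
        · simp [hfK x hx.1 h]
      · funext x
        by_cases h : x ∈ U <;> by_cases h' : x ∈ V <;> simp [zeroExt, h, h']

/-- For a Hausdorff manifold, `C_c^∞(X)` is a commutative algebra under pointwise
multiplication. -/
def CcAlg (E : Type w) [NormedAddCommGroup E] [NormedSpace ℝ E]
    (X : Type v) [TopologicalSpace X] [T2Space X] [ChartedSpace E X] :
    NonUnitalSubalgebra 𝕜 (GermSection 𝕜 X) :=
  { Cc 𝕜 E X with mul_mem' := Cc_mul_mem 𝕜 }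

variable {X : Type v} [TopologicalSpace X] {Y : Type w} [TopologicalSpace Y]
  {Z : Type z} [TopologicalSpace Z]

/-- The homomorphism `φ_x^*` of germs induced by composition with `φ`, for `φ x = y`. -/
def germPullback (φ : X → Y) {x : X} {y : Y} (h : Tendsto φ (𝓝 x) (𝓝 y)) :
    Germ (𝓝 y) 𝕜 →ₗ[𝕜] Germ (𝓝 x) 𝕜 where
  toFun g := g.compTendsto φ h
  map_add' f g := by
    induction f using Germ.inductionOn
    induction g using Germ.inductionOn
    rfl
  map_smul' c f := by
    induction f using Germ.inductionOn
    rfl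

variable {𝕜}

theorem tendsto_of_isLocalHomeomorph {φ : X → Y} (hφ : IsLocalHomeomorph φ) {x : X} {y : Y}
    (h : φ x = y) : Tendsto φ (𝓝 x) (𝓝 y) :=
  h ▸ hφ.continuous.continuousAt

variable (𝕜) in
theorem germPullback_bijective {φ : X → Y} (hφ : IsLocalHomeomorph φ) {x : X} {y : Y}
    (h : φ x = y) :
    Function.Bijective (germPullback 𝕜 φ (tendsto_of_isLocalHomeomorph hφ h)) := by
  subst h
  constructor
  · intro f g hfg
    induction f using Germ.inductionOn with | _ f
    induction g using Germ.inductionOn with | _ g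
    have : ((f ∘ φ : X → 𝕜) : Germ (𝓝 x) 𝕜) = ((g ∘ φ : X → 𝕜) : Germ (𝓝 x) 𝕜) := hfg
    rw [Germ.coe_eq] at this ⊢
    rw [← hφ.map_nhds_eq x]
    exact this
  · intro g
    induction g using Germ.inductionOn with | _ g
    obtain ⟨e, hx, rfl⟩ := hφ x
    refine ⟨((g ∘ e.symm : Y → 𝕜) : Germ (𝓝 (e x)) 𝕜), ?_⟩
    change ((g ∘ e.symm ∘ e : X → 𝕜) : Germ (𝓝 x) 𝕜) = _
    rw [Germ.coe_eq]
    filter_upwards [e.open_source.mem_nhds hx] with y hy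
    simp [e.left_inv hy]

variable (𝕜) in
/-- The isomorphism `φ_{*x}` of germs inverse to `φ_x^*`, for a local homeomorphism `φ` with
`φ x = y`. -/
def germPushforward {φ : X → Y} (hφ : IsLocalHomeomorph φ) {x : X} {y : Y} (h : φ x = y) :
    Germ (𝓝 x) 𝕜 ≃ₗ[𝕜] Germ (𝓝 y) 𝕜 :=
  (LinearEquiv.ofBijective _ (germPullback_bijective 𝕜 hφ h)).symm

/-- The push-forward `φ_+` along a local homeomorphism: the value at `y` is the sum of the germs
`φ_{*x}(u_x)` over all `x` in the fibre of `y`. -/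
def pushforward {φ : X → Y} (hφ : IsLocalHomeomorph φ) (u : GermSection 𝕜 X) :
    GermSection 𝕜 Y :=
  fun y => ∑ᶠ x : {x : X // φ x = y}, germPushforward 𝕜 hφ x.2 (u x.1)

theorem tendsto_pullback_fst {π : X → Z} {ξ : Y → Z} (p : π.Pullback ξ) :
    Tendsto (fun q : π.Pullback ξ => q.1.1) (𝓝 p) (𝓝 p.1.1) :=
  (continuous_fst.comp continuous_subtype_val).tendsto p

theorem tendsto_pullback_snd {π : X → Z} {ξ : Y → Z} (p : π.Pullback ξ) :
    Tendsto (fun q : π.Pullback ξ => q.1.2) (𝓝 p) (𝓝 p.1.2) :=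
  (continuous_snd.comp continuous_subtype_val).tendsto p

variable (𝕜) in
/-- The bilinear map `Ω_{π,ξ}` which sends `(u, v)` to the section of germs on the fibred product
with the value `pr₁^*(u_x) pr₂^*(v_y)` at `(x, y)`. -/
def extProd (π : X → Z) (ξ : Y → Z) :
    GermSection 𝕜 X →ₗ[𝕜] GermSection 𝕜 Y →ₗ[𝕜] GermSection 𝕜 (π.Pullback ξ) :=
  LinearMap.mk₂ 𝕜
    (fun u v p => germPullback 𝕜 _ (tendsto_pullback_fst p) (u p.1.1) *
      germPullback 𝕜 _ (tendsto_pullback_snd p) (v p.1.2))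
    (by intros; funext p; simp [add_mul])
    (by
      intro c u v
      funext p
      simp only [Pi.smul_apply, map_smul]
      exact smul_mul_assoc c _ _)
    (by intros; funext p; simp [mul_add])
    (by
      intro c u v
      funext p
      simp only [Pi.smul_apply, map_smul]
      exact mul_smul_comm c _ _)

variable (𝕜) in
/-- The linear map `Ω_{π,ξ}` on the tensor product over the base field. -/
def extProdTensor (E : Type*) [NormedAddCommGroup E] [NormedSpace ℝ E] [ChartedSpace E X]
    [ChartedSpace E Y] (π : X → Z) (ξ : Y → Z) :
    Cc 𝕜 E X ⊗[𝕜] Cc 𝕜 E Y →ₗ[𝕜] GermSection 𝕜 (π.Pullback ξ) :=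
  TensorProduct.lift ((extProd 𝕜 π ξ).domRestrict₁₂ (Cc 𝕜 E X) (Cc 𝕜 E Y))

/-- The projection of a fibred product along a local homeomorphism is a local homeomorphism. -/
theorem isLocalHomeomorph_pullback_fst {π : X → Z} {ξ : Y → Z} (hπ : Continuous π)
    (hξ : IsLocalHomeomorph ξ) :
    IsLocalHomeomorph (fun q : π.Pullback ξ => q.1.1) := by
  classical
  refine IsLocalHomeomorph.mk _ fun p => ?_
  obtain ⟨e, he, rfl⟩ := hξ p.1.2
  have hc2 : Continuous (fun q : π.Pullback e => q.1.2) :=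
    continuous_snd.comp continuous_subtype_val
  refine ⟨{ toFun := fun q => q.1.1
            invFun := fun x => if h : π x = e (e.symm (π x)) then ⟨(x, e.symm (π x)), h⟩ else p
            source := {q | q.1.2 ∈ e.source}
            target := {x | π x ∈ e.target}
            map_source' := ?_
            map_target' := ?_
            left_inv' := ?_
            right_inv' := ?_
            open_source := e.open_source.preimage hc2
            open_target := e.open_target.preimage hπ
            continuousOn_toFun := (continuous_fst.comp continuous_subtype_val).continuousOn
            continuousOn_invFun := ?_ }, he, fun _ _ => rfl⟩
  · intro q hq
    change π q.1.1 ∈ e.target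
    rw [q.2]
    exact e.map_source hq
  · intro x hx
    have h : π x = e (e.symm (π x)) := (e.right_inv hx).symm
    rw [dif_pos h]
    exact e.map_target hx
  · intro q hq
    have h : e.symm (π q.1.1) = q.1.2 := by rw [q.2]; exact e.left_inv hq
    have h' : π q.1.1 = e (e.symm (π q.1.1)) := by rw [h]; exact q.2
    rw [dif_pos h']
    exact Subtype.ext (Prod.ext rfl h)
  · intro x hx
    have h : π x = e (e.symm (π x)) := (e.right_inv hx).symm
    rw [dif_pos h]
  · refine (Topology.IsInducing.continuousOn_iff (Topology.IsInducing.subtypeVal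
      (t := {q : X × Y | π q.1 = e q.2}))).2 ?_
    have : ContinuousOn (fun x => (x, e.symm (π x))) {x | π x ∈ e.target} :=
      continuousOn_id.prodMk (e.continuousOn_symm.comp hπ.continuousOn fun x hx => hx)
    refine this.congr fun x hx => ?_
    have h : π x = e (e.symm (π x)) := (e.right_inv hx).symm
    simp only [Function.comp_apply]
    rw [dif_pos h]

/-- The diagonal `Y → Y ×_Z Y` of a local homeomorphism is a local homeomorphism. -/
theorem isLocalHomeomorph_diag {ξ : Y → Z} (hξ : IsLocalHomeomorph ξ) :
    IsLocalHomeomorph (fun y => (⟨(y, y), rfl⟩ : ξ.Pullback ξ)) :=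
  IsLocalHomeomorph.of_comp (g := fun q : ξ.Pullback ξ => q.1.1)
    (Homeomorph.refl Y).isLocalHomeomorph
    (isLocalHomeomorph_pullback_fst hξ.continuous hξ)
    ((continuous_id.prodMk continuous_id).subtype_mk _)

/-- The charts on `X` obtained from those on `Y` by composition with local inverses of a local
homeomorphism `X → Y`. -/
@[reducible] def chartedSpaceOfLocalHomeomorph (E : Type*) [TopologicalSpace E]
    [ChartedSpace E Y] {φ : X → Y} (hφ : IsLocalHomeomorph φ) : ChartedSpace E X where
  atlas := Set.range fun x => (hφ x).choose.trans (chartAt E (φ x))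
  chartAt x := (hφ x).choose.trans (chartAt E (φ x))
  mem_chart_source x := by
    have h := (hφ x).choose_spec
    rw [OpenPartialHomeomorph.trans_source]
    refine ⟨h.1, ?_⟩
    rw [Set.mem_preimage, ← congrFun h.2 x]
    exact mem_chart_source E (φ x)
  chart_mem_atlas x := ⟨x, rfl⟩

/-- A map `m` from the fibred product of `π` and the sheaf `ξ` is a local diffeomorphism, for the
smooth structure on the fibred product which makes the first projection a local
diffeomorphism. -/
def IsLocalDiffeomorphOnPullback (E : Type*) [NormedAddCommGroup E] [NormedSpace ℝ E]
    [ChartedSpace E X] {W : Type*} [TopologicalSpace W] [ChartedSpace E W]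
    {π : X → Z} {ξ : Y → Z} (hπ : Continuous π) (hξ : IsLocalHomeomorph ξ)
    (m : π.Pullback ξ → W) : Prop :=
  letI : ChartedSpace E (π.Pullback ξ) :=
    chartedSpaceOfLocalHomeomorph E (isLocalHomeomorph_pullback_fst hπ hξ)
  IsLocalDiffeomorph 𝓘(ℝ, E) 𝓘(ℝ, E) ∞ m

end Sections

/-! ### Étale Lie groupoids -/

/-- An étale Lie groupoid over the manifold `M`; the manifold of arrows need not be Hausdorff. -/
structure EtGrpd (E : Type v) [NormedAddCommGroup E] [NormedSpace ℝ E]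
    (M : Type w) [TopologicalSpace M] [ChartedSpace E M] where
  Arrow : Type u
  [topologicalSpace : TopologicalSpace Arrow]
  [chartedSpace : ChartedSpace E Arrow]
  [isManifold : IsManifold 𝓘(ℝ, E) ∞ Arrow]
  src : Arrow → M
  tgt : Arrow → M
  unit : M → Arrow
  inv : Arrow → Arrow
  mul : src.Pullback tgt → Arrow
  src_isLocalDiffeomorph : IsLocalDiffeomorph 𝓘(ℝ, E) 𝓘(ℝ, E) ∞ src
  tgt_isLocalDiffeomorph : IsLocalDiffeomorph 𝓘(ℝ, E) 𝓘(ℝ, E) ∞ tgt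
  unit_isLocalDiffeomorph : IsLocalDiffeomorph 𝓘(ℝ, E) 𝓘(ℝ, E) ∞ unit
  inv_isLocalDiffeomorph : IsLocalDiffeomorph 𝓘(ℝ, E) 𝓘(ℝ, E) ∞ inv
  mul_isLocalDiffeomorph : IsLocalDiffeomorphOnPullback E
    src_isLocalDiffeomorph.isLocalHomeomorph.continuous
    tgt_isLocalDiffeomorph.isLocalHomeomorph mul
  src_unit : ∀ x, src (unit x) = x
  tgt_unit : ∀ x, tgt (unit x) = x
  src_inv : ∀ g, src (inv g) = tgt g
  tgt_inv : ∀ g, tgt (inv g) = src g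
  src_mul : ∀ p, src (mul p) = src p.1.2
  tgt_mul : ∀ p, tgt (mul p) = tgt p.1.1
  unit_mul : ∀ g, mul ⟨(unit (tgt g), g), src_unit _⟩ = g
  mul_unit : ∀ g, mul ⟨(g, unit (src g)), (tgt_unit _).symm⟩ = g
  inv_mul : ∀ g, mul ⟨(inv g, g), src_inv g⟩ = unit (src g)
  mul_inv : ∀ g, mul ⟨(g, inv g), (tgt_inv g).symm⟩ = unit (tgt g)
  mul_assoc : ∀ (g h k : Arrow) (hgh : src g = tgt h) (hhk : src h = tgt k),
    mul ⟨(mul ⟨(g, h), hgh⟩, k), (src_mul _).trans hhk⟩ =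
      mul ⟨(g, mul ⟨(h, k), hhk⟩), hgh.trans (tgt_mul ⟨(h, k), hhk⟩).symm⟩

namespace EtGrpd

attribute [instance] EtGrpd.topologicalSpace EtGrpd.chartedSpace EtGrpd.isManifold

variable {E : Type v} [NormedAddCommGroup E] [NormedSpace ℝ E]
  {M : Type w} [TopologicalSpace M] [ChartedSpace E M]

section structureMaps

variable (G : EtGrpd.{u} E M)

theorem src_isLocalHomeomorph : IsLocalHomeomorph G.src :=
  G.src_isLocalDiffeomorph.isLocalHomeomorph

theorem tgt_isLocalHomeomorph : IsLocalHomeomorph G.tgt :=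
  G.tgt_isLocalDiffeomorph.isLocalHomeomorph

theorem unit_isLocalHomeomorph : IsLocalHomeomorph G.unit :=
  G.unit_isLocalDiffeomorph.isLocalHomeomorph

theorem inv_isLocalHomeomorph : IsLocalHomeomorph G.inv :=
  G.inv_isLocalDiffeomorph.isLocalHomeomorph

theorem mul_isLocalHomeomorph : IsLocalHomeomorph G.mul :=
  letI : ChartedSpace E (G.src.Pullback G.tgt) :=
    chartedSpaceOfLocalHomeomorph E (isLocalHomeomorph_pullback_fst
      G.src_isLocalHomeomorph.continuous G.tgt_isLocalHomeomorph)
  IsLocalDiffeomorph.isLocalHomeomorph G.mul_isLocalDiffeomorph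

end structureMaps

/-- Morphisms of étale Lie groupoids over `M`. -/
@[ext]
structure Hom (G H : EtGrpd.{u} E M) where
  toFun : G.Arrow → H.Arrow
  contMDiff : ContMDiff 𝓘(ℝ, E) 𝓘(ℝ, E) ∞ toFun
  map_unit : ∀ x, toFun (G.unit x) = H.unit x
  src_map : ∀ g, H.src (toFun g) = G.src g
  tgt_map : ∀ g, H.tgt (toFun g) = G.tgt g
  map_mul : ∀ p : G.src.Pullback G.tgt, toFun (G.mul p) =
    H.mul ⟨(toFun p.1.1, toFun p.1.2), by
      rw [src_map, tgt_map]
      exact p.2⟩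

instance : Category (EtGrpd.{u} E M) where
  Hom := Hom
  id G :=
    { toFun := id
      contMDiff := contMDiff_id
      map_unit := fun _ => rfl
      src_map := fun _ => rfl
      tgt_map := fun _ => rfl
      map_mul := fun _ => rfl }
  comp f g :=
    { toFun := g.toFun ∘ f.toFun
      contMDiff := g.contMDiff.comp f.contMDiff
      map_unit := fun x => by simp [f.map_unit, g.map_unit]
      src_map := fun x => by simp [f.src_map, g.src_map]
      tgt_map := fun x => by simp [f.tgt_map, g.tgt_map]
      map_mul := fun p => by simp [f.map_mul, g.map_mul] }

theorem Hom.isLocalHomeomorph {G H : EtGrpd.{u} E M} (φ : G ⟶ H) :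
    IsLocalHomeomorph (Hom.toFun φ) :=
  IsLocalHomeomorph.of_comp (g := H.tgt)
    (by
      have : H.tgt ∘ Hom.toFun φ = G.tgt := funext (Hom.tgt_map φ)
      rw [this]
      exact G.tgt_isLocalHomeomorph)
    H.tgt_isLocalHomeomorph (Hom.contMDiff φ).continuous

end EtGrpd

/-- The structure maps of the Hopf algebroid structure `X` on `C_c^∞(G)` over `C_c^∞(M)` are the
canonical ones. -/
structure IsGroupoidHopfAlgebroid {𝕜 : Type z} [RCLike 𝕜]
    {E : Type v} [NormedAddCommGroup E] [NormedSpace ℝ E]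
    {M : Type w} [TopologicalSpace M] [T2Space M] [ChartedSpace E M] (G : EtGrpd.{u} E M)
    (X : HopfAlgebroidStr 𝕜 (CcAlg 𝕜 E M) (Cc 𝕜 E G.Arrow)) : Prop where
  /-- The convolution product `mlt_+ ∘ Ω_{s,t}`. -/
  mul_eq : ∀ u v, (X.mul u v : GermSection 𝕜 G.Arrow) =
    pushforward G.mul_isLocalHomeomorph (extProd 𝕜 G.src G.tgt u v)
  /-- `C_c^∞(M)` is embedded in `C_c^∞(G)` through the unit map. -/
  incl_eq : ∀ p, (X.incl p : GermSection 𝕜 G.Arrow) =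
    pushforward G.unit_isLocalHomeomorph (p : GermSection 𝕜 M)
  /-- The comultiplication `Ω_{t,t}⁻¹ ∘ diag_+` of the target sheaf: `Δ u` is the unique element
  of `C_c^∞(G) ⊗_{C_c^∞(M)}^{ll} C_c^∞(G)` which `Ω_{t,t}` maps to `diag_+ u`. -/
  comul_eq : ∀ u x, X.comul u = X.mkLL x ↔
    extProdTensor 𝕜 E G.tgt G.tgt x =
      pushforward (isLocalHomeomorph_diag G.tgt_isLocalHomeomorph) (u : GermSection 𝕜 G.Arrow)
  /-- The counit `t_+`. -/
  counit_eq : ∀ u, (X.counit u : GermSection 𝕜 M) =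
    pushforward G.tgt_isLocalHomeomorph (u : GermSection 𝕜 G.Arrow)
  /-- The antipode `inv_+`. -/
  antipode_eq : ∀ u, (X.antipode u : GermSection 𝕜 G.Arrow) =
    pushforward G.inv_isLocalHomeomorph (u : GermSection 𝕜 G.Arrow)

end GroupoidHopf

end

/-!
A smooth partition of unity writes every element of `C_c^∞(G)` as a sum of extensions by zero of
functions `a` on open bisections, that is, on open sets on which `s` and `t` are both injective.
On such functions the structure maps are explicit: the product of `a` and `b` is the function
`g h ↦ a g * b h` on the product of the two bisections, `ε` and `S` transport `a` along `t` and
`inv`, and `Δ a = a ⊗ 1_a` for any function `1_a` on the bisection of `a` which is `1` on the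
support of `a`. All the maps being additive, the axioms reduce to pointwise identities between
functions on bisections.

What remains is that `Ω_{t,t}` is injective, so that `Δ` is well defined. An element of
`A ⊗_R A` vanishes as soon as it is killed near every point `y` of `M` by some `r ∈ R` equal to `1`
near `y`. Near `y` each element is a combination `∑ r_{g,h} (1_g ⊗ 1_h)` over the pairs `(g, h)`
of arrows with target `y`, where `1_g` is a function on a bisection which is `1` near `g`, and the
germ of `Ω_{t,t}` at `(g, h)` recovers the germ of the coefficient `r_{g,h}` at `y`.
-/

noncomputable section

namespace GroupoidHopf

/-! ### Germs and push-forward -/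

theorem finsum_fiberwise {α β N : Type*} [AddCommMonoid N] {g : α → N}
    (hg : g.support.Finite) (p : α → β) :
    ∑ᶠ b, ∑ᶠ a : {a // p a = b}, g a = ∑ᶠ a, g a := by
  classical
  have inner (b : β) : ∑ᶠ a : {a // p a = b}, g a = ∑ a ∈ hg.toFinset with p a = b, g a :=
    (finsum_set_coe_eq_finsum_mem {a | p a = b}).trans (finsum_mem_eq_sum_filter g _ hg)
  rw [finsum_congr inner, finsum_eq_sum_of_support_subset g hg.coe_toFinset.ge,
    finsum_eq_sum_of_support_subset (s := hg.toFinset.image p)]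
  · exact Finset.sum_fiberwise_of_maps_to (fun a => Finset.mem_image_of_mem p) g
  · intro b hb
    obtain ⟨a, ha, -⟩ := Finset.exists_ne_zero_of_sum_ne_zero hb
    obtain ⟨ha', rfl⟩ := Finset.mem_filter.1 ha
    exact Finset.mem_coe.2 (Finset.mem_image_of_mem p ha')

theorem exists_forall_comp_eq_of_injOn {α β γ : Type*} [Zero γ] {φ : α → β} {V : Set α}
    (hinj : Set.InjOn φ V) (f : α → γ) : ∃ F : β → γ, ∀ x ∈ V, F (φ x) = f x := by
  have h : (V.domRestrict φ).Injective := Set.injOn_iff_injective.1 hinj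
  exact ⟨Function.extend (V.domRestrict φ) (V.domRestrict f) 0,
    fun x hx => h.extend_apply _ _ ⟨x, hx⟩⟩

section Topology

variable {X Y : Type*} [TopologicalSpace X] [TopologicalSpace Y]

theorem isOpen_diff_of_isCompact {U K : Set X} (hU : IsOpen U) [T2Space U] (hK : IsCompact K)
    (hKU : K ⊆ U) : IsOpen (U \ K) := by
  have hK' : IsCompact ((↑) ⁻¹' K : Set U) := by
    rwa [Topology.IsInducing.subtypeVal.isCompact_iff, Subtype.image_preimage_coe,
      Set.inter_eq_right.2 hKU]
  convert hU.isOpenMap_subtype_val _ hK'.isClosed.isOpen_compl using 1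
  ext x
  simp

theorem t2Space_of_subset {U V : Set X} [T2Space U] (hVU : V ⊆ U) : T2Space V :=
  (Topology.IsEmbedding.inclusion hVU).t2Space

theorem t2Space_image {φ : X → Y} (hφ : IsLocalHomeomorph φ) {V : Set X} (hV : IsOpen V)
    [T2Space V] (hinj : Set.InjOn φ V) : T2Space (φ '' V) := by
  have h : Topology.IsOpenEmbedding (V.domRestrict φ) :=
    .of_continuous_injective_isOpenMap (hφ.continuous.comp continuous_subtype_val)
      (Set.injOn_iff_injective.1 hinj) (hφ.isOpenMap.comp hV.isOpenMap_subtype_val)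
  rw [← Set.range_domRestrict φ V]
  exact h.toIsEmbedding.toHomeomorph.t2Space

theorem isOpen_pullback_prod {Z : Type*} (π : X → Z) (ξ : Y → Z) {U : Set X} {V : Set Y}
    (hU : IsOpen U) (hV : IsOpen V) : IsOpen {q : π.Pullback ξ | q.1.1 ∈ U ∧ q.1.2 ∈ V} :=
  (hU.prod hV).preimage continuous_subtype_val

/-- The cut-off functions `χ` on which we glue form a class containing `0` and closed under
`(χ, χ') ↦ χ + χ' - χ χ'`, an operation for which `1` is absorbing. -/
theorem exists_eventually_eq_one_of_isCompact {S : Type*} [CommRing S] {p : (X → S) → Prop}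
    (zero : p 0) (union : ∀ χ χ', p χ → p χ' → p (χ + χ' - χ * χ')) {K : Set X}
    (hK : IsCompact K) (local_one : ∀ x ∈ K, ∃ χ, p χ ∧ ∀ᶠ y in 𝓝 x, χ y = 1) :
    ∃ χ, p χ ∧ ∀ᶠ y in 𝓝ˢ K, χ y = 1 := by
  refine hK.induction_on (p := fun s => ∃ χ, p χ ∧ ∀ᶠ y in 𝓝ˢ s, χ y = 1) ?_ ?_ ?_ ?_
  · exact ⟨0, zero, by simp⟩
  · rintro s t hst ⟨χ, hχ, h⟩
    exact ⟨χ, hχ, h.filter_mono (nhdsSet_mono hst)⟩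
  · rintro s t ⟨χ, hχ, h⟩ ⟨χ', hχ', h'⟩
    refine ⟨χ + χ' - χ * χ', union χ χ' hχ hχ', ?_⟩
    rw [nhdsSet_union, eventually_sup]
    constructor
    · filter_upwards [h] with y hy
      simp [hy]
    · filter_upwards [h'] with y hy
      simp [hy]
  · intro x hx
    obtain ⟨χ, hχ, h⟩ := local_one x hx
    obtain ⟨W, hW1, hW, hxW⟩ := eventually_nhds_iff.1 h
    exact ⟨W, mem_nhdsWithin_of_mem_nhds (hW.mem_nhds hxW), χ, hχ,
      mem_of_superset hW.mem_nhdsSet_self hW1⟩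

end Topology

section Germs

variable {𝕜 : Type z} [RCLike 𝕜] {X : Type u} [TopologicalSpace X] {Y : Type v}
  [TopologicalSpace Y] {Z : Type w} [TopologicalSpace Z]

section ZeroExt

variable {U V : Set X} {x : X} {f g : X → 𝕜}

theorem zeroExt_of_mem (h : x ∈ U) (f : X → 𝕜) : zeroExt U f x = (f : Germ (𝓝 x) 𝕜) := if_pos h

theorem zeroExt_of_notMem (h : x ∉ U) (f : X → 𝕜) : zeroExt U f x = 0 := if_neg h

theorem zeroExt_congr (hU : IsOpen U) (hfg : Set.EqOn f g U) : zeroExt U f = zeroExt U g := by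
  funext x
  by_cases hx : x ∈ U
  · rw [zeroExt_of_mem hx, zeroExt_of_mem hx, Germ.coe_eq]
    exact hfg.eventuallyEq_of_mem (hU.mem_nhds hx)
  · rw [zeroExt_of_notMem hx, zeroExt_of_notMem hx]

theorem zeroExt_zero (U : Set X) : zeroExt U (0 : X → 𝕜) = 0 := by
  funext x
  by_cases hx : x ∈ U <;> simp [zeroExt, hx]

theorem zeroExt_add (U : Set X) (f g : X → 𝕜) :
    zeroExt U (f + g) = zeroExt U f + zeroExt U g := by
  funext x
  by_cases hx : x ∈ U <;> simp [zeroExt, hx]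

theorem zeroExt_sub (U : Set X) (f g : X → 𝕜) :
    zeroExt U (f - g) = zeroExt U f - zeroExt U g := by
  funext x
  by_cases hx : x ∈ U <;> simp [zeroExt, hx]

theorem zeroExt_smul (U : Set X) (c : 𝕜) (f : X → 𝕜) :
    zeroExt U (c • f) = c • zeroExt U f := by
  funext x
  by_cases hx : x ∈ U <;> simp [zeroExt, hx]

theorem zeroExt_mul_zeroExt (U V : Set X) (f g : X → 𝕜) :
    zeroExt U f * zeroExt V g = zeroExt (U ∩ V) (f * g) := by
  funext x
  by_cases h : x ∈ U <;> by_cases h' : x ∈ V <;> simp [zeroExt, h, h']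

theorem zeroExt_eq_zeroExt_of_subset (hVU : V ⊆ U)
    (hf : ∀ x ∈ U \ V, ∀ᶠ y in 𝓝 x, f y = 0) : zeroExt U f = zeroExt V f := by
  funext x
  by_cases hxV : x ∈ V
  · rw [zeroExt_of_mem hxV, zeroExt_of_mem (hVU hxV)]
  · rw [zeroExt_of_notMem hxV]
    by_cases hxU : x ∈ U
    · rw [zeroExt_of_mem hxU, ← Germ.coe_zero, Germ.coe_eq]
      exact hf x ⟨hxU, hxV⟩
    · rw [zeroExt_of_notMem hxU]

end ZeroExt

section Pushforward

variable {φ : X → Y} {ψ : Y → Z}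

theorem germPullback_coe (φ : X → Y) {x : X} {y : Y} (h : Tendsto φ (𝓝 x) (𝓝 y)) (f : Y → 𝕜) :
    germPullback 𝕜 φ h (f : Germ (𝓝 y) 𝕜) = ((f ∘ φ : X → 𝕜) : Germ (𝓝 x) 𝕜) := rfl

theorem germPushforward_eq_iff (hφ : IsLocalHomeomorph φ) {x : X} {y : Y} (h : φ x = y)
    {a : Germ (𝓝 x) 𝕜} {b : Germ (𝓝 y) 𝕜} : germPushforward 𝕜 hφ h a = b ↔
      a = germPullback 𝕜 φ (tendsto_of_isLocalHomeomorph hφ h) b :=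
  LinearEquiv.symm_apply_eq _

theorem germPushforward_coe (hφ : IsLocalHomeomorph φ) {x : X} {y : Y} (h : φ x = y)
    {f : X → 𝕜} {F : Y → 𝕜} (hF : F ∘ φ =ᶠ[𝓝 x] f) :
    germPushforward 𝕜 hφ h (f : Germ (𝓝 x) 𝕜) = (F : Germ (𝓝 y) 𝕜) := by
  rw [germPushforward_eq_iff, germPullback_coe, Germ.coe_eq]
  exact hF.symm

theorem germPushforward_germPushforward (hφ : IsLocalHomeomorph φ) (hψ : IsLocalHomeomorph ψ)
    {χ : X → Z} (hχ : IsLocalHomeomorph χ) (h : ∀ x, ψ (φ x) = χ x) {x : X} {y : Y} {z : Z}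
    (hxy : φ x = y) (hyz : ψ y = z) (hxz : χ x = z) (a : Germ (𝓝 x) 𝕜) :
    germPushforward 𝕜 hψ hyz (germPushforward 𝕜 hφ hxy a) = germPushforward 𝕜 hχ hxz a := by
  obtain rfl : ψ ∘ φ = χ := funext h
  obtain ⟨b, rfl⟩ := (germPushforward 𝕜 hχ hxz).symm.surjective a
  rw [LinearEquiv.apply_symm_apply, germPushforward_eq_iff, germPushforward_eq_iff]
  induction b using Germ.inductionOn
  rfl

section FiberFinite

variable {X Y Z : Type*} [TopologicalSpace X] {φ : X → Y} {ψ : Y → Z} {u : GermSection 𝕜 X}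

variable (𝕜) in
/-- The sections of germs with finite support on every fibre of `φ`: the domain on which the
finite sums over fibres defining `pushforward` are not junk. -/
def fiberFinite (φ : X → Y) : Submodule 𝕜 (GermSection 𝕜 X) where
  carrier := {u | ∀ y, {x : {x // φ x = y} | u x.1 ≠ 0}.Finite}
  zero_mem' y := by simp
  add_mem' {a b} ha hb y := by
    refine ((ha y).union (hb y)).subset fun x hx => ?_
    by_contra h
    simp only [Set.mem_union, Set.mem_ofPred_eq, not_or, not_not] at h
    exact hx (by rw [Pi.add_apply, h.1, h.2, add_zero])
  smul_mem' c a ha y := by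
    refine (ha y).subset fun x hx h => hx ?_
    rw [Pi.smul_apply, h, smul_zero]

theorem mem_fiberFinite_of_comp (hu : u ∈ fiberFinite 𝕜 (ψ ∘ φ)) : u ∈ fiberFinite 𝕜 φ := by
  refine fun y => .of_finite_image ((hu (ψ y)).subset ?_)
    (f := fun x : {x // φ x = y} => (⟨x.1, congrArg ψ x.2⟩ : {x // (ψ ∘ φ) x = ψ y})) ?_
  · rintro _ ⟨x, hx, rfl⟩
    exact hx
  · intro x _ x' _ h
    exact Subtype.ext (Subtype.mk.inj h)

theorem zeroExt_mem_fiberFinite {V : Set X} (hinj : Set.InjOn φ V) (f : X → 𝕜) :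
    zeroExt V f ∈ fiberFinite 𝕜 φ := by
  refine fun y => Set.Subsingleton.finite fun x hx x' hx' => ?_
  have hxV : x.1 ∈ V := by_contra fun h => hx (zeroExt_of_notMem h f)
  have hxV' : x'.1 ∈ V := by_contra fun h => hx' (zeroExt_of_notMem h f)
  exact Subtype.ext (hinj hxV hxV' (x.2.trans x'.2.symm))

end FiberFinite

theorem hasFiniteSupport_germPushforward (hφ : IsLocalHomeomorph φ) {u : GermSection 𝕜 X}
    (hu : u ∈ fiberFinite 𝕜 φ) (y : Y) : Function.HasFiniteSupport
      fun x : {x // φ x = y} => germPushforward 𝕜 hφ x.2 (u x.1) :=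
  (hu y).subset fun x hx h => hx (by simp [h])

/-- The push-forward as a linear map on the sections with finite support on the fibres. -/
def pushforwardFiberFinite (hφ : IsLocalHomeomorph φ) :
    fiberFinite 𝕜 φ →ₗ[𝕜] GermSection 𝕜 Y where
  toFun u := pushforward hφ u
  map_add' a b := by
    funext y
    simp only [pushforward, Submodule.coe_add, Pi.add_apply, map_add]
    exact finsum_add_distrib (hasFiniteSupport_germPushforward hφ a.2 y)
      (hasFiniteSupport_germPushforward hφ b.2 y)
  map_smul' c a := by
    funext y
    simp only [pushforward, Submodule.coe_smul, Pi.smul_apply, map_smul, RingHom.id_apply]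
    exact (smul_finsum' c (hasFiniteSupport_germPushforward hφ a.2 y)).symm

theorem pushforward_zeroExt (hφ : IsLocalHomeomorph φ) {V : Set X} (hV : IsOpen V)
    (hinj : Set.InjOn φ V) {f : X → 𝕜} {F : Y → 𝕜} (hF : ∀ x ∈ V, F (φ x) = f x) :
    pushforward hφ (zeroExt V f) = zeroExt (φ '' V) F := by
  funext y
  rw [pushforward]
  by_cases hy : y ∈ φ '' V
  · obtain ⟨x, hx, rfl⟩ := hy
    rw [finsum_eq_single _ (⟨x, rfl⟩ : {x' // φ x' = φ x}), zeroExt_of_mem hx,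
      zeroExt_of_mem (Set.mem_image_of_mem φ hx), germPushforward_coe]
    · filter_upwards [hV.mem_nhds hx] with x' hx' using hF x' hx'
    · rintro ⟨x', hx'⟩ hne
      have : x' ∉ V := fun h => hne (Subtype.ext (hinj h hx hx'))
      rw [zeroExt_of_notMem this, map_zero]
  · rw [zeroExt_of_notMem hy]
    refine finsum_eq_zero_of_forall_eq_zero ?_
    rintro ⟨x', rfl⟩
    have : x' ∉ V := fun h => hy ⟨x', h, rfl⟩
    rw [zeroExt_of_notMem this, map_zero]

theorem pushforward_id {φ : X → X} (hφ : IsLocalHomeomorph φ) (h : ∀ x, φ x = x)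
    (u : GermSection 𝕜 X) : pushforward hφ u = u := by
  obtain rfl : φ = id := funext h
  funext x
  have : Unique {x' : X // id x' = x} := Unique.subtypeEq x
  rw [pushforward, finsum_eq_single _ ⟨x, rfl⟩ fun y hy => absurd (Subsingleton.elim _ _) hy]
  induction u x using Germ.inductionOn
  exact germPushforward_coe hφ rfl .rfl

theorem pushforward_pushforward (hφ : IsLocalHomeomorph φ) (hψ : IsLocalHomeomorph ψ)
    {χ : X → Z} (hχ : IsLocalHomeomorph χ) (h : ∀ x, ψ (φ x) = χ x) {u : GermSection 𝕜 X}
    (hu : u ∈ fiberFinite 𝕜 χ) : pushforward hψ (pushforward hφ u) = pushforward hχ u := by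
  obtain rfl : ψ ∘ φ = χ := funext h
  funext z
  simp only [pushforward]
  rw [← finsum_fiberwise (hasFiniteSupport_germPushforward hχ hu z)
    fun x => (⟨φ x.1, x.2⟩ : {y // ψ y = z})]
  refine finsum_congr fun y => ?_
  rw [← LinearEquiv.coe_toLinearMap, ← LinearMap.toAddMonoidHom_coe, AddMonoidHom.map_finsum _
    (hasFiniteSupport_germPushforward hφ (mem_fiberFinite_of_comp hu) y.1)]
  let e : {x // φ x = y} ≃ {x : {x // ψ (φ x) = z} // (⟨φ x.1, x.2⟩ : {y // ψ y = z}) = y} :=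
    { toFun x := ⟨⟨x.1, (congrArg ψ x.2).trans y.2⟩, Subtype.ext x.2⟩
      invFun x := ⟨x.1.1, congrArg Subtype.val x.2⟩ }
  refine (finsum_congr fun x => ?_).trans (finsum_comp_equiv e)
  exact germPushforward_germPushforward hφ hψ hχ h x.2 y.2 (e x).1.2 (u x.1)

end Pushforward

theorem extProd_zeroExt (π : X → Z) (ξ : Y → Z) (U : Set X) (V : Set Y) (f : X → 𝕜)
    (g : Y → 𝕜) : extProd 𝕜 π ξ (zeroExt U f) (zeroExt V g) =
      zeroExt {q : π.Pullback ξ | q.1.1 ∈ U ∧ q.1.2 ∈ V} (fun q => f q.1.1 * g q.1.2) := by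
  funext q
  rw [extProd, LinearMap.mk₂_apply]
  by_cases h : q.1.1 ∈ U
  · by_cases h' : q.1.2 ∈ V
    · rw [zeroExt_of_mem h, zeroExt_of_mem h', zeroExt_of_mem (by exact ⟨h, h'⟩)]
      rfl
    · rw [zeroExt_of_notMem h', map_zero, mul_zero, zeroExt_of_notMem fun h => h' h.2]
  · rw [zeroExt_of_notMem h, map_zero, zero_mul, zeroExt_of_notMem fun h' => h h'.1]

end Germs

/-! ### Smooth functions with compact support -/

section Smooth

variable {𝕜 : Type z} [RCLike 𝕜] {E : Type w} [NormedAddCommGroup E] [NormedSpace ℝ E]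
  {X : Type u} [TopologicalSpace X] [ChartedSpace E X]
  {Y : Type v} [TopologicalSpace Y] {U V : Set X} {f g : X → 𝕜}

theorem contMDiffOn_mul (hf : ContMDiffOn 𝓘(ℝ, E) 𝓘(ℝ, 𝕜) ∞ f U)
    (hg : ContMDiffOn 𝓘(ℝ, E) 𝓘(ℝ, 𝕜) ∞ g U) :
    ContMDiffOn 𝓘(ℝ, E) 𝓘(ℝ, 𝕜) ∞ (f * g) U := fun x hx =>
  (contDiff_mul (𝕜 := ℝ) (𝔸 := 𝕜)).contDiffAt.contMDiffAt.comp_contMDiffWithinAt x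
    ((hf x hx).prodMk_space (hg x hx))

namespace SmoothCompactlySupportedOn

theorem zero : SmoothCompactlySupportedOn E U (0 : X → 𝕜) :=
  ⟨contMDiffOn_const, ∅, Set.empty_subset U, isCompact_empty, fun _ _ _ => rfl⟩

theorem mul_left (hg : SmoothCompactlySupportedOn E U g)
    (hf : ContMDiffOn 𝓘(ℝ, E) 𝓘(ℝ, 𝕜) ∞ f U) : SmoothCompactlySupportedOn E U (f * g) := by
  obtain ⟨hg, K, hKU, hK, h⟩ := hg
  exact ⟨contMDiffOn_mul hf hg, K, hKU, hK, fun x hx hxK => by simp [h x hx hxK]⟩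

theorem add (hf : SmoothCompactlySupportedOn E U f) (hg : SmoothCompactlySupportedOn E U g) :
    SmoothCompactlySupportedOn E U (f + g) := by
  obtain ⟨hf, K, hKU, hK, h⟩ := hf
  obtain ⟨hg, L, hLU, hL, h'⟩ := hg
  refine ⟨hf.add hg, K ∪ L, Set.union_subset hKU hLU, hK.union hL, fun x hx hxK => ?_⟩
  rw [Set.mem_union, not_or] at hxK
  simp [h x hx hxK.1, h' x hx hxK.2]

theorem smul (c : 𝕜) (hf : SmoothCompactlySupportedOn E U f) :
    SmoothCompactlySupportedOn E U (c • f) :=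
  hf.mul_left (f := fun _ => c) contMDiffOn_const

theorem sub (hf : SmoothCompactlySupportedOn E U f) (hg : SmoothCompactlySupportedOn E U g) :
    SmoothCompactlySupportedOn E U (f - g) := by
  rw [sub_eq_add_neg, ← neg_one_smul 𝕜 g]
  exact hf.add (hg.smul (-1))

theorem eventually_indicator_eq_zero (hf : SmoothCompactlySupportedOn E V f) (hU : IsOpen U)
    [T2Space U] (hVU : V ⊆ U) {x : X} (hx : x ∈ U \ V) : ∀ᶠ y in 𝓝 x, V.indicator f y = 0 := by
  obtain ⟨-, K, hKV, hK, h⟩ := hf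
  filter_upwards [(isOpen_diff_of_isCompact hU hK (hKV.trans hVU)).mem_nhds
    ⟨hx.1, fun hxK => hx.2 (hKV hxK)⟩] with y hy
  exact Set.indicator_apply_eq_zero.2 fun hyV => h y hyV hy.2

theorem indicator (hf : SmoothCompactlySupportedOn E V f) (hU : IsOpen U) [T2Space U]
    (hV : IsOpen V) (hVU : V ⊆ U) : SmoothCompactlySupportedOn E U (V.indicator f) := by
  obtain ⟨K, hKV, hK, h⟩ := hf.2
  refine ⟨fun x hx => ContMDiffAt.contMDiffWithinAt ?_, K, hKV.trans hVU, hK, fun x _ hxK =>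
    Set.indicator_apply_eq_zero.2 fun hxV => h x hxV hxK⟩
  by_cases hxV : x ∈ V
  · refine (hf.1.contMDiffAt (hV.mem_nhds hxV)).congr_of_eventuallyEq ?_
    filter_upwards [hV.mem_nhds hxV] with y hy using Set.indicator_of_mem hy f
  · exact contMDiffAt_const.congr_of_eventuallyEq
      (hf.eventually_indicator_eq_zero hU hVU ⟨hx, hxV⟩)

theorem zeroExt_indicator (hf : SmoothCompactlySupportedOn E V f) (hU : IsOpen U) [T2Space U]
    (hV : IsOpen V) (hVU : V ⊆ U) : zeroExt U (V.indicator f) = zeroExt V f := by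
  rw [zeroExt_eq_zeroExt_of_subset hVU fun x => hf.eventually_indicator_eq_zero hU hVU]
  exact zeroExt_congr hV fun x hx => Set.indicator_of_mem hx f

theorem zeroExt_mem_Cc (hf : SmoothCompactlySupportedOn E U f) (hU : IsOpen U) (hU2 : T2Space U) :
    zeroExt U f ∈ Cc 𝕜 E X :=
  Submodule.subset_span ⟨U, f, hU, hU2, hf, rfl⟩

end SmoothCompactlySupportedOn

theorem exists_eq_zeroExt_univ [T2Space X] {u : GermSection 𝕜 X} (hu : u ∈ Cc 𝕜 E X) :
    ∃ p : X → 𝕜, SmoothCompactlySupportedOn E Set.univ p ∧ u = zeroExt Set.univ p := by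
  induction hu using Submodule.span_induction with
  | zero => exact ⟨0, .zero, (zeroExt_zero _).symm⟩
  | add x y _ _ h h' =>
    obtain ⟨p, hp, rfl⟩ := h
    obtain ⟨q, hq, rfl⟩ := h'
    exact ⟨p + q, hp.add hq, (zeroExt_add _ _ _).symm⟩
  | smul c x _ h =>
    obtain ⟨p, hp, rfl⟩ := h
    exact ⟨c • p, hp.smul c, (zeroExt_smul _ _ _).symm⟩
  | mem x hx =>
    obtain ⟨U, f, hU, -, hf, rfl⟩ := hx
    exact ⟨U.indicator f, hf.indicator isOpen_univ hU (Set.subset_univ U),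
      (hf.zeroExt_indicator isOpen_univ hU (Set.subset_univ U)).symm⟩

section Bump

variable [FiniteDimensional ℝ E] [IsManifold 𝓘(ℝ, E) ∞ X]

variable (𝕜 E) in
theorem exists_bump (hU : IsOpen U) (hU2 : T2Space U) {x : X} (hx : x ∈ U) :
    ∃ g : X → 𝕜, SmoothCompactlySupportedOn E U g ∧ ∀ᶠ y in 𝓝 x, g y = 1 := by
  let U' : TopologicalSpace.Opens X := ⟨U, hU⟩
  have : T2Space U' := hU2
  obtain ⟨b⟩ : Nonempty (SmoothBumpFunction 𝓘(ℝ, E) (⟨x, hx⟩ : U')) := inferInstance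
  let g : X → 𝕜 := Function.extend ((↑) : U' → X) (fun y => (b y : 𝕜)) 0
  have hg (y : U') : g y = b y := Subtype.val_injective.extend_apply _ _ y
  refine ⟨g, ⟨fun y hy => ContMDiffAt.contMDiffWithinAt ?_, (↑) '' tsupport b, ?_,
    b.hasCompactSupport.isCompact.image continuous_subtype_val, fun y hy hyK => ?_⟩, ?_⟩
  · rw [← contMDiffAt_subtype_iff (U := U') (x := ⟨y, hy⟩)]
    simp only [hg]
    exact (RCLike.ofRealCLM (K := 𝕜)).contDiff.contDiffAt.contMDiffAt.comp _ b.contMDiffAt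
  · rintro _ ⟨y, -, rfl⟩
    exact y.2
  · rw [hg ⟨y, hy⟩, image_eq_zero_of_notMem_tsupport fun h => hyK ⟨_, h, rfl⟩, RCLike.ofReal_zero]
  · rw [← hU.isOpenEmbedding_subtypeVal.map_nhds_eq ⟨x, hx⟩, eventually_map]
    filter_upwards [b.eventuallyEq_one] with y hy
    rw [hg, hy, Pi.one_apply, RCLike.ofReal_one]

variable (𝕜 E) in
theorem exists_bump_of_isCompact {K : Set X} (hU : IsOpen U) (hU2 : T2Space U)
    (hK : IsCompact K) (hKU : K ⊆ U) :
    ∃ χ : X → 𝕜, SmoothCompactlySupportedOn E U χ ∧ ∀ᶠ y in 𝓝ˢ K, χ y = 1 :=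
  exists_eventually_eq_one_of_isCompact .zero
    (fun _ _ hχ hχ' => (hχ.add hχ').sub (hχ'.mul_left hχ.1)) hK
    fun _ hx => exists_bump 𝕜 E hU hU2 (hKU hx)

end Bump

/-- A property of subsets which is inherited by subsets and holds for small open sets. -/
structure IsLocalProperty {X : Type*} [TopologicalSpace X] (P : Set X → Prop) : Prop where
  exists_isOpen : ∀ x, ∃ V, IsOpen V ∧ x ∈ V ∧ P V
  mono : ∀ V W, W ⊆ V → P V → P W

theorem isLocalProperty_injOn {X : Type*} [TopologicalSpace X] {φ : X → Y}
    (hφ : IsLocalHomeomorph φ) : IsLocalProperty (Set.InjOn φ) where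
  exists_isOpen x := by
    obtain ⟨e, hx, rfl⟩ := hφ x
    exact ⟨e.source, e.open_source, hx, e.injOn⟩
  mono _ _ h h' := h'.mono h

theorem IsLocalProperty.and {X : Type*} [TopologicalSpace X] {P Q : Set X → Prop}
    (hP : IsLocalProperty P) (hQ : IsLocalProperty Q) : IsLocalProperty (fun V => P V ∧ Q V) where
  exists_isOpen x := by
    obtain ⟨V, hV, hx, h⟩ := hP.exists_isOpen x
    obtain ⟨W, hW, hx', h'⟩ := hQ.exists_isOpen x
    exact ⟨V ∩ W, hV.inter hW, ⟨hx, hx'⟩, hP.mono _ _ Set.inter_subset_left h,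
      hQ.mono _ _ Set.inter_subset_right h'⟩
  mono _ _ h h' := ⟨hP.mono _ _ h h'.1, hQ.mono _ _ h h'.2⟩

variable (𝕜 E) in
/-- The extensions by zero of the smooth functions with compact support in a Hausdorff open subset
with the property `P`. -/
def smoothZeroExts (P : Set X → Prop) : Set (GermSection 𝕜 X) :=
  {u | ∃ (V : Set X) (g : X → 𝕜), IsOpen V ∧ T2Space V ∧ P V ∧
    SmoothCompactlySupportedOn E V g ∧ u = zeroExt V g}

section CcInduction

variable [FiniteDimensional ℝ E] [IsManifold 𝓘(ℝ, E) ∞ X] {P : Set X → Prop}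

theorem zeroExt_mem_span_of_isLocalProperty (hP : IsLocalProperty P) (hU : IsOpen U)
    (hU2 : T2Space U) (hf : SmoothCompactlySupportedOn E U f) :
    zeroExt U f ∈ Submodule.span 𝕜 (smoothZeroExts 𝕜 E P) := by
  let p (χ : X → 𝕜) : Prop := ContMDiffOn 𝓘(ℝ, E) 𝓘(ℝ, 𝕜) ∞ χ U ∧
    ∀ f, SmoothCompactlySupportedOn E U f →
      zeroExt U (χ * f) ∈ Submodule.span 𝕜 (smoothZeroExts 𝕜 E P)
  have zero : p 0 := ⟨contMDiffOn_const, fun f _ => by simp only [zero_mul, zeroExt_zero, zero_mem]⟩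
  have union (χ χ') : p χ → p χ' → p (χ + χ' - χ * χ') := by
    rintro ⟨hχ, h⟩ ⟨hχ', h'⟩
    refine ⟨(hχ.add hχ').sub (contMDiffOn_mul hχ hχ'), fun f hf => ?_⟩
    rw [sub_mul, add_mul, mul_assoc, zeroExt_sub, zeroExt_add]
    exact sub_mem (add_mem (h f hf) (h' f hf)) (h _ (hf.mul_left hχ'))
  have local_one (x) (hx : x ∈ U) : ∃ χ, p χ ∧ ∀ᶠ y in 𝓝 x, χ y = 1 := by
    obtain ⟨V, hV, hxV, hPV⟩ := hP.exists_isOpen x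
    have hUV := hU.inter hV
    have hVU : U ∩ V ⊆ U := Set.inter_subset_left
    have hUV2 : T2Space ↑(U ∩ V) := t2Space_of_subset hVU
    obtain ⟨g, hg, hg1⟩ := exists_bump 𝕜 E hUV hUV2 ⟨hx, hxV⟩
    refine ⟨(U ∩ V).indicator g, ⟨(hg.indicator hU hUV hVU).1, fun f hf => ?_⟩, ?_⟩
    · have hfg : SmoothCompactlySupportedOn E (U ∩ V) (g * f) :=
        mul_comm f g ▸ hg.mul_left (hf.1.mono hVU)
      have h : (U ∩ V).indicator g * f = (U ∩ V).indicator (g * f) :=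
        funext fun y => (Set.indicator_mul_left (U ∩ V) g f).symm
      rw [h, hfg.zeroExt_indicator hU hUV hVU]
      exact Submodule.subset_span
        ⟨_, _, hUV, hUV2, hP.mono _ _ Set.inter_subset_right hPV, hfg, rfl⟩
    · filter_upwards [hg1, hUV.mem_nhds ⟨hx, hxV⟩] with y hy hyV
      rw [Set.indicator_of_mem hyV, hy]
  obtain ⟨K, hKU, hK, hfK⟩ := hf.2
  obtain ⟨χ, ⟨-, hχ⟩, hχ1⟩ := exists_eventually_eq_one_of_isCompact zero union hK
    fun x hx => local_one x (hKU hx)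
  rw [zeroExt_congr (g := χ * f) hU fun x hx => ?_]
  · exact hχ f hf
  · by_cases hxK : x ∈ K
    · simp [hχ1.self_of_nhdsSet x hxK]
    · simp [hfK x hx hxK]

theorem Cc_induction (hP : IsLocalProperty P) {motive : GermSection 𝕜 X → Prop}
    (basic : ∀ (V : Set X) (f : X → 𝕜), IsOpen V → T2Space V → P V →
      SmoothCompactlySupportedOn E V f → motive (zeroExt V f))
    (zero : motive 0)
    (add : ∀ a ∈ Cc 𝕜 E X, ∀ b ∈ Cc 𝕜 E X, motive a → motive b → motive (a + b))
    {u : GermSection 𝕜 X} (hu : u ∈ Cc 𝕜 E X) : motive u := by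
  have hle : Submodule.span 𝕜 (smoothZeroExts 𝕜 E P) ≤ Cc 𝕜 E X := Submodule.span_le.2 <| by
    rintro _ ⟨V, g, hV, hV2, -, hg, rfl⟩
    exact hg.zeroExt_mem_Cc hV hV2
  have hu' : u ∈ Submodule.span 𝕜 (smoothZeroExts 𝕜 E P) := Submodule.span_le.2 (by
    rintro _ ⟨U, f, hU, hU2, hf, rfl⟩
    exact zeroExt_mem_span_of_isLocalProperty hP hU hU2 hf) hu
  induction hu' using Submodule.closure_induction with
  | zero => exact zero
  | add a b ha hb h h' => exact add a (hle ha) b (hle hb) (h (hle ha)) (h' (hle hb))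
  | smul_mem c a ha =>
    obtain ⟨V, g, hV, hV2, hPV, hg, rfl⟩ := ha
    rw [← zeroExt_smul]
    exact basic V _ hV hV2 hPV (hg.smul c)

theorem Cc_le_fiberFinite {φ : X → Y} (hφ : IsLocalHomeomorph φ) :
    Cc 𝕜 E X ≤ fiberFinite 𝕜 φ := fun _ hu =>
  Cc_induction (isLocalProperty_injOn hφ)
    (fun _ f _ _ hinj _ => zeroExt_mem_fiberFinite hinj f) (zero_mem _)
    (fun _ _ _ _ h h' => add_mem h h') hu

end CcInduction

section PushforwardCc

variable [ChartedSpace E Y] {φ : X → Y}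

/-- A map whose local inverses are smooth: the part of being a local diffeomorphism which the
push-forward of smooth functions needs. -/
def HasSmoothLocalInverses (E : Type w) [NormedAddCommGroup E] [NormedSpace ℝ E]
    [ChartedSpace E X] [ChartedSpace E Y] (φ : X → Y) : Prop :=
  ∀ x, ∃ ψ : Y → X, ContMDiffAt 𝓘(ℝ, E) 𝓘(ℝ, E) ∞ ψ (φ x) ∧ ∀ᶠ x' in 𝓝 x, ψ (φ x') = x'

theorem hasSmoothLocalInverses_of_isLocalDiffeomorph
    (hφ : IsLocalDiffeomorph 𝓘(ℝ, E) 𝓘(ℝ, E) ∞ φ) : HasSmoothLocalInverses E φ := fun x =>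
  ⟨(hφ x).localInverse, (hφ x).localInverse_contMDiffAt, (hφ x).localInverse_eventuallyEq_left⟩

theorem SmoothCompactlySupportedOn.image (hf : SmoothCompactlySupportedOn E V f)
    (hφ : IsLocalHomeomorph φ) (hφ' : HasSmoothLocalInverses E φ) (hV : IsOpen V) {F : Y → 𝕜}
    (hF : ∀ x ∈ V, F (φ x) = f x) : SmoothCompactlySupportedOn E (φ '' V) F := by
  obtain ⟨hf, K, hKV, hK, hfK⟩ := hf
  refine ⟨?_, φ '' K, Set.image_mono hKV, hK.image hφ.continuous, ?_⟩
  · rintro _ ⟨x, hx, rfl⟩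
    obtain ⟨ψ, hψ, hψφ⟩ := hφ' x
    have hfψ : ContMDiffAt 𝓘(ℝ, E) 𝓘(ℝ, 𝕜) ∞ (f ∘ ψ) (φ x) :=
      ContMDiffAt.comp _ (hψφ.self_of_nhds.symm ▸ hf.contMDiffAt (hV.mem_nhds hx)) hψ
    refine (hfψ.congr_of_eventuallyEq ?_).contMDiffWithinAt
    rw [← hφ.map_nhds_eq x, Filter.EventuallyEq, eventually_map]
    filter_upwards [hψφ, hV.mem_nhds hx] with x' h h'
    rw [hF x' h', Function.comp_apply, h]
  · rintro _ ⟨x, hx, rfl⟩ hxK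
    exact (hF x hx).trans (hfK x hx fun h => hxK ⟨x, h, rfl⟩)

variable [FiniteDimensional ℝ E] [IsManifold 𝓘(ℝ, E) ∞ X]

theorem pushforward_mem_Cc (hφ : IsLocalHomeomorph φ) (hφ' : HasSmoothLocalInverses E φ)
    {u : GermSection 𝕜 X} (hu : u ∈ Cc 𝕜 E X) : pushforward hφ u ∈ Cc 𝕜 E Y := by
  let p := pushforwardFiberFinite (𝕜 := 𝕜) hφ
  refine Cc_induction (motive := fun u => pushforward hφ u ∈ Cc 𝕜 E Y)
    (isLocalProperty_injOn hφ) (fun V f hV hV2 hinj hf => ?_) ?_ (fun a ha b hb ha' hb' => ?_) hu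
  · obtain ⟨F, hF⟩ := exists_forall_comp_eq_of_injOn hinj f
    rw [pushforward_zeroExt hφ hV hinj hF]
    exact (hf.image hφ hφ' hV hF).zeroExt_mem_Cc (hφ.isOpenMap V hV) (t2Space_image hφ hV hinj)
  · rw [show pushforward hφ 0 = 0 from p.map_zero]
    exact zero_mem _
  · rw [show pushforward hφ (a + b) = pushforward hφ a + pushforward hφ b from
      p.map_add ⟨a, Cc_le_fiberFinite hφ ha⟩ ⟨b, Cc_le_fiberFinite hφ hb⟩]
    exact add_mem ha' hb'

/-- The push-forward `φ_+ : C_c^∞(X) → C_c^∞(Y)`. -/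
def pushforwardCc (hφ : IsLocalHomeomorph φ) (hφ' : HasSmoothLocalInverses E φ) :
    Cc 𝕜 E X →ₗ[𝕜] Cc 𝕜 E Y :=
  (pushforwardFiberFinite hφ ∘ₗ Submodule.inclusion (Cc_le_fiberFinite hφ)).codRestrict _
    fun u => pushforward_mem_Cc hφ hφ' u.2

end PushforwardCc

end Smooth

/-! ### Products of sets of arrows -/

namespace EtGrpd

variable {E : Type v} [NormedAddCommGroup E] [NormedSpace ℝ E]
  {M : Type w} [TopologicalSpace M] [ChartedSpace E M] (G : EtGrpd.{u} E M)

section Groupoid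

variable {G}

theorem mul_congr {g g' h h' : G.Arrow} (hg : g = g') (hh : h = h') (e : G.src g = G.tgt h)
    (e' : G.src g' = G.tgt h') : G.mul ⟨(g, h), e⟩ = G.mul ⟨(g', h'), e'⟩ := by
  subst hg hh
  rfl

theorem inv_mul_cancel_left (g h : G.Arrow) (e : G.src g = G.tgt h) :
    G.mul ⟨(G.inv g, G.mul ⟨(g, h), e⟩), (G.src_inv g).trans (G.tgt_mul ⟨(g, h), e⟩).symm⟩ =
      h := by
  rw [← G.mul_assoc _ _ _ (G.src_inv g) e]
  exact (mul_congr ((G.inv_mul g).trans (congrArg G.unit e)) rfl _ (G.src_unit _)).trans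
    (G.unit_mul h)

theorem mul_inv_cancel_right (g h : G.Arrow) (e : G.src g = G.tgt h) :
    G.mul ⟨(G.mul ⟨(g, h), e⟩, G.inv h), (G.src_mul ⟨(g, h), e⟩).trans (G.tgt_inv h).symm⟩ =
      g := by
  rw [G.mul_assoc _ _ _ e (G.tgt_inv h).symm]
  exact (mul_congr rfl ((G.mul_inv h).trans (congrArg G.unit e.symm)) _ (G.tgt_unit _).symm).trans
    (G.mul_unit g)

theorem mul_left_cancel {p q : G.src.Pullback G.tgt} (h : p.1.1 = q.1.1)
    (hm : G.mul p = G.mul q) : p = q := by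
  obtain ⟨⟨a, b⟩, e⟩ := p
  obtain ⟨⟨a', b'⟩, e'⟩ := q
  obtain rfl : a = a' := h
  have : b = b' := by
    rw [← inv_mul_cancel_left a b e, ← inv_mul_cancel_left a b' e']
    exact mul_congr rfl hm _ _
  subst this
  rfl

theorem mul_right_cancel {p q : G.src.Pullback G.tgt} (h : p.1.2 = q.1.2)
    (hm : G.mul p = G.mul q) : p = q := by
  obtain ⟨⟨a, b⟩, e⟩ := p
  obtain ⟨⟨a', b'⟩, e'⟩ := q
  obtain rfl : b = b' := h
  have : a = a' := by
    rw [← mul_inv_cancel_right a b e, ← mul_inv_cancel_right a' b e']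
    exact mul_congr hm rfl _ _
  subst this
  rfl

theorem eq_inv_of_mul_eq_unit {g h : G.Arrow} (e : G.src g = G.tgt h)
    (hm : G.mul ⟨(g, h), e⟩ = G.unit (G.src h)) : g = G.inv h := by
  have := mul_right_cancel (p := ⟨(g, h), e⟩) (q := ⟨(G.inv h, h), G.src_inv h⟩) rfl
    (hm.trans (G.inv_mul h).symm)
  exact congrArg (fun p => p.1.1) this

theorem inv_unit (x : M) : G.inv (G.unit x) = G.unit x := by
  refine (eq_inv_of_mul_eq_unit ((G.src_unit x).trans (G.tgt_unit x).symm) ?_).symm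
  refine (mul_congr rfl (congrArg G.unit (G.src_unit x).symm) _ (G.tgt_unit _).symm).trans
    ((G.mul_unit _).trans ?_)
  rw [G.src_unit]

theorem inv_inv (g : G.Arrow) : G.inv (G.inv g) = g := by
  refine (eq_inv_of_mul_eq_unit (G.tgt_inv g).symm ?_).symm
  rw [G.mul_inv, G.src_inv]

theorem inv_mul_rev (g h : G.Arrow) (e : G.src g = G.tgt h) :
    G.inv (G.mul ⟨(g, h), e⟩) =
      G.mul ⟨(G.inv h, G.inv g), (G.src_inv h).trans (e.symm.trans (G.tgt_inv g).symm)⟩ := by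
  have e' : G.src (G.inv h) = G.tgt (G.inv g) :=
    (G.src_inv h).trans (e.symm.trans (G.tgt_inv g).symm)
  have e'' : G.src (G.inv g) = G.tgt (G.mul ⟨(g, h), e⟩) :=
    (G.src_inv g).trans (G.tgt_mul ⟨(g, h), e⟩).symm
  refine (eq_inv_of_mul_eq_unit ((G.src_mul ⟨(G.inv h, G.inv g), e'⟩).trans e'') ?_).symm
  rw [G.mul_assoc _ _ _ e' e'', G.src_mul]
  exact (mul_congr rfl (inv_mul_cancel_left g h e) _ (G.src_inv h)).trans (G.inv_mul h)

end Groupoid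
section SetMul

variable {U V : Set G.Arrow}

/-- The product of the sets of arrows `U` and `V`, formed by the products of their composable
elements. -/
def setMul (U V : Set G.Arrow) : Set G.Arrow :=
  G.mul '' {p | p.1.1 ∈ U ∧ p.1.2 ∈ V}

variable {G}

theorem isOpen_setMul (hU : IsOpen U) (hV : IsOpen V) : IsOpen (G.setMul U V) :=
  G.mul_isLocalHomeomorph.isOpenMap _ (isOpen_pullback_prod _ _ hU hV)

theorem mem_setMul {g h : G.Arrow} (hg : g ∈ U) (hh : h ∈ V) (e : G.src g = G.tgt h) :
    G.mul ⟨(g, h), e⟩ ∈ G.setMul U V :=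
  ⟨_, ⟨hg, hh⟩, rfl⟩

theorem injOn_mul (hU : Set.InjOn G.tgt U) :
    Set.InjOn G.mul {p | p.1.1 ∈ U ∧ p.1.2 ∈ V} := by
  intro p hp q hq h
  refine mul_left_cancel (hU hp.1 hq.1 ?_) h
  rw [← G.tgt_mul, h, G.tgt_mul]

theorem injOn_tgt_setMul (hU : Set.InjOn G.tgt U) (hV : Set.InjOn G.tgt V) :
    Set.InjOn G.tgt (G.setMul U V) := by
  rintro _ ⟨⟨⟨g, h⟩, e⟩, hp, rfl⟩ _ ⟨⟨⟨g', h'⟩, e'⟩, hq, rfl⟩ H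
  rw [G.tgt_mul, G.tgt_mul] at H
  obtain rfl : g = g' := hU hp.1 hq.1 H
  obtain rfl : h = h' := hV hp.2 hq.2 (e.symm.trans e')
  rfl

theorem injOn_src_setMul (hU : Set.InjOn G.src U) (hV : Set.InjOn G.src V) :
    Set.InjOn G.src (G.setMul U V) := by
  rintro _ ⟨⟨⟨g, h⟩, e⟩, hp, rfl⟩ _ ⟨⟨⟨g', h'⟩, e'⟩, hq, rfl⟩ H
  rw [G.src_mul, G.src_mul] at H
  obtain rfl : h = h' := hV hp.2 hq.2 H
  obtain rfl : g = g' := hU hp.1 hq.1 (e.trans e'.symm)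
  rfl

theorem isCompact_setMul [T2Space M] (hU : IsCompact U) (hV : IsCompact V) :
    IsCompact (G.setMul U V) := by
  have h : Topology.IsClosedEmbedding ((↑) : G.src.Pullback G.tgt → G.Arrow × G.Arrow) :=
    (isClosed_eq (G.src_isLocalHomeomorph.continuous.comp continuous_fst)
      (G.tgt_isLocalHomeomorph.continuous.comp continuous_snd)).isClosedEmbedding_subtypeVal
  exact (h.isCompact_preimage (hU.prod hV)).image G.mul_isLocalHomeomorph.continuous

theorem setMul_assoc (U V W : Set G.Arrow) :
    G.setMul (G.setMul U V) W = G.setMul U (G.setMul V W) := by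
  ext g
  constructor
  · rintro ⟨⟨⟨_, c⟩, e⟩, ⟨⟨⟨⟨a, b⟩, e'⟩, ⟨ha, hb⟩, rfl⟩, hc⟩, rfl⟩
    have e'' : G.src b = G.tgt c := (G.src_mul _).symm.trans e
    rw [G.mul_assoc a b c e' e'']
    exact mem_setMul ha (mem_setMul hb hc e'') _
  · rintro ⟨⟨⟨a, _⟩, e⟩, ⟨ha, ⟨⟨⟨b, c⟩, e'⟩, ⟨hb, hc⟩, rfl⟩⟩, rfl⟩
    have e'' : G.src a = G.tgt b := e.trans (G.tgt_mul _)
    rw [← G.mul_assoc a b c e'' e']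
    exact mem_setMul (mem_setMul ha hb e'') hc _

theorem unit_mul_of_src_eq {x : M} {g : G.Arrow} (e : G.src (G.unit x) = G.tgt g) :
    G.mul ⟨(G.unit x, g), e⟩ = g := by
  obtain rfl : x = G.tgt g := (G.src_unit x).symm.trans e
  exact G.unit_mul g

theorem mul_unit_of_eq_tgt {x : M} {g : G.Arrow} (e : G.src g = G.tgt (G.unit x)) :
    G.mul ⟨(g, G.unit x), e⟩ = g := by
  obtain rfl : G.src g = x := e.trans (G.tgt_unit x)
  exact G.mul_unit g

theorem range_unit_setMul (V : Set G.Arrow) : G.setMul (Set.range G.unit) V = V := by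
  ext g
  constructor
  · rintro ⟨⟨⟨_, h⟩, e⟩, ⟨⟨x, rfl⟩, hh⟩, rfl⟩
    rwa [unit_mul_of_src_eq e]
  · intro hg
    exact ⟨⟨(G.unit (G.tgt g), g), G.src_unit _⟩, ⟨⟨_, rfl⟩, hg⟩, G.unit_mul g⟩

theorem setMul_range_unit (V : Set G.Arrow) : G.setMul V (Set.range G.unit) = V := by
  ext g
  constructor
  · rintro ⟨⟨⟨h, _⟩, e⟩, ⟨hh, ⟨x, rfl⟩⟩, rfl⟩
    rwa [mul_unit_of_eq_tgt e]
  · intro hg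
    exact ⟨⟨(g, G.unit (G.src g)), (G.tgt_unit _).symm⟩, ⟨hg, ⟨_, rfl⟩⟩, G.mul_unit g⟩

end SetMul

theorem injective_unit : Function.Injective G.unit := Function.LeftInverse.injective G.src_unit

theorem isOpen_range_unit : IsOpen (Set.range G.unit) :=
  Set.image_univ (f := G.unit) ▸ G.unit_isLocalHomeomorph.isOpenMap _ isOpen_univ

theorem injOn_tgt_range_unit : Set.InjOn G.tgt (Set.range G.unit) :=
  (Function.LeftInverse.rightInvOn_range G.tgt_unit).injOn

theorem injOn_src_range_unit : Set.InjOn G.src (Set.range G.unit) :=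
  (Function.LeftInverse.rightInvOn_range G.src_unit).injOn

section Convolution

variable {𝕜 : Type z} [RCLike 𝕜] {G} {U V : Set G.Arrow}

theorem pushforward_unit_zeroExt (p : M → 𝕜) :
    pushforward G.unit_isLocalHomeomorph (zeroExt Set.univ p) =
      zeroExt (Set.range G.unit) (p ∘ G.tgt) := by
  rw [pushforward_zeroExt G.unit_isLocalHomeomorph isOpen_univ G.injective_unit.injOn
    (F := p ∘ G.tgt) fun x _ => congrArg p (G.tgt_unit x), Set.image_univ]

/-- The convolution product `mlt_+ ∘ Ω_{s,t}` of sections of germs; it is junk unless the fibres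
of the multiplication meet the support of the external product in finite sets. -/
def conv (u v : GermSection 𝕜 G.Arrow) : GermSection 𝕜 G.Arrow :=
  pushforward G.mul_isLocalHomeomorph (extProd 𝕜 G.src G.tgt u v)

theorem conv_zeroExt (hU : IsOpen U) (hV : IsOpen V) (hinj : Set.InjOn G.tgt U)
    {f g F : G.Arrow → 𝕜} (hF : ∀ a b e, a ∈ U → b ∈ V → F (G.mul ⟨(a, b), e⟩) = f a * g b) :
    conv (zeroExt U f) (zeroExt V g) = zeroExt (G.setMul U V) F := by
  rw [conv, extProd_zeroExt, pushforward_zeroExt G.mul_isLocalHomeomorph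
    (isOpen_pullback_prod _ _ hU hV) (injOn_mul hinj) (F := F), setMul]
  rintro ⟨⟨a, b⟩, e⟩ h
  exact hF a b e h.1 h.2

theorem conv_unit_left (hV : IsOpen V) (p : M → 𝕜) (f : G.Arrow → 𝕜) :
    conv (zeroExt (Set.range G.unit) (p ∘ G.tgt)) (zeroExt V f) =
      zeroExt V ((p ∘ G.tgt) * f) := by
  rw [conv_zeroExt (F := (p ∘ G.tgt) * f) G.isOpen_range_unit hV G.injOn_tgt_range_unit,
    range_unit_setMul]
  rintro _ b e ⟨x, rfl⟩ -
  simp only [Pi.mul_apply, Function.comp_apply, unit_mul_of_src_eq e, ← e, G.src_unit, G.tgt_unit]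

theorem conv_unit_right (hV : IsOpen V) (hinj : Set.InjOn G.tgt V) (p : M → 𝕜)
    (f : G.Arrow → 𝕜) :
    conv (zeroExt V f) (zeroExt (Set.range G.unit) (p ∘ G.tgt)) =
      zeroExt V ((p ∘ G.src) * f) := by
  rw [conv_zeroExt (F := (p ∘ G.src) * f) hV G.isOpen_range_unit hinj, setMul_range_unit]
  rintro a _ e - ⟨x, rfl⟩
  simp only [Pi.mul_apply, Function.comp_apply, mul_unit_of_eq_tgt e, e, mul_comm]

end Convolution

end EtGrpd

/-! ### The convolution algebra -/

namespace EtGrpd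

variable {E : Type v} [NormedAddCommGroup E] [NormedSpace ℝ E] {M : Type w} [TopologicalSpace M]
  [ChartedSpace E M] {G : EtGrpd.{u} E M} {𝕜 : Type z} [RCLike 𝕜]

theorem contMDiff_comp_tgt {p : M → 𝕜} (hp : SmoothCompactlySupportedOn E Set.univ p) :
    ContMDiff 𝓘(ℝ, E) 𝓘(ℝ, 𝕜) ∞ (p ∘ G.tgt) :=
  (contMDiffOn_univ.1 hp.1).comp G.tgt_isLocalDiffeomorph.contMDiff

theorem contMDiff_comp_src {p : M → 𝕜} (hp : SmoothCompactlySupportedOn E Set.univ p) :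
    ContMDiff 𝓘(ℝ, E) 𝓘(ℝ, 𝕜) ∞ (p ∘ G.src) :=
  (contMDiffOn_univ.1 hp.1).comp G.src_isLocalDiffeomorph.contMDiff

variable (G 𝕜) in
/-- A smooth function with compact support on an open bisection of `G`, i.e. on an open subset on
which the source and the target maps are injective. Such functions generate `C_c^∞(G)`, and the
structure maps are explicit on them. -/
structure BisectionFun where
  dom : Set G.Arrow
  fn : G.Arrow → 𝕜
  isOpen : IsOpen dom
  injOn_src : Set.InjOn G.src dom
  injOn_tgt : Set.InjOn G.tgt dom
  smooth : SmoothCompactlySupportedOn E dom fn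

variable [T2Space M]

theorem exists_smoothCompactlySupportedOn_setMul {U V : Set G.Arrow} {f g : G.Arrow → 𝕜}
    (hf : SmoothCompactlySupportedOn E U f) (hU : IsOpen U) (hU' : Set.InjOn G.tgt U)
    (hg : SmoothCompactlySupportedOn E V g) (hV : IsOpen V) (hV' : Set.InjOn G.src V) :
    ∃ F : G.Arrow → 𝕜, SmoothCompactlySupportedOn E (G.setMul U V) F ∧
      ∀ a b e, a ∈ U → b ∈ V → F (G.mul ⟨(a, b), e⟩) = f a * g b := by
  obtain ⟨p, hp⟩ := exists_forall_comp_eq_of_injOn hU' f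
  obtain ⟨q, hq⟩ := exists_forall_comp_eq_of_injOn hV' g
  have hF (a b e) (ha : a ∈ U) (hb : b ∈ V) :
      ((p ∘ G.tgt) * (q ∘ G.src)) (G.mul ⟨(a, b), e⟩) = f a * g b := by
    simp only [Pi.mul_apply, Function.comp_apply, G.tgt_mul, G.src_mul, hp a ha, hq b hb]
  refine ⟨(p ∘ G.tgt) * (q ∘ G.src), ⟨contMDiffOn_mul ?_ ?_, ?_⟩, hF⟩
  · refine (hf.image G.tgt_isLocalHomeomorph (hasSmoothLocalInverses_of_isLocalDiffeomorph
      G.tgt_isLocalDiffeomorph) hU hp).1.comp G.tgt_isLocalDiffeomorph.contMDiff.contMDiffOn ?_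
    rintro _ ⟨r, hr, rfl⟩
    exact ⟨r.1.1, hr.1, (G.tgt_mul r).symm⟩
  · refine (hg.image G.src_isLocalHomeomorph (hasSmoothLocalInverses_of_isLocalDiffeomorph
      G.src_isLocalDiffeomorph) hV hq).1.comp G.src_isLocalDiffeomorph.contMDiff.contMDiffOn ?_
    rintro _ ⟨r, hr, rfl⟩
    exact ⟨r.1.2, hr.2, (G.src_mul r).symm⟩
  · obtain ⟨-, K, hKU, hK, hfK⟩ := hf
    obtain ⟨-, L, hLV, hL, hgL⟩ := hg
    refine ⟨G.setMul K L, Set.image_mono fun r hr => ⟨hKU hr.1, hLV hr.2⟩,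
      isCompact_setMul hK hL, ?_⟩
    rintro _ ⟨⟨⟨a, b⟩, e⟩, ⟨ha, hb⟩, rfl⟩ hab
    rw [hF a b e ha hb]
    by_cases haK : a ∈ K
    · rw [hgL b hb fun hbL => hab (mem_setMul haK hbL e), mul_zero]
    · rw [hfK a ha haK, zero_mul]

namespace BisectionFun

theorem t2Space (a : BisectionFun G 𝕜) : T2Space a.dom :=
  T2Space.of_injective_continuous (f := a.dom.domRestrict G.tgt)
    (Set.injOn_iff_injective.1 a.injOn_tgt)
    (G.tgt_isLocalHomeomorph.continuous.comp continuous_subtype_val)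

/-- The element of `C_c^∞(G)` defined by a function on a bisection. -/
def toCc (a : BisectionFun G 𝕜) : Cc 𝕜 E G.Arrow :=
  ⟨zeroExt a.dom a.fn, a.smooth.zeroExt_mem_Cc a.isOpen a.t2Space⟩

theorem coe_toCc (a : BisectionFun G 𝕜) :
    (a.toCc : GermSection 𝕜 G.Arrow) = zeroExt a.dom a.fn := rfl

theorem toCc_congr {a b : BisectionFun G 𝕜} (h : a.dom = b.dom) (h' : Set.EqOn a.fn b.fn a.dom) :
    a.toCc = b.toCc :=
  Subtype.ext ((zeroExt_congr a.isOpen h').trans (congrArg (zeroExt · b.fn) h))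

/-- The convolution product of two functions on bisections. -/
def mul (a b : BisectionFun G 𝕜) : BisectionFun G 𝕜 where
  dom := G.setMul a.dom b.dom
  fn := (exists_smoothCompactlySupportedOn_setMul a.smooth a.isOpen a.injOn_tgt b.smooth b.isOpen
    b.injOn_src).choose
  isOpen := isOpen_setMul a.isOpen b.isOpen
  injOn_src := injOn_src_setMul a.injOn_src b.injOn_src
  injOn_tgt := injOn_tgt_setMul a.injOn_tgt b.injOn_tgt
  smooth := (exists_smoothCompactlySupportedOn_setMul a.smooth a.isOpen a.injOn_tgt b.smooth
    b.isOpen b.injOn_src).choose_spec.1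

theorem mul_fn (a b : BisectionFun G 𝕜) {x y : G.Arrow} (e : G.src x = G.tgt y) (hx : x ∈ a.dom)
    (hy : y ∈ b.dom) : (a.mul b).fn (G.mul ⟨(x, y), e⟩) = a.fn x * b.fn y :=
  (exists_smoothCompactlySupportedOn_setMul a.smooth a.isOpen a.injOn_tgt b.smooth b.isOpen
    b.injOn_src).choose_spec.2 x y e hx hy

theorem conv_toCc (a b : BisectionFun G 𝕜) :
    conv (a.toCc : GermSection 𝕜 G.Arrow) b.toCc = (a.mul b).toCc :=
  conv_zeroExt a.isOpen b.isOpen a.injOn_tgt fun _ _ e hx hy => a.mul_fn b e hx hy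

theorem toCc_mul_mul (a b c : BisectionFun G 𝕜) :
    ((a.mul b).mul c).toCc = (a.mul (b.mul c)).toCc := by
  refine toCc_congr (setMul_assoc _ _ _) ?_
  rintro _ ⟨⟨⟨_, z⟩, e⟩, ⟨⟨⟨⟨x, y⟩, e'⟩, ⟨hx, hy⟩, rfl⟩, hz⟩, rfl⟩
  have hyz : G.src y = G.tgt z := (G.src_mul _).symm.trans e
  rw [mul_fn _ _ e (mem_setMul hx hy e') hz, mul_fn _ _ e' hx hy, G.mul_assoc x y z e' hyz,
    mul_fn _ _ _ hx (mem_setMul hy hz hyz), mul_fn _ _ hyz hy hz]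
  ring

/-- The product of a function on a bisection with a smooth function on `G`. -/
def mulLeft (q : G.Arrow → 𝕜) (hq : ContMDiff 𝓘(ℝ, E) 𝓘(ℝ, 𝕜) ∞ q) (a : BisectionFun G 𝕜) :
    BisectionFun G 𝕜 :=
  { a with
    fn := q * a.fn
    smooth := a.smooth.mul_left hq.contMDiffOn }

theorem toCc_mulLeft_eq_self {q : G.Arrow → 𝕜} (hq : ContMDiff 𝓘(ℝ, E) 𝓘(ℝ, 𝕜) ∞ q)
    (a : BisectionFun G 𝕜) (h : ∀ x ∈ a.dom, a.fn x ≠ 0 → q x = 1) :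
    (a.mulLeft q hq).toCc = a.toCc := by
  refine toCc_congr rfl fun x hx => ?_
  by_cases hax : a.fn x = 0
  · exact (mul_eq_zero_of_right _ hax).trans hax.symm
  · exact (congrArg (· * a.fn x) (h x hx hax)).trans (one_mul _)

section Induction

variable [FiniteDimensional ℝ E]

protected theorem induction {motive : Cc 𝕜 E G.Arrow → Prop}
    (basic : ∀ a : BisectionFun G 𝕜, motive a.toCc) (zero : motive 0)
    (add : ∀ a b, motive a → motive b → motive (a + b)) (u : Cc 𝕜 E G.Arrow) : motive u := by
  have := Cc_induction (motive := fun u => ∃ h : u ∈ Cc 𝕜 E G.Arrow, motive ⟨u, h⟩)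
    ((isLocalProperty_injOn G.src_isLocalHomeomorph).and
      (isLocalProperty_injOn G.tgt_isLocalHomeomorph))
    (fun V f hV hV2 hP hf =>
      ⟨hf.zeroExt_mem_Cc hV hV2, basic ⟨V, f, hV, hP.1, hP.2, hf⟩⟩)
    ⟨zero_mem _, zero⟩ (fun a _ b _ ⟨ha, h⟩ ⟨hb, h'⟩ => ⟨add_mem ha hb, add _ _ h h'⟩) u.2
  exact this.2

protected theorem induction₂ {motive : Cc 𝕜 E G.Arrow → Cc 𝕜 E G.Arrow → Prop}
    (basic : ∀ a b : BisectionFun G 𝕜, motive a.toCc b.toCc)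
    (zero_left : ∀ v, motive 0 v) (zero_right : ∀ u, motive u 0)
    (add_left : ∀ u u' v, motive u v → motive u' v → motive (u + u') v)
    (add_right : ∀ u v v', motive u v → motive u v' → motive u (v + v'))
    (u v : Cc 𝕜 E G.Arrow) : motive u v := by
  induction u using BisectionFun.induction with
  | zero => exact zero_left v
  | add u u' h h' => exact add_left u u' v h h'
  | basic a =>
    induction v using BisectionFun.induction with
    | zero => exact zero_right _
    | add v v' h h' => exact add_right _ v v' h h'
    | basic b => exact basic a b

end Induction

end BisectionFun

section ConvolutionAlgebra

variable [FiniteDimensional ℝ E]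

theorem extProd_mem_fiberFinite (u v : Cc 𝕜 E G.Arrow) :
    extProd 𝕜 G.src G.tgt (u : GermSection 𝕜 G.Arrow) v ∈ fiberFinite 𝕜 G.mul := by
  induction u, v using BisectionFun.induction₂ with
  | basic a b =>
    rw [a.coe_toCc, b.coe_toCc, extProd_zeroExt]
    exact zeroExt_mem_fiberFinite (injOn_mul a.injOn_tgt) _
  | zero_left v => simp only [Submodule.coe_zero, map_zero, LinearMap.zero_apply, zero_mem]
  | zero_right u => simp only [Submodule.coe_zero, map_zero, zero_mem]
  | add_left u u' v h h' =>
    simpa only [Submodule.coe_add, map_add, LinearMap.add_apply] using add_mem h h'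
  | add_right u v v' h h' => simpa only [Submodule.coe_add, map_add] using add_mem h h'

variable (G 𝕜) in
/-- The convolution product on `C_c^∞(G)`, as a bilinear map to sections of germs. -/
def convBilin : Cc 𝕜 E G.Arrow →ₗ[𝕜] Cc 𝕜 E G.Arrow →ₗ[𝕜] GermSection 𝕜 G.Arrow :=
  (LinearMap.codRestrict₂ ((extProd 𝕜 G.src G.tgt).domRestrict₁₂ (Cc 𝕜 E G.Arrow) (Cc 𝕜 E G.Arrow))
    (fiberFinite 𝕜 G.mul).subtype (Submodule.subtype_injective _) fun u v =>
      ⟨⟨_, extProd_mem_fiberFinite u v⟩, rfl⟩).compr₂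
    (pushforwardFiberFinite G.mul_isLocalHomeomorph)

theorem convBilin_apply (u v : Cc 𝕜 E G.Arrow) : convBilin G 𝕜 u v = conv u.1 v.1 :=
  congrArg (pushforward _) (LinearMap.codRestrict₂_apply _ (fiberFinite 𝕜 G.mul).subtype _ _ u v)

theorem convBilin_mem_Cc (u v : Cc 𝕜 E G.Arrow) : convBilin G 𝕜 u v ∈ Cc 𝕜 E G.Arrow := by
  induction u, v using BisectionFun.induction₂ with
  | basic a b =>
    rw [convBilin_apply, a.conv_toCc b]
    exact (a.mul b).toCc.2
  | zero_left v => simp only [map_zero, LinearMap.zero_apply, zero_mem]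
  | zero_right u => simp only [map_zero, zero_mem]
  | add_left u u' v h h' => simpa only [map_add, LinearMap.add_apply] using add_mem h h'
  | add_right u v v' h h' => simpa only [map_add] using add_mem h h'

variable (G 𝕜) in
/-- The convolution product on `C_c^∞(G)`. -/
def convCc : Cc 𝕜 E G.Arrow →ₗ[𝕜] Cc 𝕜 E G.Arrow →ₗ[𝕜] Cc 𝕜 E G.Arrow :=
  (convBilin G 𝕜).codRestrict₂ (Cc 𝕜 E G.Arrow).subtype (Submodule.subtype_injective _) fun u v =>
    ⟨⟨_, convBilin_mem_Cc u v⟩, rfl⟩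

theorem coe_convCc (u v : Cc 𝕜 E G.Arrow) :
    (convCc G 𝕜 u v : GermSection 𝕜 G.Arrow) = conv (u : GermSection 𝕜 G.Arrow) v :=
  (LinearMap.codRestrict₂_apply _ (Cc 𝕜 E G.Arrow).subtype _ _ u v).trans (convBilin_apply u v)

theorem convCc_toCc (a b : BisectionFun G 𝕜) : convCc G 𝕜 a.toCc b.toCc = (a.mul b).toCc :=
  Subtype.ext ((coe_convCc _ _).trans (a.conv_toCc b))

theorem convCc_assoc (u v w : Cc 𝕜 E G.Arrow) :
    convCc G 𝕜 (convCc G 𝕜 u v) w = convCc G 𝕜 u (convCc G 𝕜 v w) := by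
  induction u, v using BisectionFun.induction₂ with
  | zero_left v => simp only [map_zero, LinearMap.zero_apply]
  | zero_right u => simp only [map_zero, LinearMap.zero_apply]
  | add_left u u' v h h' => simp only [map_add, LinearMap.add_apply, h, h']
  | add_right u v v' h h' => simp only [map_add, LinearMap.add_apply, h, h']
  | basic a b =>
    induction w using BisectionFun.induction with
    | zero => simp only [map_zero]
    | add w w' h h' => simp only [map_add, h, h']
    | basic c => simp only [convCc_toCc, BisectionFun.toCc_mul_mul]

section Incl

variable [IsManifold 𝓘(ℝ, E) ∞ M]

variable (G 𝕜) in
/-- The embedding `uni_+` of `C_c^∞(M)` into `C_c^∞(G)`. -/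
def inclCc : CcAlg 𝕜 E M →ₗ[𝕜] Cc 𝕜 E G.Arrow :=
  pushforwardCc (X := M) G.unit_isLocalHomeomorph
    (hasSmoothLocalInverses_of_isLocalDiffeomorph G.unit_isLocalDiffeomorph)

theorem coe_inclCc (r : CcAlg 𝕜 E M) : (inclCc G 𝕜 r : GermSection 𝕜 G.Arrow) =
    pushforward G.unit_isLocalHomeomorph (r : GermSection 𝕜 M) := rfl

end Incl

variable (G 𝕜) in
/-- The counit `t_+`. -/
def counitCc : Cc 𝕜 E G.Arrow →ₗ[𝕜] CcAlg 𝕜 E M :=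
  pushforwardCc (Y := M) G.tgt_isLocalHomeomorph
    (hasSmoothLocalInverses_of_isLocalDiffeomorph G.tgt_isLocalDiffeomorph)

theorem coe_counitCc (u : Cc 𝕜 E G.Arrow) : (counitCc G 𝕜 u : GermSection 𝕜 M) =
    pushforward G.tgt_isLocalHomeomorph (u : GermSection 𝕜 G.Arrow) := rfl

end ConvolutionAlgebra

section BaseFunctions

/-- The element of the algebra `C_c^∞(M)` defined by a function on `M`. -/
def ofFun (p : M → 𝕜) (hp : SmoothCompactlySupportedOn E Set.univ p) : CcAlg 𝕜 E M :=
  ⟨zeroExt Set.univ p, hp.zeroExt_mem_Cc isOpen_univ inferInstance⟩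

theorem exists_eq_ofFun (r : CcAlg 𝕜 E M) :
    ∃ (p : M → 𝕜) (hp : SmoothCompactlySupportedOn E Set.univ p), r = ofFun p hp := by
  obtain ⟨p, hp, h⟩ := exists_eq_zeroExt_univ r.2
  exact ⟨p, hp, Subtype.ext h⟩

theorem coe_ofFun (p : M → 𝕜) (hp : SmoothCompactlySupportedOn E Set.univ p) (y : M) :
    (ofFun p hp : GermSection 𝕜 M) y = (p : Germ (𝓝 y) 𝕜) :=
  zeroExt_of_mem (Set.mem_univ y) p

theorem coe_ofFun_eq_one_iff {p : M → 𝕜} {hp : SmoothCompactlySupportedOn E Set.univ p} {y : M} :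
    (ofFun p hp : GermSection 𝕜 M) y = 1 ↔ ∀ᶠ z in 𝓝 y, p z = 1 :=
  (coe_ofFun p hp y).congr_left.trans Germ.coe_eq

theorem coe_ofFun_eq_zero_iff {p : M → 𝕜} {hp : SmoothCompactlySupportedOn E Set.univ p} {y : M} :
    (ofFun p hp : GermSection 𝕜 M) y = 0 ↔ ∀ᶠ z in 𝓝 y, p z = 0 :=
  (coe_ofFun p hp y).congr_left.trans Germ.coe_eq

theorem ofFun_mul (p q : M → 𝕜) (hp : SmoothCompactlySupportedOn E Set.univ p)
    (hq : SmoothCompactlySupportedOn E Set.univ q) :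
    ofFun p hp * ofFun q hq = ofFun (p * q) (hq.mul_left hp.1) :=
  Subtype.ext ((zeroExt_mul_zeroExt _ _ _ _).trans (by rw [Set.univ_inter]; rfl))

variable [FiniteDimensional ℝ E] [IsManifold 𝓘(ℝ, E) ∞ M]

theorem coe_inclCc_ofFun (p : M → 𝕜) (hp : SmoothCompactlySupportedOn E Set.univ p) :
    (inclCc G 𝕜 (ofFun p hp) : GermSection 𝕜 G.Arrow) =
      zeroExt (Set.range G.unit) (p ∘ G.tgt) :=
  pushforward_unit_zeroExt p

theorem inclCc_convCc_toCc (p : M → 𝕜) (hp : SmoothCompactlySupportedOn E Set.univ p)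
    (a : BisectionFun G 𝕜) : convCc G 𝕜 (inclCc G 𝕜 (ofFun p hp)) a.toCc =
      (a.mulLeft (p ∘ G.tgt) (contMDiff_comp_tgt hp)).toCc := by
  refine Subtype.ext ?_
  rw [coe_convCc, coe_inclCc_ofFun, a.coe_toCc, conv_unit_left a.isOpen]
  rfl

theorem toCc_convCc_inclCc (p : M → 𝕜) (hp : SmoothCompactlySupportedOn E Set.univ p)
    (a : BisectionFun G 𝕜) : convCc G 𝕜 a.toCc (inclCc G 𝕜 (ofFun p hp)) =
      (a.mulLeft (p ∘ G.src) (contMDiff_comp_src hp)).toCc := by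
  refine Subtype.ext ?_
  rw [coe_convCc, coe_inclCc_ofFun, a.coe_toCc, conv_unit_right a.isOpen a.injOn_tgt]
  rfl

theorem inclCc_mul (r s : CcAlg 𝕜 E M) :
    inclCc G 𝕜 (r * s) = convCc G 𝕜 (inclCc G 𝕜 r) (inclCc G 𝕜 s) := by
  obtain ⟨p, hp, rfl⟩ := exists_eq_ofFun r
  obtain ⟨q, hq, rfl⟩ := exists_eq_ofFun s
  refine Subtype.ext ?_
  rw [ofFun_mul, coe_convCc, coe_inclCc_ofFun, coe_inclCc_ofFun, coe_inclCc_ofFun,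
    conv_unit_left G.isOpen_range_unit]
  rfl

theorem counitCc_inclCc (r : CcAlg 𝕜 E M) : counitCc G 𝕜 (inclCc G 𝕜 r) = r := by
  have hid : IsLocalHomeomorph (id : M → M) := (Homeomorph.refl M).isLocalHomeomorph
  refine Subtype.ext ?_
  rw [coe_counitCc, coe_inclCc,
    pushforward_pushforward _ _ hid G.tgt_unit (Cc_le_fiberFinite hid r.2)]
  exact pushforward_id hid (fun _ => rfl) r.1

theorem exists_isCompact_local_identity (u : Cc 𝕜 E G.Arrow) :
    ∃ C : Set M, IsCompact C ∧ ∀ r : CcAlg 𝕜 E M, (∀ y ∈ C, (r : GermSection 𝕜 M) y = 1) →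
      convCc G 𝕜 u (inclCc G 𝕜 r) = u ∧ convCc G 𝕜 (inclCc G 𝕜 r) u = u := by
  induction u using BisectionFun.induction with
  | zero =>
    exact ⟨∅, isCompact_empty, fun r _ => by simp only [map_zero, LinearMap.zero_apply, and_self]⟩
  | add u u' h h' =>
    obtain ⟨C, hC, h⟩ := h
    obtain ⟨C', hC', h'⟩ := h'
    refine ⟨C ∪ C', hC.union hC', fun r hr => ?_⟩
    have hu := h r fun y hy => hr y (Or.inl hy)
    have hu' := h' r fun y hy => hr y (Or.inr hy)
    simp only [map_add, LinearMap.add_apply, hu.1, hu.2, hu'.1, hu'.2, and_self]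
  | basic a =>
    obtain ⟨-, K, -, hK, h0⟩ := a.smooth
    have mem_K {x} (hx : x ∈ a.dom) (hax : a.fn x ≠ 0) : x ∈ K :=
      by_contra fun h => hax (h0 x hx h)
    refine ⟨G.src '' K ∪ G.tgt '' K, (hK.image G.src_isLocalHomeomorph.continuous).union
      (hK.image G.tgt_isLocalHomeomorph.continuous), fun r hr => ?_⟩
    obtain ⟨p, hp, rfl⟩ := exists_eq_ofFun r
    have one_of_mem {y} (hy : y ∈ G.src '' K ∪ G.tgt '' K) : p y = 1 :=
      (coe_ofFun_eq_one_iff.1 (hr y hy)).self_of_nhds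
    rw [inclCc_convCc_toCc, toCc_convCc_inclCc]
    exact ⟨a.toCc_mulLeft_eq_self _ fun x hx hax => one_of_mem (Or.inl ⟨x, mem_K hx hax, rfl⟩),
      a.toCc_mulLeft_eq_self _ fun x hx hax => one_of_mem (Or.inr ⟨x, mem_K hx hax, rfl⟩)⟩

variable (G 𝕜) in
/-- The convolution algebra of smooth functions with compact support on `G`. -/
def convAlgebra : AlgebraOver 𝕜 (CcAlg 𝕜 E M) (Cc 𝕜 E G.Arrow) where
  mul := convCc G 𝕜
  mul_assoc := convCc_assoc
  incl := inclCc G 𝕜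
  incl_mul := inclCc_mul
  incl_injective := Function.LeftInverse.injective counitCc_inclCc
  local_identities s := by
    choose C hC h using exists_isCompact_local_identity (G := G) (𝕜 := 𝕜)
    obtain ⟨p, hp, hpC⟩ := exists_bump_of_isCompact 𝕜 E isOpen_univ inferInstance
      (s.isCompact_biUnion fun u _ => hC u) (Set.subset_univ (⋃ u ∈ s, C u))
    exact ⟨ofFun p hp, fun u hu => h u _ fun y hy =>
      coe_ofFun_eq_one_iff.2 (eventually_nhdsSet_iff_forall.1 hpC y (Set.mem_biUnion hu hy))⟩

theorem lact_toCc (p : M → 𝕜) (hp : SmoothCompactlySupportedOn E Set.univ p)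
    (a : BisectionFun G 𝕜) : (convAlgebra G 𝕜).lact (ofFun p hp) a.toCc =
      (a.mulLeft (p ∘ G.tgt) (contMDiff_comp_tgt hp)).toCc :=
  inclCc_convCc_toCc p hp a

theorem ract_toCc (p : M → 𝕜) (hp : SmoothCompactlySupportedOn E Set.univ p)
    (a : BisectionFun G 𝕜) : (convAlgebra G 𝕜).ract (ofFun p hp) a.toCc =
      (a.mulLeft (p ∘ G.src) (contMDiff_comp_src hp)).toCc :=
  toCc_convCc_inclCc p hp a

end BaseFunctions

end EtGrpd

/-! ### Pullback of germs and the map `Ω_{t,t}` -/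

namespace AlgebraOver

variable {𝕜 : Type*} [Field 𝕜] {R : Type*} [NonUnitalCommRing R] [Module 𝕜 R]
  {A : Type*} [AddCommGroup A] [Module 𝕜 A] (X : AlgebraOver 𝕜 R A)

protected theorem induction_LL {motive : X.LL → Prop} (zero : motive 0)
    (tmul : ∀ a b, motive (X.mkLL (a ⊗ₜ[𝕜] b)))
    (add : ∀ x y, motive x → motive y → motive (x + y)) (x : X.LL) : motive x := by
  obtain ⟨x, rfl⟩ := X.relLL.mkQ_surjective x
  induction x using TensorProduct.induction_on with
  | zero => rwa [map_zero]
  | tmul a b => exact tmul a b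
  | add x y hx hy => rw [map_add]; exact add _ _ hx hy

variable [IsScalarTower 𝕜 R R] [SMulCommClass 𝕜 R R]

theorem lactLL_mk (r : R) (a b : A) :
    X.lactLL r (X.mkLL (a ⊗ₜ[𝕜] b)) = X.mkLL (X.lact r a ⊗ₜ[𝕜] b) := by
  simp [lactLL]

theorem lactLL_mul (r s : R) (x : X.LL) : X.lactLL (r * s) x = X.lactLL r (X.lactLL s x) := by
  have h : X.lactLL (r * s) = X.lactLL r ∘ₗ X.lactLL s :=
    hom_ext_LL fun a b => by simp [lactLL_mk, lact_mul]
  exact LinearMap.congr_fun h x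

theorem lactLL_zero (x : X.LL) : X.lactLL 0 x = 0 := by
  have h : X.lactLL 0 = 0 := hom_ext_LL fun a b => by simp [lactLL_mk]
  exact LinearMap.congr_fun h x

theorem lactLL_add (r s : R) (x : X.LL) : X.lactLL (r + s) x = X.lactLL r x + X.lactLL s x := by
  have h : X.lactLL (r + s) = X.lactLL r + X.lactLL s :=
    hom_ext_LL fun a b => by simp [lactLL_mk, TensorProduct.add_tmul]
  exact LinearMap.congr_fun h x

theorem lactLL_sub (r s : R) (x : X.LL) : X.lactLL (r - s) x = X.lactLL r x - X.lactLL s x := by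
  have h : X.lactLL (r - s) = X.lactLL r - X.lactLL s :=
    hom_ext_LL fun a b => by simp [lactLL_mk, TensorProduct.sub_tmul]
  exact LinearMap.congr_fun h x

theorem lactLL_mul_mk (r s : R) (a b : A) :
    X.lactLL (r * s) (X.mkLL (a ⊗ₜ[𝕜] b)) = X.mkLL (X.lact r a ⊗ₜ[𝕜] X.lact s b) := by
  rw [lactLL_mul, lactLL_mk, mkLL_lact, lactLL_mk]

end AlgebraOver

section SectionPullback

variable {𝕜 : Type z} [RCLike 𝕜] {X : Type u} [TopologicalSpace X] {Y : Type v}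
  [TopologicalSpace Y] {Z : Type w} [TopologicalSpace Z]

theorem germPullback_mul (φ : X → Y) {x : X} {y : Y} (h : Tendsto φ (𝓝 x) (𝓝 y))
    (a b : Germ (𝓝 y) 𝕜) :
    germPullback 𝕜 φ h (a * b) = germPullback 𝕜 φ h a * germPullback 𝕜 φ h b := by
  induction a using Germ.inductionOn
  induction b using Germ.inductionOn
  rfl

theorem germPullback_one (φ : X → Y) {x : X} {y : Y} (h : Tendsto φ (𝓝 x) (𝓝 y)) :
    germPullback 𝕜 φ h 1 = 1 := rfl

theorem germPullback_germPullback (φ : X → Y) (ψ : Y → Z) {x : X} {y : Y} {z : Z}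
    (h : Tendsto φ (𝓝 x) (𝓝 y)) (h' : Tendsto ψ (𝓝 y) (𝓝 z)) (a : Germ (𝓝 z) 𝕜) :
    germPullback 𝕜 φ h (germPullback 𝕜 ψ h' a) = germPullback 𝕜 (ψ ∘ φ) (h'.comp h) a := by
  induction a using Germ.inductionOn
  rfl

theorem germPullback_injective {φ : X → Y} (hφ : IsLocalHomeomorph φ) {x : X} {y : Y}
    (h : φ x = y) :
    Function.Injective (germPullback 𝕜 φ (tendsto_of_isLocalHomeomorph hφ h)) := fun _ _ hab =>
  ((germPushforward_eq_iff hφ h).2 rfl).symm.trans ((germPushforward_eq_iff hφ h).2 hab)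

/-- The pullback `φ^* u` of a section of germs `u`. -/
def sectionPullback {φ : X → Y} (hφ : Continuous φ) (u : GermSection 𝕜 Y) : GermSection 𝕜 X :=
  fun x => germPullback 𝕜 φ (hφ.tendsto x) (u (φ x))

theorem sectionPullback_eq_one {φ : X → Y} (hφ : Continuous φ) {u : GermSection 𝕜 Y} {x : X}
    (h : u (φ x) = 1) : sectionPullback hφ u x = 1 :=
  (congrArg (germPullback 𝕜 φ (hφ.tendsto x)) h).trans (germPullback_one φ _)

theorem sectionPullback_congr {φ ψ : X → Y} (hφ : Continuous φ) (hψ : Continuous ψ) (h : φ = ψ)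
    (u : GermSection 𝕜 Y) : sectionPullback hφ u = sectionPullback hψ u := by
  subst h
  rfl

variable {π : X → Z} {ξ : Y → Z}

theorem extProd_sectionPullback_mul_left (hπ : Continuous π) (r : GermSection 𝕜 Z)
    (u : GermSection 𝕜 X) (v : GermSection 𝕜 Y) :
    extProd 𝕜 π ξ (sectionPullback hπ r * u) v =
      sectionPullback (hπ.comp (continuous_fst.comp continuous_subtype_val)) r *
        extProd 𝕜 π ξ u v := by
  funext q
  simp only [extProd, LinearMap.mk₂_apply, Pi.mul_apply, sectionPullback, germPullback_mul,
    germPullback_germPullback, mul_assoc]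
  rfl

theorem extProd_sectionPullback_mul_right (hξ : Continuous ξ) (r : GermSection 𝕜 Z)
    (u : GermSection 𝕜 X) (v : GermSection 𝕜 Y) :
    extProd 𝕜 π ξ u (sectionPullback hξ r * v) =
      sectionPullback (hξ.comp (continuous_snd.comp continuous_subtype_val)) r *
        extProd 𝕜 π ξ u v := by
  funext q
  simp only [extProd, LinearMap.mk₂_apply, Pi.mul_apply, sectionPullback, germPullback_mul,
    germPullback_germPullback, mul_left_comm]
  rfl

end SectionPullback

namespace EtGrpd

variable {E : Type v} [NormedAddCommGroup E] [NormedSpace ℝ E] [FiniteDimensional ℝ E]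
  {M : Type w} [TopologicalSpace M] [T2Space M] [ChartedSpace E M] [IsManifold 𝓘(ℝ, E) ∞ M]
  {G : EtGrpd.{u} E M} {𝕜 : Type z} [RCLike 𝕜]

theorem coe_lact (r : CcAlg 𝕜 E M) (u : Cc 𝕜 E G.Arrow) :
    ((convAlgebra G 𝕜).lact r u : GermSection 𝕜 G.Arrow) =
      sectionPullback G.tgt_isLocalHomeomorph.continuous (r : GermSection 𝕜 M) * u.1 := by
  induction u using BisectionFun.induction with
  | zero => simp only [map_zero, Submodule.coe_zero, mul_zero]
  | add u u' h h' => simp only [map_add, Submodule.coe_add, h, h', mul_add]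
  | basic a =>
    obtain ⟨p, hp, rfl⟩ := exists_eq_ofFun r
    funext x
    rw [lact_toCc, a.coe_toCc, BisectionFun.coe_toCc, Pi.mul_apply, sectionPullback, coe_ofFun,
      germPullback_coe]
    by_cases hx : x ∈ a.dom
    · rw [zeroExt_of_mem hx, zeroExt_of_mem (by exact hx)]
      rfl
    · rw [zeroExt_of_notMem hx, zeroExt_of_notMem (by exact hx), mul_zero]

theorem extProd_lact (r : CcAlg 𝕜 E M) (u v : Cc 𝕜 E G.Arrow) :
    extProd 𝕜 G.tgt G.tgt ((convAlgebra G 𝕜).lact r u : GermSection 𝕜 G.Arrow) v =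
      extProd 𝕜 G.tgt G.tgt (u : GermSection 𝕜 G.Arrow) ((convAlgebra G 𝕜).lact r v) := by
  rw [coe_lact, coe_lact, extProd_sectionPullback_mul_left, extProd_sectionPullback_mul_right]
  exact congrArg (· * _) (sectionPullback_congr _ _ (funext fun q => q.2) _)

variable (G 𝕜) in
/-- The map `Ω_{t,t}` on the tensor product over `C_c^∞(M)`. -/
def omega : (convAlgebra G 𝕜).LL →ₗ[𝕜] GermSection 𝕜 (G.tgt.Pullback G.tgt) :=
  (convAlgebra G 𝕜).liftLL ((extProd 𝕜 G.tgt G.tgt).domRestrict₁₂ (Cc 𝕜 E G.Arrow)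
    (Cc 𝕜 E G.Arrow)) extProd_lact

theorem omega_tmul (u v : Cc 𝕜 E G.Arrow) : omega G 𝕜 ((convAlgebra G 𝕜).mkLL (u ⊗ₜ[𝕜] v)) =
    extProd 𝕜 G.tgt G.tgt (u : GermSection 𝕜 G.Arrow) v :=
  AlgebraOver.liftLL_mk _ _ _ u v

theorem omega_mkLL (x : Cc 𝕜 E G.Arrow ⊗[𝕜] Cc 𝕜 E G.Arrow) :
    omega G 𝕜 ((convAlgebra G 𝕜).mkLL x) = extProdTensor 𝕜 E G.tgt G.tgt x := by
  have h : omega G 𝕜 ∘ₗ (convAlgebra G 𝕜).mkLL = extProdTensor 𝕜 E G.tgt G.tgt :=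
    TensorProduct.ext' fun u v => (omega_tmul u v).trans rfl
  exact LinearMap.congr_fun h x

theorem omega_toCc (a b : BisectionFun G 𝕜) :
    omega G 𝕜 ((convAlgebra G 𝕜).mkLL (a.toCc ⊗ₜ[𝕜] b.toCc)) =
      zeroExt {q : G.tgt.Pullback G.tgt | q.1.1 ∈ a.dom ∧ q.1.2 ∈ b.dom}
        (fun q => a.fn q.1.1 * b.fn q.1.2) :=
  (omega_tmul _ _).trans (extProd_zeroExt _ _ _ _ _ _)

theorem omega_lactLL (r : CcAlg 𝕜 E M) (x : (convAlgebra G 𝕜).LL) :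
    omega G 𝕜 ((convAlgebra G 𝕜).lactLL r x) =
      sectionPullback (G.tgt_isLocalHomeomorph.continuous.comp
        (continuous_fst.comp continuous_subtype_val)) (r : GermSection 𝕜 M) * omega G 𝕜 x := by
  induction x using AlgebraOver.induction_LL with
  | zero => simp only [map_zero, mul_zero]
  | add x y hx hy => simp only [map_add, hx, hy, mul_add]
  | tmul u v =>
    rw [AlgebraOver.lactLL_mk, omega_tmul, omega_tmul, coe_lact, extProd_sectionPullback_mul_left]

protected theorem induction_LL {motive : (convAlgebra G 𝕜).LL → Prop} (zero : motive 0)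
    (basic : ∀ a b : BisectionFun G 𝕜, motive ((convAlgebra G 𝕜).mkLL (a.toCc ⊗ₜ[𝕜] b.toCc)))
    (add : ∀ x y, motive x → motive y → motive (x + y)) (x : (convAlgebra G 𝕜).LL) :
    motive x := by
  induction x using AlgebraOver.induction_LL with
  | zero => exact zero
  | add x y hx hy => exact add x y hx hy
  | tmul u v =>
    induction u, v using BisectionFun.induction₂ with
    | zero_left v => rwa [TensorProduct.zero_tmul, map_zero]
    | zero_right u => rwa [TensorProduct.tmul_zero, map_zero]
    | add_left u u' v h h' => rw [TensorProduct.add_tmul, map_add]; exact add _ _ h h'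
    | add_right u v v' h h' => rw [TensorProduct.tmul_add, map_add]; exact add _ _ h h'
    | basic a b => exact basic a b

end EtGrpd

/-! ### Injectivity of `Ω_{t,t}` -/

namespace EtGrpd

variable {E : Type v} [NormedAddCommGroup E] [NormedSpace ℝ E] [FiniteDimensional ℝ E]
  {M : Type w} [TopologicalSpace M] [T2Space M] [ChartedSpace E M]
  {G : EtGrpd.{u} E M} {𝕜 : Type z} [RCLike 𝕜]

section LocalFunctions

variable [IsManifold 𝓘(ℝ, E) ∞ M]

theorem exists_eq_one_of_isOpen {W : Set M} (hW : IsOpen W) {y : M} (hy : y ∈ W) :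
    ∃ r : CcAlg 𝕜 E M, (r : GermSection 𝕜 M) y = 1 ∧ ∀ z ∉ W, (r : GermSection 𝕜 M) z = 0 := by
  obtain ⟨p, hp, h1⟩ := exists_bump 𝕜 E hW inferInstance hy
  exact ⟨⟨zeroExt W p, hp.zeroExt_mem_Cc hW inferInstance⟩,
    (zeroExt_of_mem hy p).trans (Germ.coe_eq.2 h1), fun z hz => zeroExt_of_notMem hz p⟩

theorem exists_eq_one_of_eq_zero {s : CcAlg 𝕜 E M} {y : M} (h : (s : GermSection 𝕜 M) y = 0) :
    ∃ r : CcAlg 𝕜 E M, (r : GermSection 𝕜 M) y = 1 ∧ r * s = 0 := by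
  obtain ⟨p, hp, rfl⟩ := exists_eq_ofFun s
  obtain ⟨r, hr1, hr0⟩ := exists_eq_one_of_isOpen (𝕜 := 𝕜) (E := E)
    isOpen_setOfPred_eventually_nhds (coe_ofFun_eq_zero_iff.1 h)
  refine ⟨r, hr1, Subtype.ext (funext fun z => ?_)⟩
  by_cases hz : ∀ᶠ x in 𝓝 z, p x = 0
  · exact mul_eq_zero_of_right _ (coe_ofFun_eq_zero_iff.2 hz)
  · exact mul_eq_zero_of_left (hr0 z hz) _

end LocalFunctions

namespace BisectionFun

theorem exists_eq_one_on_support (a : BisectionFun G 𝕜) :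
    ∃ χ : G.Arrow → 𝕜, SmoothCompactlySupportedOn E a.dom χ ∧
      ∀ x ∈ a.dom, a.fn x * χ x = a.fn x := by
  obtain ⟨-, K, hKV, hK, h0⟩ := a.smooth
  obtain ⟨χ, hχ, h1⟩ := exists_bump_of_isCompact 𝕜 E a.isOpen a.t2Space hK hKV
  refine ⟨χ, hχ, fun x hx => ?_⟩
  by_cases hxK : x ∈ K
  · rw [h1.self_of_nhdsSet x hxK, mul_one]
  · rw [h0 x hx hxK, zero_mul]

/-- A function on the bisection of `a` which is `1` on the support of `a`. -/
def one (a : BisectionFun G 𝕜) : BisectionFun G 𝕜 :=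
  { a with
    fn := a.exists_eq_one_on_support.choose
    smooth := a.exists_eq_one_on_support.choose_spec.1 }

theorem fn_mul_one (a : BisectionFun G 𝕜) {x : G.Arrow} (hx : x ∈ a.dom) :
    a.fn x * a.one.fn x = a.fn x :=
  a.exists_eq_one_on_support.choose_spec.2 x hx

theorem one_mul_fn (a : BisectionFun G 𝕜) {x : G.Arrow} (hx : x ∈ a.dom) :
    a.one.fn x * a.fn x = a.fn x := by
  rw [mul_comm, a.fn_mul_one hx]

variable (𝕜) in
theorem exists_eventually_eq_one (g : G.Arrow) :
    ∃ e : BisectionFun G 𝕜, g ∈ e.dom ∧ ∀ᶠ x in 𝓝 g, e.fn x = 1 := by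
  obtain ⟨V, hV, hg, hs, ht⟩ := ((isLocalProperty_injOn G.src_isLocalHomeomorph).and
    (isLocalProperty_injOn G.tgt_isLocalHomeomorph)).exists_isOpen g
  have hV2 : T2Space V := T2Space.of_injective_continuous (f := V.domRestrict G.tgt)
    (Set.injOn_iff_injective.1 ht)
    (G.tgt_isLocalHomeomorph.continuous.comp continuous_subtype_val)
  obtain ⟨f, hf, h1⟩ := exists_bump 𝕜 E hV hV2 hg
  exact ⟨⟨V, f, hV, hs, ht, hf⟩, hg, h1⟩

variable (𝕜) in
/-- A function on a bisection through the arrow `g` which is `1` near `g`. -/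
def bump (g : G.Arrow) : BisectionFun G 𝕜 := (exists_eventually_eq_one 𝕜 g).choose

theorem mem_bump_dom (g : G.Arrow) : g ∈ (bump 𝕜 g).dom :=
  (exists_eventually_eq_one 𝕜 g).choose_spec.1

theorem bump_eventually_eq_one (g : G.Arrow) : ∀ᶠ x in 𝓝 g, (bump 𝕜 g).fn x = 1 :=
  (exists_eventually_eq_one 𝕜 g).choose_spec.2

theorem coe_toCc_bump_self (g : G.Arrow) :
    ((bump 𝕜 g).toCc : GermSection 𝕜 G.Arrow) g = 1 :=
  (zeroExt_of_mem (mem_bump_dom g) _).trans (Germ.coe_eq.2 (bump_eventually_eq_one g))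

end BisectionFun

section Counit

open BisectionFun

theorem exists_counitCc_toCc_eq (a : BisectionFun G 𝕜) :
    ∃ (p : M → 𝕜) (hp : SmoothCompactlySupportedOn E Set.univ p),
      counitCc G 𝕜 a.toCc = ofFun p hp ∧ ∀ x ∈ a.dom, p (G.tgt x) = a.fn x := by
  obtain ⟨F, hF⟩ := exists_forall_comp_eq_of_injOn a.injOn_tgt a.fn
  obtain ⟨p, hp, h⟩ := exists_eq_ofFun (counitCc G 𝕜 a.toCc)
  refine ⟨p, hp, h, fun x hx => ?_⟩
  have hpF : (p : Germ (𝓝 (G.tgt x)) 𝕜) = F := by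
    rw [← coe_ofFun p hp, ← h, coe_counitCc, coe_toCc,
      pushforward_zeroExt _ a.isOpen a.injOn_tgt hF, zeroExt_of_mem (Set.mem_image_of_mem _ hx)]
  rw [(Germ.coe_eq.1 hpF).self_of_nhds, hF x hx]

theorem coe_counitCc_toCc_of_notMem {a : BisectionFun G 𝕜} {y : M} (hy : y ∉ G.tgt '' a.dom) :
    (counitCc G 𝕜 a.toCc : GermSection 𝕜 M) y = 0 := by
  obtain ⟨F, hF⟩ := exists_forall_comp_eq_of_injOn a.injOn_tgt a.fn
  rw [coe_counitCc, coe_toCc, pushforward_zeroExt _ a.isOpen a.injOn_tgt hF, zeroExt_of_notMem hy]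

variable [IsManifold 𝓘(ℝ, E) ∞ M]

theorem lact_counitCc_toCc {a b c : BisectionFun G 𝕜} (hab : b.dom = a.dom) (hbc : b.dom = c.dom)
    (h : ∀ x ∈ b.dom, a.fn x * b.fn x = c.fn x) :
    (convAlgebra G 𝕜).lact (counitCc G 𝕜 a.toCc) b.toCc = c.toCc := by
  obtain ⟨p, hp, hε, hpa⟩ := exists_counitCc_toCc_eq a
  rw [hε, lact_toCc]
  refine toCc_congr hbc fun x hx => ?_
  rw [← h x hx, ← hpa x (hab ▸ hx)]
  rfl

theorem lact_counitCc_one (a : BisectionFun G 𝕜) :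
    (convAlgebra G 𝕜).lact (counitCc G 𝕜 a.toCc) a.one.toCc = a.toCc :=
  lact_counitCc_toCc rfl rfl fun _ => a.fn_mul_one

end Counit

section LocalForm

open BisectionFun

variable [IsManifold 𝓘(ℝ, E) ∞ M]

theorem exists_lact_toCc_eq {a b : BisectionFun G 𝕜} {g : G.Arrow} (ha : g ∈ a.dom)
    (hb : g ∈ b.dom) (h : a.fn =ᶠ[𝓝 g] b.fn) :
    ∃ r : CcAlg 𝕜 E M, (r : GermSection 𝕜 M) (G.tgt g) = 1 ∧
      (convAlgebra G 𝕜).lact r a.toCc = (convAlgebra G 𝕜).lact r b.toCc := by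
  let D := a.dom ∩ b.dom ∩ {x | a.fn =ᶠ[𝓝 x] b.fn}
  have hD : IsOpen D := (a.isOpen.inter b.isOpen).inter isOpen_setOfPred_eventually_nhds
  obtain ⟨r, hr1, hr0⟩ := exists_eq_one_of_isOpen (𝕜 := 𝕜) (E := E)
    (G.tgt_isLocalHomeomorph.isOpenMap D hD) ⟨g, ⟨⟨ha, hb⟩, h⟩, rfl⟩
  refine ⟨r, hr1, Subtype.ext (funext fun x => ?_)⟩
  rw [coe_lact, coe_lact, Pi.mul_apply, Pi.mul_apply, coe_toCc, coe_toCc, sectionPullback]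
  by_cases hx : G.tgt x ∈ G.tgt '' D
  · obtain ⟨x', hx', e⟩ := hx
    by_cases hxD : x ∈ D
    · rw [zeroExt_of_mem hxD.1.1, zeroExt_of_mem hxD.1.2, Germ.coe_eq.2 hxD.2]
    · rw [zeroExt_of_notMem fun h => hxD (a.injOn_tgt hx'.1.1 h e ▸ hx'),
        zeroExt_of_notMem fun h => hxD (b.injOn_tgt hx'.1.2 h e ▸ hx')]
  · rw [hr0 _ hx, map_zero, zero_mul, zero_mul]

theorem exists_lact_toCc_local_form (a : BisectionFun G 𝕜) (y : M) :
    ∃ r : CcAlg 𝕜 E M, (r : GermSection 𝕜 M) y = 1 ∧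
      ((convAlgebra G 𝕜).lact r a.toCc = 0 ∨
        ∃ (g : {g // G.tgt g = y}) (s : CcAlg 𝕜 E M), (convAlgebra G 𝕜).lact r a.toCc =
          (convAlgebra G 𝕜).lact r ((convAlgebra G 𝕜).lact s (bump 𝕜 g.1).toCc)) := by
  by_cases hy : y ∈ G.tgt '' a.dom
  · obtain ⟨g, hg, rfl⟩ := hy
    obtain ⟨p, hp, -, hpa⟩ := exists_counitCc_toCc_eq a
    have hag : a.fn =ᶠ[𝓝 g] (p ∘ G.tgt) * (bump 𝕜 g).fn := by
      filter_upwards [a.isOpen.mem_nhds hg, bump_eventually_eq_one (𝕜 := 𝕜) g] with x hx h1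
      rw [Pi.mul_apply, h1, mul_one, Function.comp_apply, hpa x hx]
    obtain ⟨r, hr1, hr⟩ := exists_lact_toCc_eq
      (b := (bump 𝕜 g).mulLeft (p ∘ G.tgt) (contMDiff_comp_tgt hp)) hg (mem_bump_dom g) hag
    exact ⟨r, hr1, Or.inr ⟨⟨g, rfl⟩, ofFun p hp, by rw [lact_toCc, hr]⟩⟩
  · obtain ⟨r, hr1, hr⟩ := exists_eq_one_of_eq_zero (coe_counitCc_toCc_of_notMem hy)
    refine ⟨r, hr1, Or.inl ?_⟩
    rw [← lact_counitCc_one, ← AlgebraOver.lact_mul, hr, map_zero, LinearMap.zero_apply]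

end LocalForm

section OmegaInjective

open BisectionFun

variable [IsManifold 𝓘(ℝ, E) ∞ M]

/-- The elements of `A ⊗_R A`, where `A = C_c^∞(G)` and `R = C_c^∞(M)`, whose germ at `y`
vanishes. -/
def germKer (y : M) : Submodule 𝕜 (convAlgebra G 𝕜).LL where
  carrier := {x | ∃ r : CcAlg 𝕜 E M, (r : GermSection 𝕜 M) y = 1 ∧
    (convAlgebra G 𝕜).lactLL r x = 0}
  zero_mem' := by
    obtain ⟨r, hr, -⟩ := exists_eq_one_of_isOpen (𝕜 := 𝕜) (E := E) isOpen_univ (Set.mem_univ y)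
    exact ⟨r, hr, map_zero _⟩
  add_mem' := by
    rintro x x' ⟨r, hr, h⟩ ⟨r', hr', h'⟩
    refine ⟨r * r', (congrArg₂ _ hr hr').trans (mul_one 1), ?_⟩
    rw [map_add, AlgebraOver.lactLL_mul _ _ _ x', h', map_zero, add_zero, mul_comm,
      AlgebraOver.lactLL_mul, h, map_zero]
  smul_mem' := by
    rintro c x ⟨r, hr, h⟩
    exact ⟨r, hr, by rw [map_smul, h, smul_zero]⟩

theorem omega_eq_zero_of_mem_germKer {y : M} {x : (convAlgebra G 𝕜).LL} (hx : x ∈ germKer y)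
    (q : G.tgt.Pullback G.tgt) (hq : G.tgt q.1.1 = y) : omega G 𝕜 x q = 0 := by
  obtain ⟨r, hr, h⟩ := hx
  subst hq
  have hrq := congrFun (omega_lactLL r x) q
  rwa [h, map_zero, Pi.zero_apply, Pi.mul_apply, sectionPullback_eq_one _ (by exact hr), one_mul,
    eq_comm] at hrq

theorem exists_isCompact_lactLL_eq_self (x : (convAlgebra G 𝕜).LL) :
    ∃ C : Set M, IsCompact C ∧ ∀ r : CcAlg 𝕜 E M, (∀ y ∈ C, (r : GermSection 𝕜 M) y = 1) →
      (convAlgebra G 𝕜).lactLL r x = x := by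
  induction x using AlgebraOver.induction_LL with
  | zero => exact ⟨∅, isCompact_empty, fun _ _ => map_zero _⟩
  | add x x' hx hx' =>
    obtain ⟨C, hC, h⟩ := hx
    obtain ⟨C', hC', h'⟩ := hx'
    refine ⟨C ∪ C', hC.union hC', fun r hr => ?_⟩
    rw [map_add, h r fun y hy => hr y (Or.inl hy), h' r fun y hy => hr y (Or.inr hy)]
  | tmul u v =>
    obtain ⟨C, hC, h⟩ := exists_isCompact_local_identity u
    refine ⟨C, hC, fun r hr => ?_⟩
    rw [AlgebraOver.lactLL_mk]
    exact congrArg (fun u => (convAlgebra G 𝕜).mkLL (u ⊗ₜ[𝕜] v)) (h r hr).2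

theorem eq_zero_of_forall_mem_germKer {x : (convAlgebra G 𝕜).LL} (hx : ∀ y, x ∈ germKer y) :
    x = 0 := by
  obtain ⟨C, hC, h⟩ := exists_isCompact_lactLL_eq_self x
  obtain ⟨χ, ⟨hχ, hχx⟩, h1⟩ := exists_eventually_eq_one_of_isCompact
    (p := fun χ : M → 𝕜 => ∃ hχ : SmoothCompactlySupportedOn E Set.univ χ,
      (convAlgebra G 𝕜).lactLL (ofFun χ hχ) x = 0)
    ⟨.zero, by rw [show ofFun (E := E) (0 : M → 𝕜) .zero = 0 from Subtype.ext (zeroExt_zero _),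
      AlgebraOver.lactLL_zero]⟩
    (fun χ χ' ⟨hχ, h⟩ ⟨hχ', h'⟩ => ⟨(hχ.add hχ').sub (hχ'.mul_left hχ.1), by
      have hof : ofFun (χ + χ' - χ * χ') ((hχ.add hχ').sub (hχ'.mul_left hχ.1)) =
          ofFun χ hχ + ofFun χ' hχ' - ofFun χ hχ * ofFun χ' hχ' := by
        rw [ofFun_mul]
        exact Subtype.ext ((zeroExt_sub _ _ _).trans (congrArg (· - _) (zeroExt_add _ _ _)))
      rw [hof, AlgebraOver.lactLL_sub, AlgebraOver.lactLL_add, AlgebraOver.lactLL_mul, h', h,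
        map_zero, add_zero, sub_zero]⟩)
    hC fun y _ => by
      obtain ⟨r, hr1, hr⟩ := hx y
      obtain ⟨p, hp, rfl⟩ := exists_eq_ofFun r
      exact ⟨p, ⟨hp, hr⟩, coe_ofFun_eq_one_iff.1 hr1⟩
  rw [← hχx, h _ fun y hy => coe_ofFun_eq_one_iff.2 (eventually_nhdsSet_iff_forall.1 h1 y hy)]

variable (G 𝕜) in
/-- The element of `A ⊗_R A`, where `A = C_c^∞(G)` and `R = C_c^∞(M)`, concentrated near the pair
`i` of arrows over `y`, with coefficient `s`. -/
def germTensor (y : M) (i : {g // G.tgt g = y} × {g // G.tgt g = y}) (s : CcAlg 𝕜 E M) :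
    (convAlgebra G 𝕜).LL :=
  (convAlgebra G 𝕜).lactLL s ((convAlgebra G 𝕜).mkLL ((bump 𝕜 i.1.1).toCc ⊗ₜ[𝕜]
    (bump 𝕜 i.2.1).toCc))

theorem germTensor_add (y : M) (i : {g // G.tgt g = y} × {g // G.tgt g = y})
    (s s' : CcAlg 𝕜 E M) :
    germTensor G 𝕜 y i (s + s') = germTensor G 𝕜 y i s + germTensor G 𝕜 y i s' :=
  AlgebraOver.lactLL_add _ s s' _

theorem germTensor_zero (y : M) (i : {g // G.tgt g = y} × {g // G.tgt g = y}) :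
    germTensor G 𝕜 y i 0 = 0 :=
  AlgebraOver.lactLL_zero _ _

theorem exists_germ_expansion (y : M) (x : (convAlgebra G 𝕜).LL) :
    ∃ c : ({g // G.tgt g = y} × {g // G.tgt g = y}) →₀ CcAlg 𝕜 E M,
      x - c.sum (germTensor G 𝕜 y) ∈ germKer y := by
  classical
  induction x using EtGrpd.induction_LL with
  | zero => exact ⟨0, by simp only [Finsupp.sum_zero_index, sub_zero, zero_mem]⟩
  | add x x' hx hx' =>
    obtain ⟨c, h⟩ := hx
    obtain ⟨c', h'⟩ := hx'
    refine ⟨c + c', ?_⟩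
    rw [Finsupp.sum_add_index' (germTensor_zero y) (germTensor_add y), add_sub_add_comm]
    exact add_mem h h'
  | basic a b =>
    obtain ⟨r, hr1, hr⟩ := exists_lact_toCc_local_form a y
    obtain ⟨r', hr1', hr'⟩ := exists_lact_toCc_local_form b y
    have hrr' : ((r * r' : CcAlg 𝕜 E M) : GermSection 𝕜 M) y = 1 :=
      (congrArg₂ _ hr1 hr1').trans (mul_one 1)
    rcases hr with hr | ⟨g, s, hr⟩
    · refine ⟨0, r * r', hrr', ?_⟩
      rw [Finsupp.sum_zero_index, sub_zero, AlgebraOver.lactLL_mul_mk, hr,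
        TensorProduct.zero_tmul, map_zero]
    rcases hr' with hr' | ⟨g', s', hr'⟩
    · refine ⟨0, r * r', hrr', ?_⟩
      rw [Finsupp.sum_zero_index, sub_zero, AlgebraOver.lactLL_mul_mk, hr',
        TensorProduct.tmul_zero, map_zero]
    refine ⟨Finsupp.single (g, g') (s * s'), r * r', hrr', ?_⟩
    have hsum : (Finsupp.single (g, g') (s * s')).sum (germTensor G 𝕜 y) =
        germTensor G 𝕜 y (g, g') (s * s') := Finsupp.sum_single_index (germTensor_zero y _)
    rw [hsum, map_sub, sub_eq_zero, germTensor, AlgebraOver.lactLL_mul_mk,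
      AlgebraOver.lactLL_mul_mk, AlgebraOver.lactLL_mul_mk, hr, hr']

theorem omega_germTensor_of_ne {y : M} {i j : {g // G.tgt g = y} × {g // G.tgt g = y}}
    (hij : i ≠ j) (s : CcAlg 𝕜 E M) :
    omega G 𝕜 (germTensor G 𝕜 y i s) ⟨(j.1.1, j.2.1), j.1.2.trans j.2.2.symm⟩ = 0 := by
  rw [germTensor, omega_lactLL, omega_toCc, Pi.mul_apply, zeroExt_of_notMem, mul_zero]
  rintro ⟨h1, h2⟩
  exact hij (Prod.ext
    (Subtype.ext ((bump 𝕜 i.1.1).injOn_tgt (mem_bump_dom _) h1 (i.1.2.trans j.1.2.symm)))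
    (Subtype.ext ((bump 𝕜 i.2.1).injOn_tgt (mem_bump_dom _) h2 (i.2.2.trans j.2.2.symm))))

theorem germTensor_mem_germKer {y : M} {i : {g // G.tgt g = y} × {g // G.tgt g = y}}
    {s : CcAlg 𝕜 E M}
    (h : omega G 𝕜 (germTensor G 𝕜 y i s) ⟨(i.1.1, i.2.1), i.1.2.trans i.2.2.symm⟩ = 0) :
    germTensor G 𝕜 y i s ∈ germKer y := by
  obtain ⟨⟨g, rfl⟩, ⟨g', hg'⟩⟩ := i
  let q : G.tgt.Pullback G.tgt := ⟨(g, g'), hg'.symm⟩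
  have omega_bump_q : omega G 𝕜 ((convAlgebra G 𝕜).mkLL
      ((bump 𝕜 g).toCc ⊗ₜ[𝕜] (bump 𝕜 g').toCc)) q = 1 := by
    rw [omega_tmul, extProd, LinearMap.mk₂_apply]
    simp only [q, coe_toCc_bump_self, germPullback_one, mul_one]
  have hs : (s : GermSection 𝕜 M) (G.tgt g) = 0 := by
    rw [germTensor, omega_lactLL, Pi.mul_apply] at h
    erw [omega_bump_q] at h
    rw [mul_one] at h
    exact germPullback_injective (G.tgt_isLocalHomeomorph.comp (isLocalHomeomorph_pullback_fst
      G.tgt_isLocalHomeomorph.continuous G.tgt_isLocalHomeomorph)) (x := q) rfl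
        (h.trans (map_zero _).symm)
  obtain ⟨r, hr1, hr⟩ := exists_eq_one_of_eq_zero hs
  exact ⟨r, hr1, by rw [germTensor, ← AlgebraOver.lactLL_mul, hr, AlgebraOver.lactLL_zero]⟩

theorem omega_injective : Function.Injective (omega G 𝕜) := by
  rw [injective_iff_map_eq_zero]
  intro x hx
  refine eq_zero_of_forall_mem_germKer fun y => ?_
  obtain ⟨c, hc⟩ := exists_germ_expansion y x
  have hsum : c.sum (germTensor G 𝕜 y) ∈ germKer y := by
    refine Submodule.sum_mem _ fun i hi => germTensor_mem_germKer ?_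
    have h := omega_eq_zero_of_mem_germKer hc ⟨(i.1.1, i.2.1), i.1.2.trans i.2.2.symm⟩ i.1.2
    rwa [map_sub, hx, zero_sub, Pi.neg_apply, neg_eq_zero, Finsupp.sum, map_sum,
      Finset.sum_apply, Finset.sum_eq_single i (fun j _ hji => omega_germTensor_of_ne hji _)
        fun h => (h hi).elim] at h
  simpa only [sub_add_cancel] using add_mem hc hsum

end OmegaInjective

end EtGrpd

/-! ### Tensor products over the base algebra -/

namespace AlgebraOver

variable {𝕜 : Type*} [Field 𝕜] {R : Type*} [NonUnitalCommRing R] [Module 𝕜 R]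
  [IsScalarTower 𝕜 R R] [SMulCommClass 𝕜 R R] {A : Type*} [AddCommGroup A] [Module 𝕜 A]
  (X : AlgebraOver 𝕜 R A)

theorem flipLL_mk (a b : A) : X.flipLL (X.mkLL (a ⊗ₜ[𝕜] b)) = X.mkLL (b ⊗ₜ[𝕜] a) :=
  X.liftLL_mk _ _ a b

theorem mulRL_antipodeId_mk (S : A →ₗ[𝕜] A) (hS : ∀ r a, S (X.lact r a) = X.ract r (S a))
    (a b : A) : X.mulRL (X.antipodeId S hS (X.mkLL (a ⊗ₜ[𝕜] b))) = X.mul (S a) b := by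
  simp [antipodeId, mulRL, liftRL, mkRL]

theorem tmulRight_mk (a b c : A) : X.tmulRight (X.mkLL (a ⊗ₜ[𝕜] b)) c = X.mk₃ a b c := by
  simp [tmulRight]

theorem tmulLeft_mk (a b c : A) : X.tmulLeft a (X.mkLL (b ⊗ₜ[𝕜] c)) = X.mk₃ a b c := by
  simp [tmulLeft]

theorem idCounit_mk (ε : A →ₗ[𝕜] R) (hε : ∀ r a, ε (X.lact r a) = r * ε a) (a b : A) :
    X.idCounit ε hε (X.mkLL (a ⊗ₜ[𝕜] b)) = X.lact (ε b) a :=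
  X.liftLL_mk _ _ a b

theorem counitId_mk (ε : A →ₗ[𝕜] R) (hε : ∀ r a, ε (X.lact r a) = r * ε a) (a b : A) :
    X.counitId ε hε (X.mkLL (a ⊗ₜ[𝕜] b)) = X.lact (ε a) b := by
  simp [counitId]

theorem comulId_mk (Δ : A →ₗ[𝕜] X.LL) (hΔ : ∀ r a, Δ (X.lact r a) = X.lactLL r (Δ a))
    (a b : A) : X.comulId Δ hΔ (X.mkLL (a ⊗ₜ[𝕜] b)) = X.tmulRight (Δ a) b := by
  simp [comulId]

theorem idComul_mk (Δ : A →ₗ[𝕜] X.LL) (hΔ : ∀ r a, Δ (X.lact r a) = X.lactLL r (Δ a))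
    (a b : A) : X.idComul Δ hΔ (X.mkLL (a ⊗ₜ[𝕜] b)) = X.tmulLeft a (Δ b) := by
  simp [idComul]

theorem comulId_eq_idComul (Δ : A →ₗ[𝕜] X.LL) (hΔ : ∀ r a, Δ (X.lact r a) = X.lactLL r (Δ a))
    {a e e' : A} (h : Δ a = X.mkLL (a ⊗ₜ[𝕜] e)) (h' : Δ a = X.mkLL (a ⊗ₜ[𝕜] e'))
    (he : Δ e = X.mkLL (e ⊗ₜ[𝕜] e')) : X.comulId Δ hΔ (Δ a) = X.idComul Δ hΔ (Δ a) :=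
  calc X.comulId Δ hΔ (Δ a) = X.mk₃ a e e' := by rw [h', comulId_mk, h, tmulRight_mk]
    _ = X.idComul Δ hΔ (Δ a) := by rw [h, idComul_mk, he, tmulLeft_mk]

theorem ractFst_mk (r : R) (a b : A) :
    X.ractFst r (X.mkLL (a ⊗ₜ[𝕜] b)) = X.mkLL (X.ract r a ⊗ₜ[𝕜] b) := by
  simp [ractFst]

theorem ractSnd_mk (r : R) (a b : A) :
    X.ractSnd r (X.mkLL (a ⊗ₜ[𝕜] b)) = X.mkLL (a ⊗ₜ[𝕜] X.ract r b) := by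
  simp [ractSnd]

/-- The right multiplication `a ⊗ b ↦ ac ⊗ bd` on `A ⊗_R^{ll} A`. -/
def rmulLL (c d : A) : X.LL →ₗ[𝕜] X.LL :=
  X.mapLL X (X.mul.flip c) (X.mul.flip d) (fun r a => X.mul_assoc (X.incl r) a c)
    (fun r a => X.mul_assoc (X.incl r) a d)

theorem rmulLL_mk (a b c d : A) :
    X.rmulLL c d (X.mkLL (a ⊗ₜ[𝕜] b)) = X.mkLL (X.mul a c ⊗ₜ[𝕜] X.mul b d) :=
  X.mapLL_mk X _ _ _ _ a b

theorem mkLL_mulTensor_tmul (x : A ⊗[𝕜] A) (c d : A) :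
    X.mkLL (X.mulTensor x (c ⊗ₜ[𝕜] d)) = X.rmulLL c d (X.mkLL x) := by
  have h : X.mkLL ∘ₗ X.mulTensor.flip (c ⊗ₜ[𝕜] d) = X.rmulLL c d ∘ₗ X.mkLL :=
    TensorProduct.ext' fun a b => (X.rmulLL_mk a b c d).symm
  exact LinearMap.congr_fun h x

theorem rmulLL_lact_left (r : R) (c d : A) (x : X.LL) :
    X.rmulLL (X.lact r c) d x = X.rmulLL c d (X.ractFst r x) := by
  have h : X.rmulLL (X.lact r c) d = X.rmulLL c d ∘ₗ X.ractFst r :=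
    hom_ext_LL fun a b => by simp [rmulLL_mk, ractFst_mk, lact_apply, ract_apply, X.mul_assoc]
  exact LinearMap.congr_fun h x

theorem rmulLL_lact_right (r : R) (c d : A) (x : X.LL) :
    X.rmulLL c (X.lact r d) x = X.rmulLL c d (X.ractSnd r x) := by
  have h : X.rmulLL c (X.lact r d) = X.rmulLL c d ∘ₗ X.ractSnd r :=
    hom_ext_LL fun a b => by simp [rmulLL_mk, ractSnd_mk, lact_apply, ract_apply, X.mul_assoc]
  exact LinearMap.congr_fun h x

theorem mkLL_mulTensor_congr {x x' y y' : A ⊗[𝕜] A} (hx : X.mkLL x = X.mkLL x')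
    (hy : X.mkLL y = X.mkLL y') (h : ∀ r, X.ractFst r (X.mkLL x) = X.ractSnd r (X.mkLL x)) :
    X.mkLL (X.mulTensor x y) = X.mkLL (X.mulTensor x' y') := by
  have congr_left : X.mkLL ∘ₗ X.mulTensor x = X.mkLL ∘ₗ X.mulTensor x' :=
    TensorProduct.ext' fun c d => by
      simp only [LinearMap.comp_apply, mkLL_mulTensor_tmul, hx]
  have relLL_le : X.relLL ≤ LinearMap.ker (X.mkLL ∘ₗ X.mulTensor x) := by
    refine Submodule.span_le.2 ?_
    rintro _ ⟨r, c, d, rfl⟩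
    rw [SetLike.mem_coe, LinearMap.mem_ker, map_sub, sub_eq_zero, LinearMap.comp_apply,
      LinearMap.comp_apply, mkLL_mulTensor_tmul, mkLL_mulTensor_tmul, rmulLL_lact_left,
      rmulLL_lact_right, h]
  have congr_right := relLL_le ((Submodule.Quotient.eq _).1 hy)
  rw [LinearMap.mem_ker, map_sub, sub_eq_zero] at congr_right
  exact congr_right.trans (LinearMap.congr_fun congr_left y')

theorem exists_bilin_eq_mkLL_mulTensor {Δ : A →ₗ[𝕜] X.LL}
    (hΔ : ∀ r a, X.ractFst r (Δ a) = X.ractSnd r (Δ a)) :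
    ∃ B : A →ₗ[𝕜] A →ₗ[𝕜] X.LL, ∀ a b x y, X.mkLL x = Δ a → X.mkLL y = Δ b →
      B a b = X.mkLL (X.mulTensor x y) := by
  obtain ⟨σ, hσ⟩ := X.mkLL.exists_rightInverse_of_surjective X.relLL.range_mkQ
  have mkLL_σ (z : X.LL) : X.mkLL (σ z) = z := LinearMap.congr_fun hσ z
  refine ⟨(X.mulTensor.compl₁₂ (σ ∘ₗ Δ) (σ ∘ₗ Δ)).compr₂ X.mkLL, fun a b x y hx hy => ?_⟩
  refine X.mkLL_mulTensor_congr ((mkLL_σ (Δ a)).trans hx.symm) ((mkLL_σ (Δ b)).trans hy.symm)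
    fun r => ?_
  rw [LinearMap.comp_apply, mkLL_σ, hΔ]

end AlgebraOver

/-! ### The structure maps of the Hopf algebroid -/

namespace EtGrpd

variable {E : Type v} [NormedAddCommGroup E] [NormedSpace ℝ E]
  {M : Type w} [TopologicalSpace M] [ChartedSpace E M] {G : EtGrpd.{u} E M}

section Inverse

theorem inv_injective : Function.Injective G.inv := Function.LeftInverse.injective inv_inv

theorem image_inv_setMul (U V : Set G.Arrow) :
    G.inv '' G.setMul U V = G.setMul (G.inv '' V) (G.inv '' U) := by
  ext g
  constructor
  · rintro ⟨_, ⟨⟨⟨x, y⟩, e⟩, ⟨hx, hy⟩, rfl⟩, rfl⟩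
    rw [inv_mul_rev]
    exact mem_setMul (Set.mem_image_of_mem _ hy) (Set.mem_image_of_mem _ hx) _
  · rintro ⟨⟨⟨_, _⟩, e⟩, ⟨⟨y, hy, rfl⟩, ⟨x, hx, rfl⟩⟩, rfl⟩
    have e' : G.src x = G.tgt y := (G.tgt_inv x).symm.trans (e.symm.trans (G.src_inv y))
    rw [← inv_mul_rev _ _ e']
    exact ⟨_, mem_setMul hx hy e', rfl⟩

theorem image_inv_setMul_self {U : Set G.Arrow} (hU : Set.InjOn G.tgt U) :
    G.setMul (G.inv '' U) U = G.unit '' (G.tgt '' (G.inv '' U)) := by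
  ext g
  constructor
  · rintro ⟨⟨⟨_, y⟩, e⟩, ⟨⟨x, hx, rfl⟩, hy⟩, rfl⟩
    obtain rfl : x = y := hU hx hy ((G.src_inv x).symm.trans e)
    rw [G.inv_mul]
    exact ⟨_, ⟨G.inv x, ⟨x, hx, rfl⟩, G.tgt_inv x⟩, rfl⟩
  · rintro ⟨_, ⟨_, ⟨x, hx, rfl⟩, rfl⟩, rfl⟩
    rw [G.tgt_inv, ← G.inv_mul]
    exact mem_setMul (Set.mem_image_of_mem _ hx) hx _

end Inverse

variable {𝕜 : Type z} [RCLike 𝕜]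

namespace BisectionFun

/-- The image `a ∘ inv` of a function on a bisection under the inverse map. -/
def inv (a : BisectionFun G 𝕜) : BisectionFun G 𝕜 where
  dom := G.inv '' a.dom
  fn := a.fn ∘ G.inv
  isOpen := G.inv_isLocalHomeomorph.isOpenMap _ a.isOpen
  injOn_src := by
    rintro _ ⟨x, hx, rfl⟩ _ ⟨y, hy, rfl⟩ h
    rw [G.src_inv, G.src_inv] at h
    rw [a.injOn_tgt hx hy h]
  injOn_tgt := by
    rintro _ ⟨x, hx, rfl⟩ _ ⟨y, hy, rfl⟩ h
    rw [G.tgt_inv, G.tgt_inv] at h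
    rw [a.injOn_src hx hy h]
  smooth := a.smooth.image G.inv_isLocalHomeomorph
    (hasSmoothLocalInverses_of_isLocalDiffeomorph G.inv_isLocalDiffeomorph) a.isOpen
    fun x _ => congrArg a.fn (inv_inv x)

theorem inv_fn (a : BisectionFun G 𝕜) (x : G.Arrow) : a.inv.fn (G.inv x) = a.fn x :=
  congrArg a.fn (inv_inv x)

/-- A function on `M`, as a function on the bisection of units. -/
def ofUnits (p : M → 𝕜) (hp : SmoothCompactlySupportedOn E Set.univ p) : BisectionFun G 𝕜 where
  dom := Set.range G.unit
  fn := p ∘ G.tgt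
  isOpen := G.isOpen_range_unit
  injOn_src := G.injOn_src_range_unit
  injOn_tgt := G.injOn_tgt_range_unit
  smooth := by
    rw [← Set.image_univ]
    exact hp.image G.unit_isLocalHomeomorph (hasSmoothLocalInverses_of_isLocalDiffeomorph
      G.unit_isLocalDiffeomorph) isOpen_univ fun x _ => congrArg p (G.tgt_unit x)

end BisectionFun

variable [FiniteDimensional ℝ E]

variable (G 𝕜) in
/-- The antipode `inv_+`. -/
def antipodeCc : Cc 𝕜 E G.Arrow →ₗ[𝕜] Cc 𝕜 E G.Arrow :=
  pushforwardCc G.inv_isLocalHomeomorph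
    (hasSmoothLocalInverses_of_isLocalDiffeomorph G.inv_isLocalDiffeomorph)

theorem antipodeCc_antipodeCc (u : Cc 𝕜 E G.Arrow) :
    antipodeCc G 𝕜 (antipodeCc G 𝕜 u) = u := by
  have hid : IsLocalHomeomorph (id : G.Arrow → G.Arrow) :=
    (Homeomorph.refl G.Arrow).isLocalHomeomorph
  exact Subtype.ext ((pushforward_pushforward _ _ hid inv_inv (Cc_le_fiberFinite hid u.2)).trans
    (pushforward_id hid (fun _ => rfl) u.1))

variable [T2Space M]

section Counit

theorem counitCc_lact [IsManifold 𝓘(ℝ, E) ∞ M] (r : CcAlg 𝕜 E M) (u : Cc 𝕜 E G.Arrow) :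
    counitCc G 𝕜 ((convAlgebra G 𝕜).lact r u) = r * counitCc G 𝕜 u := by
  obtain ⟨p, hp, rfl⟩ := exists_eq_ofFun r
  induction u using BisectionFun.induction with
  | zero => simp only [map_zero, mul_zero]
  | add u u' h h' => simp only [map_add, h, h', mul_add]
  | basic a =>
    obtain ⟨F, hF⟩ := exists_forall_comp_eq_of_injOn a.injOn_tgt a.fn
    have hpF : ∀ x ∈ a.dom, (p * F) (G.tgt x) = ((p ∘ G.tgt) * a.fn) x := fun x hx => by
      rw [Pi.mul_apply, hF x hx]
      rfl
    rw [lact_toCc]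
    refine Subtype.ext ?_
    calc (counitCc G 𝕜 (a.mulLeft (p ∘ G.tgt) (contMDiff_comp_tgt hp)).toCc : GermSection 𝕜 M)
      _ = zeroExt (G.tgt '' a.dom) (p * F) := pushforward_zeroExt _ a.isOpen a.injOn_tgt hpF
      _ = zeroExt Set.univ p * zeroExt (G.tgt '' a.dom) F := by
        rw [zeroExt_mul_zeroExt, Set.univ_inter]
      _ = zeroExt Set.univ p * (counitCc G 𝕜 a.toCc : GermSection 𝕜 M) :=
        congrArg _ (pushforward_zeroExt _ a.isOpen a.injOn_tgt hF).symm

theorem coe_inclCc_counitCc_toCc [IsManifold 𝓘(ℝ, E) ∞ M] (a : BisectionFun G 𝕜) {F : M → 𝕜}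
    (hF : ∀ x ∈ a.dom, F (G.tgt x) = a.fn x) :
    (inclCc G 𝕜 (counitCc G 𝕜 a.toCc) : GermSection 𝕜 G.Arrow) =
      zeroExt (G.unit '' (G.tgt '' a.dom)) (F ∘ G.tgt) := by
  rw [coe_inclCc, coe_counitCc, a.coe_toCc, pushforward_zeroExt _ a.isOpen a.injOn_tgt hF]
  exact pushforward_zeroExt _ (G.tgt_isLocalHomeomorph.isOpenMap _ a.isOpen)
    G.injective_unit.injOn fun x _ => congrArg F (G.tgt_unit x)

theorem inclCc_ofFun [IsManifold 𝓘(ℝ, E) ∞ M] (p : M → 𝕜)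
    (hp : SmoothCompactlySupportedOn E Set.univ p) :
    inclCc G 𝕜 (ofFun p hp) = (BisectionFun.ofUnits p hp).toCc :=
  Subtype.ext (coe_inclCc_ofFun p hp)

end Counit

section Comul

variable (G 𝕜) in
/-- The push-forward along the diagonal `G → G ×_M G`. -/
def diagCc : Cc 𝕜 E G.Arrow →ₗ[𝕜] GermSection 𝕜 (G.tgt.Pullback G.tgt) :=
  pushforwardFiberFinite (isLocalHomeomorph_diag G.tgt_isLocalHomeomorph) ∘ₗ
    Submodule.inclusion (Cc_le_fiberFinite (isLocalHomeomorph_diag G.tgt_isLocalHomeomorph))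

variable [IsManifold 𝓘(ℝ, E) ∞ M]

theorem omega_eq_diagCc {a b c : BisectionFun G 𝕜} (hb : b.dom = a.dom) (hc : c.dom = a.dom)
    (h : ∀ x ∈ a.dom, b.fn x * c.fn x = a.fn x) :
    omega G 𝕜 ((convAlgebra G 𝕜).mkLL (b.toCc ⊗ₜ[𝕜] c.toCc)) = diagCc G 𝕜 a.toCc := by
  have hdom : {q : G.tgt.Pullback G.tgt | q.1.1 ∈ b.dom ∧ q.1.2 ∈ c.dom} =
      (fun x => ⟨(x, x), rfl⟩) '' a.dom := by
    rw [hb, hc]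
    ext ⟨⟨x, y⟩, e⟩
    constructor
    · rintro ⟨hx, hy⟩
      obtain rfl : x = y := a.injOn_tgt hx hy e
      exact ⟨x, hx, rfl⟩
    · rintro ⟨z, hz, h⟩
      obtain ⟨rfl, rfl⟩ := Prod.mk.inj (congrArg Subtype.val h)
      exact ⟨hz, hz⟩
  rw [omega_toCc, hdom]
  exact (pushforward_zeroExt (isLocalHomeomorph_diag G.tgt_isLocalHomeomorph) a.isOpen
    (fun x _ y _ hxy => congrArg (fun p => p.1.1) hxy)
    (F := fun q => b.fn q.1.1 * c.fn q.1.2) h).symm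

theorem diagCc_mem_range_omega (u : Cc 𝕜 E G.Arrow) :
    diagCc G 𝕜 u ∈ LinearMap.range (omega G 𝕜) := by
  induction u using BisectionFun.induction with
  | zero => rw [map_zero]; exact zero_mem _
  | add u u' h h' => rw [map_add]; exact add_mem h h'
  | basic a => exact ⟨_, omega_eq_diagCc (b := a) (c := a.one) rfl rfl fun _ => a.fn_mul_one⟩

variable (G 𝕜) in
/-- The comultiplication `Ω_{t,t}⁻¹ ∘ diag_+`. -/
def comulCc : Cc 𝕜 E G.Arrow →ₗ[𝕜] (convAlgebra G 𝕜).LL :=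
  (LinearEquiv.ofInjective (omega G 𝕜) omega_injective).symm.toLinearMap ∘ₗ
    (diagCc G 𝕜).codRestrict (LinearMap.range (omega G 𝕜)) diagCc_mem_range_omega

theorem omega_comulCc (u : Cc 𝕜 E G.Arrow) : omega G 𝕜 (comulCc G 𝕜 u) = diagCc G 𝕜 u :=
  congrArg Subtype.val (LinearEquiv.apply_symm_apply
    (LinearEquiv.ofInjective (omega G 𝕜) omega_injective) _)

theorem comulCc_toCc {a b c : BisectionFun G 𝕜} (hb : b.dom = a.dom) (hc : c.dom = a.dom)
    (h : ∀ x ∈ a.dom, b.fn x * c.fn x = a.fn x) :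
    comulCc G 𝕜 a.toCc = (convAlgebra G 𝕜).mkLL (b.toCc ⊗ₜ[𝕜] c.toCc) :=
  omega_injective ((omega_comulCc _).trans (omega_eq_diagCc hb hc h).symm)

theorem comulCc_toCc_one (a : BisectionFun G 𝕜) :
    comulCc G 𝕜 a.toCc = (convAlgebra G 𝕜).mkLL (a.toCc ⊗ₜ[𝕜] a.one.toCc) :=
  comulCc_toCc rfl rfl fun _ => a.fn_mul_one

theorem comulCc_mulLeft_toCc {q : G.Arrow → 𝕜} (hq : ContMDiff 𝓘(ℝ, E) 𝓘(ℝ, 𝕜) ∞ q)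
    (a : BisectionFun G 𝕜) : comulCc G 𝕜 (a.mulLeft q hq).toCc =
      (convAlgebra G 𝕜).mkLL ((a.mulLeft q hq).toCc ⊗ₜ[𝕜] a.one.toCc) :=
  comulCc_toCc rfl rfl fun x hx =>
    (_root_.mul_assoc (q x) _ _).trans (congrArg (q x * ·) (a.fn_mul_one hx))

theorem comulCc_lact (r : CcAlg 𝕜 E M) (u : Cc 𝕜 E G.Arrow) :
    comulCc G 𝕜 ((convAlgebra G 𝕜).lact r u) =
      (convAlgebra G 𝕜).lactLL r (comulCc G 𝕜 u) := by
  obtain ⟨p, hp, rfl⟩ := exists_eq_ofFun r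
  induction u using BisectionFun.induction with
  | zero => simp only [map_zero]
  | add u u' h h' => simp only [map_add, h, h']
  | basic a =>
    rw [comulCc_toCc_one, AlgebraOver.lactLL_mk, lact_toCc, comulCc_mulLeft_toCc]

theorem ract_comulCc (r : CcAlg 𝕜 E M) (u : Cc 𝕜 E G.Arrow) :
    (convAlgebra G 𝕜).ractFst r (comulCc G 𝕜 u) =
      (convAlgebra G 𝕜).ractSnd r (comulCc G 𝕜 u) := by
  obtain ⟨p, hp, rfl⟩ := exists_eq_ofFun r
  induction u using BisectionFun.induction with
  | zero => simp only [map_zero]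
  | add u u' h h' => simp only [map_add, h, h']
  | basic a =>
    rw [comulCc_toCc_one, AlgebraOver.ractFst_mk, AlgebraOver.ractSnd_mk, ract_toCc, ract_toCc,
      ← comulCc_mulLeft_toCc]
    exact comulCc_toCc rfl rfl fun x hx =>
      (mul_left_comm _ _ _).trans (congrArg (p (G.src x) * ·) (a.fn_mul_one hx))

theorem idCounit_comulCc (u : Cc 𝕜 E G.Arrow) :
    (convAlgebra G 𝕜).idCounit (counitCc G 𝕜) counitCc_lact (comulCc G 𝕜 u) = u := by
  induction u using BisectionFun.induction with
  | zero => simp only [map_zero]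
  | add u u' h h' => simp only [map_add, h, h']
  | basic a =>
    rw [comulCc_toCc_one, AlgebraOver.idCounit_mk]
    exact lact_counitCc_toCc rfl rfl fun _ => a.one_mul_fn

theorem counitId_comulCc (u : Cc 𝕜 E G.Arrow) :
    (convAlgebra G 𝕜).counitId (counitCc G 𝕜) counitCc_lact (comulCc G 𝕜 u) = u := by
  induction u using BisectionFun.induction with
  | zero => simp only [map_zero]
  | add u u' h h' => simp only [map_add, h, h']
  | basic a => rw [comulCc_toCc_one, AlgebraOver.counitId_mk, lact_counitCc_one]

theorem comulCc_inclCc (r s : CcAlg 𝕜 E M) : comulCc G 𝕜 (inclCc G 𝕜 (r * s)) =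
    (convAlgebra G 𝕜).mkLL (inclCc G 𝕜 r ⊗ₜ[𝕜] inclCc G 𝕜 s) := by
  obtain ⟨p, hp, rfl⟩ := exists_eq_ofFun r
  obtain ⟨q, hq, rfl⟩ := exists_eq_ofFun s
  rw [ofFun_mul, inclCc_ofFun, inclCc_ofFun, inclCc_ofFun]
  exact comulCc_toCc rfl rfl fun _ _ => rfl

theorem comulCc_mul_toCc (a b : BisectionFun G 𝕜) : comulCc G 𝕜 (a.mul b).toCc =
    (convAlgebra G 𝕜).mkLL ((convAlgebra G 𝕜).mulTensor (a.toCc ⊗ₜ[𝕜] a.one.toCc)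
      (b.toCc ⊗ₜ[𝕜] b.one.toCc)) := by
  have mulTensor_eq : (convAlgebra G 𝕜).mulTensor (a.toCc ⊗ₜ[𝕜] a.one.toCc)
      (b.toCc ⊗ₜ[𝕜] b.one.toCc) =
        convCc G 𝕜 a.toCc b.toCc ⊗ₜ[𝕜] convCc G 𝕜 a.one.toCc b.one.toCc := rfl
  rw [mulTensor_eq, convCc_toCc, convCc_toCc]
  refine comulCc_toCc rfl rfl ?_
  rintro _ ⟨⟨⟨x, y⟩, e⟩, ⟨hx, hy⟩, rfl⟩
  rw [BisectionFun.mul_fn _ _ e hx hy, BisectionFun.mul_fn _ _ e (by exact hx) (by exact hy),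
    mul_mul_mul_comm, a.fn_mul_one hx, b.fn_mul_one hy]

theorem comulCc_mul {u v : Cc 𝕜 E G.Arrow} {x y : Cc 𝕜 E G.Arrow ⊗[𝕜] Cc 𝕜 E G.Arrow}
    (hx : (convAlgebra G 𝕜).mkLL x = comulCc G 𝕜 u)
    (hy : (convAlgebra G 𝕜).mkLL y = comulCc G 𝕜 v) :
    comulCc G 𝕜 (convCc G 𝕜 u v) =
      (convAlgebra G 𝕜).mkLL ((convAlgebra G 𝕜).mulTensor x y) := by
  obtain ⟨B, hB⟩ := (convAlgebra G 𝕜).exists_bilin_eq_mkLL_mulTensor ract_comulCc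
  suffices h : comulCc G 𝕜 (convCc G 𝕜 u v) = B u v from h.trans (hB u v x y hx hy)
  clear hx hy
  induction u, v using BisectionFun.induction₂ with
  | zero_left v => simp only [map_zero, LinearMap.zero_apply]
  | zero_right u => simp only [map_zero]
  | add_left u u' v h h' => simp only [map_add, LinearMap.add_apply, h, h']
  | add_right u v v' h h' => simp only [map_add, h, h']
  | basic a b =>
    rw [convCc_toCc, comulCc_mul_toCc]
    exact (hB _ _ _ _ (comulCc_toCc_one a).symm (comulCc_toCc_one b).symm).symm

theorem flipLL_comulCc (u : Cc 𝕜 E G.Arrow) :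
    (convAlgebra G 𝕜).flipLL (comulCc G 𝕜 u) = comulCc G 𝕜 u := by
  induction u using BisectionFun.induction with
  | zero => simp only [map_zero]
  | add u u' h h' => simp only [map_add, h, h']
  | basic a =>
    have swap : comulCc G 𝕜 a.toCc = (convAlgebra G 𝕜).mkLL (a.one.toCc ⊗ₜ[𝕜] a.toCc) :=
      comulCc_toCc (b := a.one) (c := a) rfl rfl fun _ => a.one_mul_fn
    rw [comulCc_toCc_one, AlgebraOver.flipLL_mk, ← comulCc_toCc_one, swap]

theorem comulId_comulCc (u : Cc 𝕜 E G.Arrow) :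
    (convAlgebra G 𝕜).comulId (comulCc G 𝕜) comulCc_lact (comulCc G 𝕜 u) =
      (convAlgebra G 𝕜).idComul (comulCc G 𝕜) comulCc_lact (comulCc G 𝕜 u) := by
  induction u using BisectionFun.induction with
  | zero => simp only [map_zero]
  | add u u' h h' => simp only [map_add, h, h']
  | basic a =>
    refine AlgebraOver.comulId_eq_idComul _ _ _ (comulCc_toCc_one a)
      (comulCc_toCc (b := a) (c := a.one.one) rfl rfl fun x hx => ?_) (comulCc_toCc_one a.one)
    rw [← a.fn_mul_one hx, _root_.mul_assoc, a.one.fn_mul_one hx]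

end Comul

section Antipode

theorem antipodeCc_toCc (a : BisectionFun G 𝕜) : antipodeCc G 𝕜 a.toCc = a.inv.toCc :=
  Subtype.ext (pushforward_zeroExt G.inv_isLocalHomeomorph a.isOpen inv_injective.injOn
    fun x _ => a.inv_fn x)

theorem antipodeCc_convCc (u v : Cc 𝕜 E G.Arrow) :
    antipodeCc G 𝕜 (convCc G 𝕜 u v) = convCc G 𝕜 (antipodeCc G 𝕜 v) (antipodeCc G 𝕜 u) := by
  induction u, v using BisectionFun.induction₂ with
  | zero_left v => simp only [map_zero, LinearMap.zero_apply]
  | zero_right u => simp only [map_zero, LinearMap.zero_apply]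
  | add_left u u' v h h' => simp only [map_add, LinearMap.add_apply, h, h']
  | add_right u v v' h h' => simp only [map_add, LinearMap.add_apply, h, h']
  | basic a b =>
    rw [convCc_toCc, antipodeCc_toCc, antipodeCc_toCc, antipodeCc_toCc, convCc_toCc]
    refine BisectionFun.toCc_congr (image_inv_setMul _ _) ?_
    rintro _ ⟨_, ⟨⟨⟨x, y⟩, e⟩, ⟨hx, hy⟩, rfl⟩, rfl⟩
    rw [BisectionFun.inv_fn, BisectionFun.mul_fn _ _ e hx hy, inv_mul_rev,
      BisectionFun.mul_fn _ _ _ (Set.mem_image_of_mem _ hy) (Set.mem_image_of_mem _ hx),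
      BisectionFun.inv_fn, BisectionFun.inv_fn, mul_comm]

variable [IsManifold 𝓘(ℝ, E) ∞ M]

theorem antipodeCc_inclCc (r : CcAlg 𝕜 E M) : antipodeCc G 𝕜 (inclCc G 𝕜 r) = inclCc G 𝕜 r :=
  Subtype.ext (pushforward_pushforward _ _ G.unit_isLocalHomeomorph inv_unit
    (Cc_le_fiberFinite G.unit_isLocalHomeomorph r.2))

theorem antipodeCc_lact (r : CcAlg 𝕜 E M) (u : Cc 𝕜 E G.Arrow) :
    antipodeCc G 𝕜 ((convAlgebra G 𝕜).lact r u) =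
      (convAlgebra G 𝕜).ract r (antipodeCc G 𝕜 u) :=
  (antipodeCc_convCc _ _).trans (congrArg _ (antipodeCc_inclCc r))

theorem inv_mul_one_toCc (a : BisectionFun G 𝕜) :
    (a.inv.mul a.one).toCc = inclCc G 𝕜 (counitCc G 𝕜 a.inv.toCc) := by
  obtain ⟨F, hF⟩ := exists_forall_comp_eq_of_injOn a.inv.injOn_tgt a.inv.fn
  refine Subtype.ext ?_
  rw [coe_inclCc_counitCc_toCc a.inv hF, BisectionFun.coe_toCc]
  refine (zeroExt_congr (BisectionFun.isOpen _) ?_).trans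
    (congrArg (zeroExt · _) (image_inv_setMul_self a.injOn_tgt))
  rintro _ ⟨⟨⟨_, y⟩, e⟩, ⟨⟨x, hx, rfl⟩, hy⟩, rfl⟩
  obtain rfl : x = y := a.injOn_tgt hx hy ((G.src_inv x).symm.trans e)
  rw [BisectionFun.mul_fn _ _ e (Set.mem_image_of_mem _ hx) hy, BisectionFun.inv_fn,
    a.fn_mul_one hx, Function.comp_apply, G.tgt_mul, ← a.inv_fn x]
  exact (hF _ ⟨x, hx, rfl⟩).symm

theorem mul_antipodeCc (u : Cc 𝕜 E G.Arrow) :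
    (convAlgebra G 𝕜).mulRL ((convAlgebra G 𝕜).antipodeId (antipodeCc G 𝕜) antipodeCc_lact
      (comulCc G 𝕜 u)) = inclCc G 𝕜 (counitCc G 𝕜 (antipodeCc G 𝕜 u)) := by
  induction u using BisectionFun.induction with
  | zero => simp only [map_zero]
  | add u u' h h' => simp only [map_add, h, h']
  | basic a =>
    rw [comulCc_toCc_one, AlgebraOver.mulRL_antipodeId_mk, antipodeCc_toCc, ← inv_mul_one_toCc]
    exact convCc_toCc _ _

end Antipode

end EtGrpd

/-! ### Functoriality -/

namespace EtGrpd

variable {E : Type v} [NormedAddCommGroup E] [NormedSpace ℝ E]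
  {M : Type w} [TopologicalSpace M] [ChartedSpace E M] {G H K : EtGrpd.{u} E M}

section Morphisms

theorem Hom.hasSmoothLocalInverses (φ : G ⟶ H) : HasSmoothLocalInverses E (Hom.toFun φ) := by
  intro x
  have hx := G.tgt_isLocalDiffeomorph x
  refine ⟨hx.localInverse ∘ H.tgt, ?_, ?_⟩
  · refine ContMDiffAt.comp _ ?_ H.tgt_isLocalDiffeomorph.contMDiff.contMDiffAt
    rw [Hom.tgt_map φ]
    exact hx.localInverse_contMDiffAt
  · filter_upwards [hx.localInverse_eventuallyEq_left] with y hy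
    rw [Function.comp_apply, Hom.tgt_map φ]
    exact hy

theorem Hom.map_inv (φ : G ⟶ H) (g : G.Arrow) :
    Hom.toFun φ (G.inv g) = H.inv (Hom.toFun φ g) := by
  refine eq_inv_of_mul_eq_unit
    (by rw [Hom.src_map φ, Hom.tgt_map φ, G.src_inv]) ?_
  have h := Hom.map_mul φ ⟨(G.inv g, g), G.src_inv g⟩
  rw [G.inv_mul, Hom.map_unit φ] at h
  exact h.symm.trans (congrArg H.unit (Hom.src_map φ g).symm)

theorem Hom.image_setMul (φ : G ⟶ H) (U V : Set G.Arrow) :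
    Hom.toFun φ '' G.setMul U V = H.setMul (Hom.toFun φ '' U) (Hom.toFun φ '' V) := by
  ext g
  constructor
  · rintro ⟨_, ⟨⟨⟨x, y⟩, e⟩, ⟨hx, hy⟩, rfl⟩, rfl⟩
    rw [Hom.map_mul φ]
    exact mem_setMul (Set.mem_image_of_mem _ hx) (Set.mem_image_of_mem _ hy) _
  · rintro ⟨⟨⟨_, _⟩, e⟩, ⟨⟨x, hx, rfl⟩, ⟨y, hy, rfl⟩⟩, rfl⟩
    have e' : G.src x = G.tgt y := (Hom.src_map φ x).symm.trans (e.trans (Hom.tgt_map φ y))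
    exact ⟨_, mem_setMul hx hy e', Hom.map_mul φ _⟩

end Morphisms

variable {𝕜 : Type z} [RCLike 𝕜]

namespace BisectionFun

theorem injOn_map (φ : G ⟶ H) (a : BisectionFun G 𝕜) : Set.InjOn (Hom.toFun φ) a.dom :=
  fun x hx y hy h => a.injOn_tgt hx hy (by rw [← Hom.tgt_map φ, h, Hom.tgt_map φ])

theorem exists_map (φ : G ⟶ H) (a : BisectionFun G 𝕜) : ∃ b : BisectionFun H 𝕜,
    b.dom = Hom.toFun φ '' a.dom ∧ ∀ x ∈ a.dom, b.fn (Hom.toFun φ x) = a.fn x := by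
  obtain ⟨F, hF⟩ := exists_forall_comp_eq_of_injOn (a.injOn_map φ) a.fn
  refine ⟨⟨_, F, (Hom.isLocalHomeomorph φ).isOpenMap _ a.isOpen, ?_, ?_,
    a.smooth.image (Hom.isLocalHomeomorph φ) (Hom.hasSmoothLocalInverses φ) a.isOpen hF⟩, rfl, hF⟩
  · rintro _ ⟨x, hx, rfl⟩ _ ⟨y, hy, rfl⟩ h
    rw [Hom.src_map φ, Hom.src_map φ] at h
    rw [a.injOn_src hx hy h]
  · rintro _ ⟨x, hx, rfl⟩ _ ⟨y, hy, rfl⟩ h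
    rw [Hom.tgt_map φ, Hom.tgt_map φ] at h
    rw [a.injOn_tgt hx hy h]

end BisectionFun

variable [FiniteDimensional ℝ E]

section Map

variable (𝕜) in
/-- The push-forward `φ_+` along a morphism of étale Lie groupoids. -/
def mapCc (φ : G ⟶ H) : Cc 𝕜 E G.Arrow →ₗ[𝕜] Cc 𝕜 E H.Arrow :=
  pushforwardCc (Hom.isLocalHomeomorph φ) (Hom.hasSmoothLocalInverses φ)

theorem mapCc_id (u : Cc 𝕜 E G.Arrow) : mapCc 𝕜 (𝟙 G) u = u :=
  Subtype.ext (pushforward_id _ (fun _ => rfl) u.1)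

theorem mapCc_comp (φ : G ⟶ H) (ψ : H ⟶ K) (u : Cc 𝕜 E G.Arrow) :
    mapCc 𝕜 (φ ≫ ψ) u = mapCc 𝕜 ψ (mapCc 𝕜 φ u) :=
  have hc := Hom.isLocalHomeomorph (φ ≫ ψ)
  Subtype.ext (pushforward_pushforward (Hom.isLocalHomeomorph φ) (Hom.isLocalHomeomorph ψ) hc
    (fun _ => rfl) (Cc_le_fiberFinite hc u.2)).symm

theorem counitCc_mapCc [T2Space M] (φ : G ⟶ H) (u : Cc 𝕜 E G.Arrow) :
    counitCc H 𝕜 (mapCc 𝕜 φ u) = counitCc G 𝕜 u :=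
  Subtype.ext (pushforward_pushforward (Hom.isLocalHomeomorph φ) H.tgt_isLocalHomeomorph
    G.tgt_isLocalHomeomorph (Hom.tgt_map φ) (Cc_le_fiberFinite G.tgt_isLocalHomeomorph u.2))

theorem antipodeCc_mapCc (φ : G ⟶ H) (u : Cc 𝕜 E G.Arrow) :
    antipodeCc H 𝕜 (mapCc 𝕜 φ u) = mapCc 𝕜 φ (antipodeCc G 𝕜 u) := by
  have hc : IsLocalHomeomorph (H.inv ∘ Hom.toFun φ) :=
    H.inv_isLocalHomeomorph.comp (Hom.isLocalHomeomorph φ)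
  have hu := Cc_le_fiberFinite hc u.2
  have hφ := Hom.isLocalHomeomorph φ
  exact Subtype.ext
    ((pushforward_pushforward hφ H.inv_isLocalHomeomorph hc (fun _ => rfl) hu).trans
      (pushforward_pushforward G.inv_isLocalHomeomorph hφ hc (Hom.map_inv φ) hu).symm)

theorem mapCc_inclCc [T2Space M] [IsManifold 𝓘(ℝ, E) ∞ M] (φ : G ⟶ H) (r : CcAlg 𝕜 E M) :
    mapCc 𝕜 φ (inclCc G 𝕜 r) = inclCc H 𝕜 r :=
  Subtype.ext (pushforward_pushforward G.unit_isLocalHomeomorph (Hom.isLocalHomeomorph φ)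
    H.unit_isLocalHomeomorph (Hom.map_unit φ) (Cc_le_fiberFinite H.unit_isLocalHomeomorph r.2))

end Map

variable [T2Space M]

theorem mapCc_toCc (φ : G ⟶ H) {a : BisectionFun G 𝕜} {b : BisectionFun H 𝕜}
    (hb : b.dom = Hom.toFun φ '' a.dom) (h : ∀ x ∈ a.dom, b.fn (Hom.toFun φ x) = a.fn x) :
    mapCc 𝕜 φ a.toCc = b.toCc :=
  Subtype.ext ((pushforward_zeroExt (Hom.isLocalHomeomorph φ) a.isOpen (a.injOn_map φ) h).trans
    (congrArg (zeroExt · b.fn) hb.symm))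

theorem mapCc_convCc (φ : G ⟶ H) (u v : Cc 𝕜 E G.Arrow) :
    mapCc 𝕜 φ (convCc G 𝕜 u v) = convCc H 𝕜 (mapCc 𝕜 φ u) (mapCc 𝕜 φ v) := by
  induction u, v using BisectionFun.induction₂ with
  | zero_left v => simp only [map_zero, LinearMap.zero_apply]
  | zero_right u => simp only [map_zero]
  | add_left u u' v h h' => simp only [map_add, LinearMap.add_apply, h, h']
  | add_right u v v' h h' => simp only [map_add, h, h']
  | basic a b =>
    obtain ⟨a', ha, ha'⟩ := a.exists_map φ
    obtain ⟨b', hb, hb'⟩ := b.exists_map φ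
    have dom_eq : (a'.mul b').dom = Hom.toFun φ '' (a.mul b).dom :=
      (congrArg₂ H.setMul ha hb).trans (Hom.image_setMul φ _ _).symm
    rw [convCc_toCc, mapCc_toCc φ ha ha', mapCc_toCc φ hb hb', convCc_toCc]
    refine mapCc_toCc φ dom_eq ?_
    rintro _ ⟨⟨⟨x, y⟩, e⟩, ⟨hx, hy⟩, rfl⟩
    rw [Hom.map_mul φ, BisectionFun.mul_fn _ _ _ (ha ▸ Set.mem_image_of_mem _ hx)
      (hb ▸ Set.mem_image_of_mem _ hy), BisectionFun.mul_fn _ _ e hx hy]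
    exact congrArg₂ _ (ha' x hx) (hb' y hy)

variable [IsManifold 𝓘(ℝ, E) ∞ M]

theorem mapCc_lact (φ : G ⟶ H) (r : CcAlg 𝕜 E M) (u : Cc 𝕜 E G.Arrow) :
    mapCc 𝕜 φ ((convAlgebra G 𝕜).lact r u) = (convAlgebra H 𝕜).lact r (mapCc 𝕜 φ u) :=
  (mapCc_convCc φ (inclCc G 𝕜 r) u).trans
    (congrArg (convCc H 𝕜 · (mapCc 𝕜 φ u)) (mapCc_inclCc φ r))

theorem mapLL_comulCc (φ : G ⟶ H) (u : Cc 𝕜 E G.Arrow) :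
    (convAlgebra G 𝕜).mapLL (convAlgebra H 𝕜) (mapCc 𝕜 φ) (mapCc 𝕜 φ) (mapCc_lact φ)
      (mapCc_lact φ) (comulCc G 𝕜 u) = comulCc H 𝕜 (mapCc 𝕜 φ u) := by
  induction u using BisectionFun.induction with
  | zero => simp only [map_zero]
  | add u u' h h' => simp only [map_add, h, h']
  | basic a =>
    obtain ⟨b, hb, hb'⟩ := a.exists_map φ
    obtain ⟨c, hc, hc'⟩ := a.one.exists_map φ
    rw [comulCc_toCc_one, AlgebraOver.mapLL_mk, mapCc_toCc φ hb hb', mapCc_toCc φ hc hc']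
    refine (comulCc_toCc rfl (hc.trans hb.symm) fun y hy => ?_).symm
    rw [hb] at hy
    obtain ⟨x, hx, rfl⟩ := hy
    rw [hb' x hx, hc' x hx, a.fn_mul_one hx]

variable (G 𝕜) in
/-- The Hopf algebroid of smooth functions with compact support on an étale Lie groupoid. -/
def hopfAlgebroid : HopfAlgebroidStr 𝕜 (CcAlg 𝕜 E M) (Cc 𝕜 E G.Arrow) where
  toAlgebraOver := convAlgebra G 𝕜
  comul := comulCc G 𝕜
  counit := counitCc G 𝕜
  antipode := antipodeCc G 𝕜
  comul_lact := comulCc_lact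
  counit_lact := counitCc_lact
  id_counit := idCounit_comulCc
  counit_id := counitId_comulCc
  counit_incl := counitCc_inclCc
  comul_incl := comulCc_inclCc
  ract_comul := ract_comulCc
  comul_mul _ _ _ _ := comulCc_mul
  antipode_incl := antipodeCc_inclCc
  antipode_antipode := antipodeCc_antipodeCc
  antipode_mul := antipodeCc_convCc
  mul_antipode_id := mul_antipodeCc

theorem isGroupoidHopfAlgebroid_hopfAlgebroid :
    IsGroupoidHopfAlgebroid G (hopfAlgebroid G 𝕜) where
  mul_eq := coe_convCc
  incl_eq _ := rfl
  comul_eq u x := by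
    rw [← omega_mkLL]
    exact ⟨fun h => (congrArg (omega G 𝕜) h.symm).trans (omega_comulCc u),
      fun h => omega_injective ((omega_comulCc u).trans h.symm)⟩
  counit_eq _ := rfl
  antipode_eq _ := rfl

variable (E M 𝕜) in
/-- The functor `G ↦ C_c^∞(G)`, `φ ↦ φ_+`. -/
def hopfFunctor : EtGrpd.{u} E M ⥤ HoAlgd 𝕜 (CcAlg 𝕜 E M) where
  obj G := ⟨Cc 𝕜 E G.Arrow, hopfAlgebroid G 𝕜⟩
  map φ :=
    { toLin := mapCc 𝕜 φ
      map_mul := mapCc_convCc φ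
      map_incl := mapCc_inclCc φ
      map_counit := counitCc_mapCc φ
      map_comul := mapLL_comulCc φ
      map_antipode := antipodeCc_mapCc φ }
  map_id _ := HoAlgd.Hom.ext (LinearMap.ext mapCc_id)
  map_comp φ ψ := HoAlgd.Hom.ext (LinearMap.ext (mapCc_comp φ ψ))

end EtGrpd

end GroupoidHopf

end

open GroupoidHopf in
theorem proposition18 (𝕜 : Type z) [RCLike 𝕜]
    (E : Type v) [NormedAddCommGroup E] [NormedSpace ℝ E] [FiniteDimensional ℝ E]
    (M : Type w) [TopologicalSpace M] [T2Space M] [ChartedSpace E M]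
    [IsManifold 𝓘(ℝ, E) ∞ M] :
    ∃ H : ∀ G : EtGrpd.{u} E M, HopfAlgebroidStr 𝕜 (CcAlg 𝕜 E M) (Cc 𝕜 E G.Arrow),
      (∀ G, IsGroupoidHopfAlgebroid G (H G) ∧ (H G).IsCocommutative ∧ (H G).IsCoassociative) ∧
      ∃ (F : EtGrpd.{u} E M ⥤ HoAlgd 𝕜 (CcAlg 𝕜 E M))
        (hF : ∀ G, F.obj G = ⟨Cc 𝕜 E G.Arrow, H G⟩),
        ∀ (G G' : EtGrpd.{u} E M) (φ : G ⟶ G') (a : Cc 𝕜 E G.Arrow),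
          ((HoAlgd.Hom.toLin (eqToHom (hF G).symm ≫ F.map φ ≫ eqToHom (hF G')) a :
              Cc 𝕜 E G'.Arrow) : GermSection 𝕜 G'.Arrow) =
            pushforward (EtGrpd.Hom.isLocalHomeomorph φ) (a : GermSection 𝕜 G.Arrow) := by
  refine ⟨fun G => EtGrpd.hopfAlgebroid G 𝕜, fun G =>
    ⟨EtGrpd.isGroupoidHopfAlgebroid_hopfAlgebroid, EtGrpd.flipLL_comulCc, EtGrpd.comulId_comulCc⟩,
    EtGrpd.hopfFunctor E M 𝕜, fun _ => rfl, fun G G' φ a => ?_⟩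
  rfl
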